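/- **Setting.** Let $(Y_i,D_i,X_i)$, $i\ge 1$, be i.i.d., $D_i\in\{0,1\}$, where $X_i$ has Lebesgue density $f$, and let $c\in\mathbb R$. For $k=Y,D$ let $m_k(x)$ be the conditional mean, and let $\sigma_Y^2(x),\sigma_D^2(x),\sigma_{YD}(x)$ be the conditional variances and covariance of $(Y_i,D_i)$ given $X_i=x$; for such a function $g$ write $g_{+}(c)$, $g_-(c)$ for its right and left limit at $c$, and likewise $m_{kj}^{(l)}(c)$, $j=+,-$, for the one-sided limits of the derivatives. For an open set $U$ let $\mathcal G_k(U)$ be the class of $k$ times continuously differentiable functions on $U$ whose $k$-th derivative is Hölder continuous with some exponent $\alpha\in(0,1]$. Assume: - $K$ is a continuous, compactly supported, symmetric second-order kernel ($\int K=1$, $\int u^2K(u)\,du\ne0$). - $f$ is bounded, $f(c)>0$, and $f\in\mathcal G_1$ on an open neighbourhood of $c$. - For some $\delta>0$, on each of $(c,c+\delta)$ and $(c-\delta,c)$: $Y$ has a conditional second moment, $m_Y\in\mathcal G_3$, and $\sigma_Y^2,\sigma_{YD}\in\mathcal G_0$; $m_D$ is three times differentiable there, and the one-sided limits at $c$ of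 $m_D,m_D^{(2)},m_D^{(3)},\sigma_D^2$ exist. Moreover $\sigma_{Yj}^2(c)>0$, $\sigma_{Dj}^2(c)>0$. - $\tau_D:=m_{D+}(c)-m_{D-}(c)\neq 0$. Put $\tau=(m_{Y+}(c)-m_{Y-}(c))/\tau_D$, $\mu_i=\int_0^\infty u^iK(u)\,du$, $\nu_i=\int_0^\infty u^iK(u)^2du$, $\Delta=\mu_0\mu_2-\mu_1^2$ (taken to be nonzero, as is automatic for $K\ge0$), $$C_1=\frac{\mu_2^2-\mu_1\mu_3}{2\Delta},\quad v=\frac{\mu_2^2\nu_0-2\mu_1\mu_2\nu_1+\mu_1^2\nu_2}{\Delta^2},\quad \xi_1=\frac{\mu_2\mu_3-\mu_1\mu_4}{\Delta},\quad \xi_2=\frac{(\mu_2^2-\mu_1\mu_3)(\mu_0\mu_3-\mu_1\mu_2)}{\Delta^2},$$ and for $j=+,-$ (read as $\pm1$ in the factor $-j$) $$\omega_j=\sigma_{Yj}^2(c)+\tau^2\sigma_{Dj}^2(c)-2\tau\sigma_{YDj}(c),\quad \phi_j=C_1\bigl[m_{Yj}^{(2)}(c)-\tau m_{Dj}^{(2)}(c)\bigr],\quad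 \psi_j=\zeta_{Yj}-\tau\zeta_{Dj},$$ $$\zeta_{kj}=(-j)\Bigl\{\xi_1\Bigl[\tfrac{m_{kj}^{(2)}(c)}2\tfrac{f'(c)}{f(c)}+\tfrac{m_{kj}^{(3)}(c)}6\Bigr]-\xi_2\tfrac{m_{kj}^{(2)}(c)}2\tfrac{f'(c)}{f(c)}\Bigr\}.$$ Assume $\omega_+,\omega_->0$, $\phi_+\phi_-\ne0$ and, if $\phi_+\phi_->0$, also $\psi_+-(\phi_+/\phi_-)^{3/2}\psi_-\neq0$. **AFO bandwidths.** For $n\ge1$ let $(h_+^\dagger,h_-^\dagger)\in(0,\infty)^2$ (depending on $n$) be the asymptotically first-order optimal bandwidths: if $\phi_+\phi_-<0$, a minimizer over $(0,\infty)^2$ of $$\frac1{\tau_D^2}\{\phi_+h_+^2-\phi_-h_-^2\}^2+\frac{v}{nf(c)\tau_D^2}\Bigl\{\frac{\omega_+}{h_+}+\frac{\omega_-}{h_-}\Bigr\};$$ if $\phi_+\phi_->0$, a minimizer of $$\frac1{\tau_D^2}\{\psi_+h_+^3-\psi_-h_-^3\}^2+\frac{v}{nf(c)\tau_D^2}\Bigl\{\frac{\omega_+}{h_+}+\frac{\omega_-}{h_-}\Bigr\}$$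 over the $(h_+,h_-)\in(0,\infty)^2$ with $\phi_+h_+^2-\phi_-h_-^2=0$. **Feasible bandwidths.** Let $\hat\phi_j,\hat\psi_j,\hat\omega_j,\hat f$ (depending on $n$) converge in probability to $\phi_j,\psi_j,\omega_j,f(c)$, and let $(\hat h_+,\hat h_-)$ minimize over $(0,\infty)^2$, whenever a minimizer exists, $$MMSE_n^p(h_+,h_-)=\{\hat\phi_+h_+^2-\hat\phi_-h_-^2\}^2+\{\hat\psi_+h_+^3-\hat\psi_-h_-^3\}^2+\frac{v}{n\hat f}\Bigl\{\frac{\hat\omega_+}{h_+}+\frac{\hat\omega_-}{h_-}\Bigr\}.$$ **Mean squared error.** Let $\hat\tau=\hat\tau_Y/\hat\tau_D$, where $\hat\tau_Y$ (resp. $\hat\tau_D$) is the difference of the local linear regression estimators, with kernel $K$, of $m_{Y\pm}(c)$ (resp. $m_{D\pm}(c)$) computed from the observations with $X_i\ge c$ and bandwidth $h_+$, and from those with $X_i<c$ and bandwidth $h_-$. For $0<r<|\tau_D|$ let $$MSE_n(h_+,h_-)=E\bigl[(\hat\tau-\tau)^2\,\mathbf 1\{|\hat\tau_D|\ge r\}\,\big|\,X_1,\dots,X_n\bigr].$$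 **Theorem.** As $n\to\infty$, $$\frac{\hat h_+}{h_+^\dagger}\xrightarrow{p}1,\qquad \frac{\hat h_-}{h_-^\dagger}\xrightarrow{p}1,\qquad \frac{MMSE_n^p(\hat h_+,\hat h_-)}{\tau_D^2\,MSE_n(h_+^\dagger,h_-^\dagger)}\xrightarrow{p}1\quad\text{for every } 0<r<|\tau_D|.$$ The bandwidths $h_+^\dagger,h_-^\dagger$ are of exact order $n^{-1/5}$ if $\phi_+\phi_-<0$, and of exact order $n^{-1/7}$ if $\phi_+\phi_->0$. -/

import Mathlib

open MeasureTheory ProbabilityTheory Filter Topology Set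

open scoped ENNReal Asymptotics

namespace FRD

noncomputable section

/-- The side of the cut-off: `pos` is the index `+` (right), `neg` is the index `-` (left). -/
inductive Side where
  | pos : Side
  | neg : Side

namespace Side

/-- The index `j = +, -` read as the number `+1, -1`. -/
def sign : Side → ℝ
  | pos => 1
  | neg => -1

/-- One-sided punctured neighbourhoods of `c`. -/
def nhds (c : ℝ) : Side → Filter ℝ
  | pos => 𝓝[>] c
  | neg => 𝓝[<] c

/-- The one-sided open neighbourhood `(c, c + δ)` or `(c - δ, c)`. -/
def interval (c δ : ℝ) : Side → Set ℝ
  | pos => Ioo c (c + δ)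
  | neg => Ioo (c - δ) c

/-- The values of the assignment variable used on each side of the cut-off. -/
def region (c : ℝ) : Side → Set ℝ
  | pos => Ici c
  | neg => Iio c

/-- One-sided limit of `g` at `c`. -/
def limit (c : ℝ) (g : ℝ → ℝ) : Side → ℝ
  | pos => Function.rightLim g c
  | neg => Function.leftLim g c

end Side

/-! ### Kernel constants -/

/-- A symmetric second-order kernel, continuous with compact support. -/
structure IsSecondOrderKernel (K : ℝ → ℝ) : Prop where
  continuous : Continuous K
  hasCompactSupport : HasCompactSupport K
  symmetric : ∀ u, K (-u) = K u
  integral_eq_one : ∫ u, K u = 1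
  second_moment_ne_zero : ∫ u, u ^ 2 * K u ≠ 0

/-- `μ_i = ∫_0^∞ u^i K(u) du`. -/
def mu (K : ℝ → ℝ) (i : ℕ) : ℝ := ∫ u in Ioi (0 : ℝ), u ^ i * K u

/-- `ν_i = ∫_0^∞ u^i K(u)^2 du`. -/
def nu (K : ℝ → ℝ) (i : ℕ) : ℝ := ∫ u in Ioi (0 : ℝ), u ^ i * K u ^ 2

def constC1 (K : ℝ → ℝ) : ℝ :=
  (mu K 2 ^ 2 - mu K 1 * mu K 3) / (2 * (mu K 0 * mu K 2 - mu K 1 ^ 2))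

def constV (K : ℝ → ℝ) : ℝ :=
  (mu K 2 ^ 2 * nu K 0 - 2 * mu K 1 * mu K 2 * nu K 1 + mu K 1 ^ 2 * nu K 2) /
    (mu K 0 * mu K 2 - mu K 1 ^ 2) ^ 2

def xi1 (K : ℝ → ℝ) : ℝ :=
  (mu K 2 * mu K 3 - mu K 1 * mu K 4) / (mu K 0 * mu K 2 - mu K 1 ^ 2)

def xi2 (K : ℝ → ℝ) : ℝ :=
  (mu K 2 ^ 2 - mu K 1 * mu K 3) * (mu K 0 * mu K 3 - mu K 1 * mu K 2) /
    (mu K 0 * mu K 2 - mu K 1 ^ 2) ^ 2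

/-! ### Population quantities

`κ` is the conditional law of `(Y, D)` given `X = x`; the first coordinate is the outcome `Y`,
the second one is the treatment status `D`. -/

/-- Conditional mean of `g (Y, D)` given `X = x`. -/
def condMean (κ : Kernel ℝ (ℝ × ℝ)) (g : ℝ × ℝ → ℝ) (x : ℝ) : ℝ := ∫ p, g p ∂(κ x)

/-- Conditional covariance of `g₁ (Y, D)` and `g₂ (Y, D)` given `X = x`. -/
def condCov (κ : Kernel ℝ (ℝ × ℝ)) (g₁ g₂ : ℝ × ℝ → ℝ) (x : ℝ) : ℝ :=
  ∫ p, (g₁ p - condMean κ g₁ x) * (g₂ p - condMean κ g₂ x) ∂(κ x)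

/-- `m_{Y}(x)`. -/
def mY (κ : Kernel ℝ (ℝ × ℝ)) : ℝ → ℝ := condMean κ Prod.fst

/-- `m_{D}(x)`. -/
def mD (κ : Kernel ℝ (ℝ × ℝ)) : ℝ → ℝ := condMean κ Prod.snd

/-- `σ_Y²(x)`. -/
def varY (κ : Kernel ℝ (ℝ × ℝ)) : ℝ → ℝ := condCov κ Prod.fst Prod.fst

/-- `σ_D²(x)`. -/
def varD (κ : Kernel ℝ (ℝ × ℝ)) : ℝ → ℝ := condCov κ Prod.snd Prod.snd

/-- `σ_{YD}(x)`. -/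
def covYD (κ : Kernel ℝ (ℝ × ℝ)) : ℝ → ℝ := condCov κ Prod.fst Prod.snd

/-- `τ_D(c) = m_{D+}(c) - m_{D-}(c)`. -/
def tauD (κ : Kernel ℝ (ℝ × ℝ)) (c : ℝ) : ℝ :=
  Side.limit c (mD κ) .pos - Side.limit c (mD κ) .neg

/-- `τ(c) = (m_{Y+}(c) - m_{Y-}(c)) / (m_{D+}(c) - m_{D-}(c))`. -/
def tau (κ : Kernel ℝ (ℝ × ℝ)) (c : ℝ) : ℝ :=
  (Side.limit c (mY κ) .pos - Side.limit c (mY κ) .neg) / tauD κ c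

/-- `ω_j(c)`. -/
def omega (κ : Kernel ℝ (ℝ × ℝ)) (c : ℝ) (j : Side) : ℝ :=
  Side.limit c (varY κ) j + tau κ c ^ 2 * Side.limit c (varD κ) j
    - 2 * tau κ c * Side.limit c (covYD κ) j

/-- `φ_j(c)`. -/
def phi (K : ℝ → ℝ) (κ : Kernel ℝ (ℝ × ℝ)) (c : ℝ) (j : Side) : ℝ :=
  constC1 K * (Side.limit c (iteratedDeriv 2 (mY κ)) j
    - tau κ c * Side.limit c (iteratedDeriv 2 (mD κ)) j)

/-- `ζ_{kj}(c)` for the conditional mean function `m = m_k`. -/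
def zeta (K f m : ℝ → ℝ) (c : ℝ) (j : Side) : ℝ :=
  -j.sign *
    (xi1 K * (Side.limit c (iteratedDeriv 2 m) j / 2 * (deriv f c / f c)
        + Side.limit c (iteratedDeriv 3 m) j / 6)
      - xi2 K * (Side.limit c (iteratedDeriv 2 m) j / 2 * (deriv f c / f c)))

/-- `ψ_j(c)`. -/
def psi (K f : ℝ → ℝ) (κ : Kernel ℝ (ℝ × ℝ)) (c : ℝ) (j : Side) : ℝ :=
  zeta K f (mY κ) c j - tau κ c * zeta K f (mD κ) c j

/-! ### Regularity assumptions -/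

/-- The class `𝒢_k(U)`: `k` times continuously differentiable on `U`, with Hölder continuous
`k`-th derivative. -/
def HolderClass (k : ℕ) (U : Set ℝ) (g : ℝ → ℝ) : Prop :=
  ContDiffOn ℝ k g U ∧
    ∃ M : ℝ, 0 < M ∧ ∃ α : ℝ, 0 < α ∧ α ≤ 1 ∧
      ∀ x ∈ U, ∀ y ∈ U, |iteratedDeriv k g x - iteratedDeriv k g y| ≤ M * |x - y| ^ α

/-- `f` is nonnegative, bounded above, strictly positive
at `c`, and in `𝒢_1` on an open neighbourhood of `c`. -/
structure RegularDensity (f : ℝ → ℝ) (c : ℝ) : Prop where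
  measurable : Measurable f
  nonneg : ∀ x, 0 ≤ f x
  bounded : ∃ M, ∀ x, f x ≤ M
  pos : 0 < f c
  holder : ∃ U : Set ℝ, IsOpen U ∧ c ∈ U ∧ HolderClass 1 U f

/-- Regularity of the conditional moments on side `j` of the cut-off. -/
structure RegularSide (κ : Kernel ℝ (ℝ × ℝ)) (c : ℝ) (j : Side) : Prop where
  /-- Near the cut-off `Y` has a conditional second moment; `m_Y` is in `𝒢_3`, and `σ_Y²`,
  `σ_{YD}` are in `𝒢_0`. -/
  outcome : ∃ δ > 0,
    (∀ x ∈ Side.interval c δ j, Integrable (fun p : ℝ × ℝ => p.1 ^ 2) (κ x)) ∧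
    HolderClass 3 (Side.interval c δ j) (mY κ) ∧
    HolderClass 0 (Side.interval c δ j) (varY κ) ∧
    HolderClass 0 (Side.interval c δ j) (covYD κ)
  /-- `m_D` is three times differentiable near the cut-off. -/
  treatment : ∃ δ > 0, ∀ k < 3,
    DifferentiableOn ℝ (iteratedDeriv k (mD κ)) (Side.interval c δ j)
  /-- The one-sided limits of `m_D`, `m_D''`, `m_D'''` and `σ_D²` exist. -/
  limit_mD : ∃ l, Tendsto (mD κ) (Side.nhds c j) (𝓝 l)
  limit_mD_two : ∃ l, Tendsto (iteratedDeriv 2 (mD κ)) (Side.nhds c j) (𝓝 l)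
  limit_mD_three : ∃ l, Tendsto (iteratedDeriv 3 (mD κ)) (Side.nhds c j) (𝓝 l)
  limit_varD : ∃ l, Tendsto (varD κ) (Side.nhds c j) (𝓝 l)
  varY_pos : 0 < Side.limit c (varY κ) j
  varD_pos : 0 < Side.limit c (varD κ) j

/-! ### The estimator and its mean squared error -/

/-- `S_k = ∑_i K((x_i - c)/h) (x_i - c)^k w_i` over the observations on side `j`. -/
def wsum (K : ℝ → ℝ) (c h : ℝ) (j : Side) {n : ℕ} (x w : Fin n → ℝ) (k : ℕ) : ℝ :=
  ∑ i, (Side.region c j).indicator (fun t => K ((t - c) / h) * (t - c) ^ k) (x i) * w i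

/-- The local linear regression estimator at `c` from the observations on side `j` with
bandwidth `h`: the intercept of the kernel-weighted least squares line, obtained by solving the
two normal equations. -/
def llr (K : ℝ → ℝ) (c h : ℝ) (j : Side) {n : ℕ} (x y : Fin n → ℝ) : ℝ :=
  (wsum K c h j x 1 2 * wsum K c h j x y 0 - wsum K c h j x 1 1 * wsum K c h j x y 1) /
    (wsum K c h j x 1 0 * wsum K c h j x 1 2 - wsum K c h j x 1 1 ^ 2)

/-- Estimated jump at the cut-off of the regression of `y` on `x`, with bandwidths `h_+, h_-`. -/
def jumpHat (K : ℝ → ℝ) (c : ℝ) (h : Side → ℝ) {n : ℕ} (x y : Fin n → ℝ) : ℝ :=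
  llr K c (h .pos) .pos x y - llr K c (h .neg) .neg x y

/-- The estimator `τ̂(c)`; `z i = (Y_i, D_i)`. -/
def tauHat (K : ℝ → ℝ) (c : ℝ) (h : Side → ℝ) {n : ℕ} (x : Fin n → ℝ) (z : Fin n → ℝ × ℝ) : ℝ :=
  jumpHat K c h x (fun i => (z i).1) / jumpHat K c h x (fun i => (z i).2)

/-- The mean squared error of `τ̂(c)`, conditional on `X_i = x i` for all `i`, on the event
`|τ̂_D(c)| ≥ r`. Given the `X_i`, the pairs `(Y_i, D_i)` are independent with laws `κ (x i)`. -/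
def condMSE (K : ℝ → ℝ) (κ : Kernel ℝ (ℝ × ℝ)) (c r : ℝ) (h : Side → ℝ) {n : ℕ}
    (x : Fin n → ℝ) : ℝ :=
  ∫ z in {z : Fin n → ℝ × ℝ | r ≤ |jumpHat K c h x (fun i => (z i).2)|},
    (tauHat K c h x z - tau κ c) ^ 2 ∂(Measure.pi fun i => κ (x i))

/-! ### Optimality criteria -/

/-- Admissible pairs of bandwidths. -/
def bandwidths : Set (Side → ℝ) := {h | ∀ j, 0 < h j}

/-- `a_+ h_+^k - a_- h_-^k`. -/
def biasTerm (a : Side → ℝ) (k : ℕ) (h : Side → ℝ) : ℝ :=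
  a .pos * h .pos ^ k - a .neg * h .neg ^ k

/-- `v / (n f) (w_+ / h_+ + w_- / h_-)`. -/
def varTerm (v f₀ : ℝ) (w : Side → ℝ) (n : ℕ) (h : Side → ℝ) : ℝ :=
  v / (n * f₀) * (w .pos / h .pos + w .neg / h .neg)

/-- `AMSE_{1n}`. -/
def AMSE1 (K f : ℝ → ℝ) (κ : Kernel ℝ (ℝ × ℝ)) (c : ℝ) (n : ℕ) (h : Side → ℝ) : ℝ :=
  1 / tauD κ c ^ 2 * biasTerm (phi K κ c) 2 h ^ 2
    + 1 / tauD κ c ^ 2 * varTerm (constV K) (f c) (omega κ c) n h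

/-- `AMSE_{2n}`. -/
def AMSE2 (K f : ℝ → ℝ) (κ : Kernel ℝ (ℝ × ℝ)) (c : ℝ) (n : ℕ) (h : Side → ℝ) : ℝ :=
  1 / tauD κ c ^ 2 * biasTerm (psi K f κ c) 3 h ^ 2
    + 1 / tauD κ c ^ 2 * varTerm (constV K) (f c) (omega κ c) n h

/-- `h` is a minimizer of `F` over `S`. -/
def IsMinimizer (F : (Side → ℝ) → ℝ) (S : Set (Side → ℝ)) (h : Side → ℝ) : Prop :=
  h ∈ S ∧ IsMinOn F S h

/-- `h` is the pair of asymptotically first-order optimal bandwidths for sample size `n`. -/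
def IsAFO (K f : ℝ → ℝ) (κ : Kernel ℝ (ℝ × ℝ)) (c : ℝ) (n : ℕ) (h : Side → ℝ) : Prop :=
  (phi K κ c .pos * phi K κ c .neg < 0 → IsMinimizer (AMSE1 K f κ c n) bandwidths h) ∧
  (0 < phi K κ c .pos * phi K κ c .neg →
    IsMinimizer (AMSE2 K f κ c n) {h ∈ bandwidths | biasTerm (phi K κ c) 2 h = 0} h)

/-- The plug-in modified criterion `MMSE_n^p`, a function of the pilot values `φ̂, ψ̂, f̂, ω̂`. -/
def MMSE (K : ℝ → ℝ) (phiHat psiHat : Side → ℝ) (fHat : ℝ) (omegaHat : Side → ℝ) (n : ℕ)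
    (h : Side → ℝ) : ℝ :=
  biasTerm phiHat 2 h ^ 2 + biasTerm psiHat 3 h ^ 2 + varTerm (constV K) fHat omegaHat n h

end

end FRD

/-! Let `a` be the scale with `a^5 = v / (n f(c))` if `φ_+ φ_- < 0`, and `a^7 = v / (n f(c))` if
`φ_+ φ_- > 0`, and write `h = a t`. Each AFO criterion becomes a power of `a` times a function `G`
of `t` that does not depend on `n`. Midpoint convexity of the squared bias (in the second case, on
the ray cut out by the constraint) and strict convexity of `1/x` make the minimizer `t*` of `G`
unique. Hence `h† = a t*` exactly, which also gives the orders `n^{-1/5}` and `n^{-1/7}`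
(`exists_eq_rate_mul_of_neg`, `exists_eq_rate_mul_of_pos`).

The plug-in criterion rescales to a perturbation of the same problem. For opposite signs, dividing
by `a^4` leaves the squared cubic bias with weight `a^2 → 0`, so it disappears. For equal signs,
dividing by `a^6` leaves the squared quadratic bias with weight `a^{-2} → ∞`, so it acts as a
penalty that enforces the constraint in the limit. The general principle is `tendsto_minimizer`, a
Gamma-convergence argument: equi-coercivity, a recovery family, a lower bound along convergent
families and uniqueness give convergence of minimizers and of minima. Coercivity for equal signs is
where `ψ_+ - (φ_+/φ_-)^{3/2} ψ_- ≠ 0` enters: the two bias terms then have no common zero.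

For the mean squared error, condition on the design. Then `τ̂ - τ` is a linear statistic in `Y - τ
D` divided by `τ̂_D`, and on `|τ̂_D| ≥ r` replacing `τ̂_D` by `τ_D` costs at most `ε + C (τ̂_D -
τ_D)^2` in relative terms. Because `D` is bounded, independence bounds the resulting mixed moment
using only second moments of `Y` (`centredPair_sum`, `abs_condMSE_sub_le`). What remains is squared
bias plus variance of local linear estimators, computed from one-sided Taylor expansions and laws of
large numbers for kernel moments; the third-order bias needs these moments up to `o(h)`, where
`f'(c)` appears (`tendsto_llr_sub_div_cube`). When the second-order biases of the two sides cancel,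
the third-order ones remain.

Thus the minimum of the plug-in criterion and `τ_D^2 MSE` at the AFO bandwidths, divided by the same
power of `a`, have the same positive limit `G(t*)`. Convergence in probability is expressed as
convergence along a filter `inProb P` on `ℕ × Ω`, so that the deterministic limit calculus,
including the minimizer argument, applies to random quantities directly. -/

namespace FRD

/-! ### Convergence in probability as convergence along a filter -/

section InProb

variable {Ω : Type*} [MeasurableSpace Ω] {P : Measure Ω}

/-- The filter on `ℕ × Ω` of the events whose sections have probability tending to one. -/
def inProb (P : Measure Ω) : Filter (ℕ × Ω) where
  sets := {s | Tendsto (fun n => P {ω | (n, ω) ∉ s}) atTop (𝓝 0)}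
  univ_sets := by simp
  sets_of_superset {s t} hs hst :=
    tendsto_of_tendsto_of_tendsto_of_le_of_le tendsto_const_nhds hs (fun _ => zero_le)
      fun n => measure_mono fun ω hω h => hω (hst h)
  inter_sets {s t} hs ht := by
    have h : Tendsto (fun n => P {ω | (n, ω) ∉ s} + P {ω | (n, ω) ∉ t}) atTop (𝓝 0) := by
      simpa using Tendsto.add hs ht
    refine tendsto_of_tendsto_of_tendsto_of_le_of_le tendsto_const_nhds h (fun _ => zero_le)
      fun n => (measure_mono fun ω hω => ?_).trans (measure_union_le _ _)
    simp only [mem_ofPred_eq, mem_inter_iff, not_and_or] at hω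
    exact hω

theorem eventually_inProb {p : ℕ × Ω → Prop} :
    (∀ᶠ q in inProb P, p q) ↔ Tendsto (fun n => P {ω | ¬ p (n, ω)}) atTop (𝓝 0) :=
  Iff.rfl

theorem tendsto_inProb_iff {Z : ℕ → Ω → ℝ} {z : ℝ} :
    Tendsto (fun q : ℕ × Ω => Z q.1 q.2) (inProb P) (𝓝 z) ↔
      TendstoInMeasure P Z atTop fun _ => z := by
  rw [tendstoInMeasure_iff_dist, Metric.tendsto_nhds]
  simp only [eventually_inProb, not_lt]

theorem eventually_inProb_of_atTop {p : ℕ → Prop} (h : ∀ᶠ n in atTop, p n) :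
    ∀ᶠ q : ℕ × Ω in inProb P, p q.1 := by
  rw [eventually_inProb]
  refine tendsto_const_nhds.congr' ?_
  filter_upwards [h] with n hn
  simp [hn]

theorem tendsto_fst_inProb : Tendsto (Prod.fst : ℕ × Ω → ℕ) (inProb P) atTop :=
  fun _ hs => eventually_inProb_of_atTop hs

theorem eventually_inProb_of_ae {p : ℕ × Ω → Prop} (h : ∀ n, ∀ᵐ ω ∂P, p (n, ω)) :
    ∀ᶠ q in inProb P, p q := by
  rw [eventually_inProb]
  refine tendsto_const_nhds.congr fun n => ?_
  exact (ae_iff.1 (h n)).symm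

end InProb

/-! ### One-sided neighbourhoods and expansions -/

namespace Side

variable {c δ x : ℝ} {j : Side}

theorem sign_mul_self (j : Side) : j.sign * j.sign = 1 := by cases j <;> simp [sign]

theorem abs_sign (j : Side) : |j.sign| = 1 := by cases j <;> simp [sign]

theorem mem_interval_iff : x ∈ interval c δ j ↔ 0 < j.sign * (x - c) ∧ j.sign * (x - c) < δ := by
  cases j <;> simp only [interval, sign, mem_Ioo] <;> constructor <;> rintro ⟨h, h'⟩ <;>
    constructor <;> linarith

theorem abs_sub_of_pos (h : 0 < j.sign * (x - c)) : |x - c| = j.sign * (x - c) := by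
  rw [← abs_of_pos h, abs_mul, abs_sign, one_mul]

theorem isOpen_interval : IsOpen (interval c δ j) := by
  cases j <;> exact isOpen_Ioo

theorem convex_interval : Convex ℝ (interval c δ j) := by
  cases j <;> exact convex_Ioo _ _

theorem interval_mem_nhds (h : 0 < δ) : interval c δ j ∈ nhds c j := by
  cases j
  · exact Ioo_mem_nhdsGT (by linarith)
  · exact Ioo_mem_nhdsLT (by linarith)

theorem exists_interval_subset {s : Set ℝ} (h : s ∈ nhds c j) :
    ∃ δ > 0, interval c δ j ⊆ s := by
  cases j
  · obtain ⟨u, hu, hs⟩ := mem_nhdsGT_iff_exists_Ioo_subset.1 h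
    exact ⟨u - c, by simpa using hu, by simpa [interval] using hs⟩
  · obtain ⟨u, hu, hs⟩ := mem_nhdsLT_iff_exists_Ioo_subset.1 h
    exact ⟨c - u, by simpa using hu, by simpa [interval] using hs⟩

theorem interval_mono {δ' : ℝ} (h : δ ≤ δ') : interval c δ j ⊆ interval c δ' j := fun x hx => by
  rw [mem_interval_iff] at hx ⊢
  exact ⟨hx.1, hx.2.trans_le h⟩

instance nhds_neBot : (nhds c j).NeBot := by
  cases j
  · exact inferInstanceAs (𝓝[>] c).NeBot
  · exact inferInstanceAs (𝓝[<] c).NeBot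

theorem nhds_le : nhds c j ≤ 𝓝 c := by
  cases j <;> exact nhdsWithin_le_nhds

theorem limit_eq {g : ℝ → ℝ} {l : ℝ} (h : Tendsto g (nhds c j) (𝓝 l)) : limit c g j = l := by
  cases j
  · exact rightLim_eq_of_tendsto h
  · exact leftLim_eq_of_tendsto h

/-- `Side.limit` has a default value where no one-sided limit exists, so existence has to be
supplied before it means anything. -/
theorem tendsto_limit {g : ℝ → ℝ} (h : ∃ l, Tendsto g (nhds c j) (𝓝 l)) :
    Tendsto g (nhds c j) (𝓝 (limit c g j)) := by
  obtain ⟨l, hl⟩ := h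
  rwa [limit_eq hl]

/-- A function that is Hölder continuous on a one-sided neighbourhood has a one-sided limit. -/
theorem exists_tendsto_of_holder {g : ℝ → ℝ} {M α : ℝ} (hδ : 0 < δ) (hM : 0 < M) (hα : 0 < α)
    (h : ∀ x ∈ interval c δ j, ∀ y ∈ interval c δ j, |g x - g y| ≤ M * |x - y| ^ α) :
    ∃ l, Tendsto g (nhds c j) (𝓝 l) := by
  refine cauchy_map_iff_exists_tendsto.1 (Metric.cauchy_iff.2 ⟨inferInstance, fun ε hε => ?_⟩)
  have hlim : Tendsto (fun η : ℝ => M * η ^ α) (𝓝[>] 0) (𝓝 0) := by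
    have : Tendsto (fun η : ℝ => M * η ^ α) (𝓝 0) (𝓝 (M * 0 ^ α)) :=
      ((Real.continuousAt_rpow_const 0 α (Or.inr hα.le)).tendsto).const_mul M
    rw [Real.zero_rpow hα.ne', mul_zero] at this
    exact this.mono_left nhdsWithin_le_nhds
  obtain ⟨η, hη, hη0⟩ := ((hlim.eventually_lt_const hε).and self_mem_nhdsWithin).exists
  have hη0 : 0 < η := hη0
  refine ⟨g '' interval c (min δ η) j, image_mem_map (interval_mem_nhds (lt_min hδ hη0)), ?_⟩
  rintro _ ⟨x, hx, rfl⟩ _ ⟨y, hy, rfl⟩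
  have hx' := mem_interval_iff.1 hx
  have hy' := mem_interval_iff.1 hy
  rw [Real.dist_eq]
  refine (h x (interval_mono (min_le_left _ _) hx) y
    (interval_mono (min_le_left _ _) hy)).trans_lt (lt_of_le_of_lt ?_ hη)
  have hxy : |x - y| ≤ η := by
    have e : |x - y| = |j.sign * (x - c) - j.sign * (y - c)| := by
      rw [← mul_sub, abs_mul, abs_sign, one_mul]; congr 1; ring
    have := min_le_right δ η
    rw [e, abs_le]; constructor <;> linarith [hx'.1, hx'.2, hy'.1, hy'.2]
  gcongr

/-- A derivative with a limit is bounded near `c`, so `g` is Lipschitz there: the Hölder case with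
exponent one. -/
theorem exists_tendsto_of_deriv {g : ℝ → ℝ} {l : ℝ} (hδ : 0 < δ)
    (hg : DifferentiableOn ℝ g (interval c δ j)) (h : Tendsto (deriv g) (nhds c j) (𝓝 l)) :
    ∃ l', Tendsto g (nhds c j) (𝓝 l') := by
  have hb : ∀ᶠ x in nhds c j, |deriv g x| < |l| + 1 :=
    h.abs.eventually_lt_const (by linarith)
  obtain ⟨η, hη, hs⟩ := exists_interval_subset (hb.and (interval_mem_nhds hδ))
  refine exists_tendsto_of_holder hη (M := |l| + 1) (by positivity) one_pos fun x hx y hy => ?_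
  rw [Real.rpow_one]
  refine convex_interval.norm_image_sub_le_of_norm_deriv_le (f := g) (fun z hz => ?_)
    (fun z hz => ((hs hz).1.le)) hy hx
  exact hg.differentiableAt (isOpen_interval.mem_nhds (hs hz).2)

/-- Mean value inequality between `x` and a point `y` closer to `c`, followed by `y → c`.
Intersecting the interval with the ball of radius `|x - c|` keeps the derivative below `ε |x - c|^k`
along the way. -/
theorem isLittleO_pow_succ_of_deriv {R : ℝ → ℝ} {k : ℕ} (hδ : 0 < δ)
    (hR : DifferentiableOn ℝ R (interval c δ j)) (h0 : Tendsto R (nhds c j) (𝓝 0))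
    (h : deriv R =o[nhds c j] fun x => (x - c) ^ k) :
    R =o[nhds c j] fun x => (x - c) ^ (k + 1) := by
  refine Asymptotics.isLittleO_iff.2 fun ε hε => ?_
  obtain ⟨η, hη, hs⟩ := exists_interval_subset
    ((Asymptotics.isLittleO_iff.1 h hε).and (interval_mem_nhds (c := c) (j := j) hδ))
  filter_upwards [interval_mem_nhds hη] with x hx
  have hx' := mem_interval_iff.1 hx
  have key : ∀ᶠ y in nhds c j, ‖R x - R y‖ ≤ ε * |x - c| ^ k * |x - y| := by
    filter_upwards [interval_mem_nhds hx'.1] with y hy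
    have hy' := mem_interval_iff.1 hy
    have hconv : Convex ℝ (interval c η j ∩ Metric.closedBall c |x - c|) :=
      convex_interval.inter (convex_closedBall _ _)
    refine hconv.norm_image_sub_le_of_norm_deriv_le (f := R) (fun z hz => ?_) (fun z hz => ?_)
      ⟨interval_mono hx'.2.le hy, ?_⟩ ⟨hx, by simp [Real.dist_eq]⟩
    · exact hR.differentiableAt (isOpen_interval.mem_nhds (hs hz.1).2)
    · refine (hs hz.1).1.trans ?_
      rw [norm_pow, Real.norm_eq_abs]
      have : |z - c| ≤ |x - c| := by simpa [Real.dist_eq] using hz.2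
      gcongr
    · rw [Metric.mem_closedBall, Real.dist_eq, abs_sub_of_pos hy'.1, abs_sub_of_pos hx'.1]
      exact hy'.2.le
  have hlim : Tendsto (fun y => ε * |x - c| ^ k * |x - y|) (nhds c j)
      (𝓝 (ε * |x - c| ^ k * |x - c|)) :=
    ((tendsto_const_nhds.sub (tendsto_id.mono_left nhds_le)).abs).const_mul _
  have hlim' : Tendsto (fun y => ‖R x - R y‖) (nhds c j) (𝓝 ‖R x - 0‖) :=
    (tendsto_const_nhds.sub h0).norm
  have := le_of_tendsto_of_tendsto hlim' hlim key
  simpa [norm_pow, pow_succ, mul_assoc] using this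

/-- One-sided third order Taylor expansion at `c`. -/
theorem exists_taylor {g : ℝ → ℝ} {l₀ l₂ l₃ : ℝ} (hδ : 0 < δ)
    (hd : ∀ k < 3, DifferentiableOn ℝ (iteratedDeriv k g) (interval c δ j))
    (h0 : Tendsto g (nhds c j) (𝓝 l₀)) (h2 : Tendsto (iteratedDeriv 2 g) (nhds c j) (𝓝 l₂))
    (h3 : Tendsto (iteratedDeriv 3 g) (nhds c j) (𝓝 l₃)) :
    ∃ l₁, (fun x => g x - (l₀ + l₁ * (x - c) + l₂ / 2 * (x - c) ^ 2 + l₃ / 6 * (x - c) ^ 3))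
      =o[nhds c j] fun x => (x - c) ^ 3 := by
  have hsucc : ∀ k, deriv (iteratedDeriv k g) = iteratedDeriv (k + 1) g := fun k =>
    iteratedDeriv_succ.symm
  -- The limit of the first derivative is not among the hypotheses; it follows from that of the
  -- second.
  obtain ⟨l₁, h1⟩ := exists_tendsto_of_deriv (g := iteratedDeriv 1 g) hδ (hd 1 (by norm_num))
    (by rw [hsucc]; exact h2)
  -- One integration of the expansion: each use raises the order of the error by one, and the limit
  -- at `c` fixes the constant of integration. Three uses lead from the third derivative back to
  -- `g`.
  have step : ∀ (k m : ℕ) (p p' : ℝ → ℝ), k < 3 → (∀ x, HasDerivAt p (p' x) x) →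
      Tendsto (iteratedDeriv k g) (nhds c j) (𝓝 (p c)) →
      ((fun x => iteratedDeriv (k + 1) g x - p' x) =o[nhds c j] fun x => (x - c) ^ m) →
      (fun x => iteratedDeriv k g x - p x) =o[nhds c j] fun x => (x - c) ^ (m + 1) := by
    intro k m p p' hk hp h0 ho
    have hp' : Differentiable ℝ p := fun x => (hp x).differentiableAt
    have h0' := h0.sub ((hp'.continuous.tendsto c).mono_left (nhds_le (j := j)))
    rw [sub_self] at h0'
    refine isLittleO_pow_succ_of_deriv hδ ((hd k hk).sub hp'.differentiableOn) h0'
      (ho.congr' ?_ EventuallyEq.rfl)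
    filter_upwards [interval_mem_nhds hδ] with x hx
    have hgx : DifferentiableAt ℝ (iteratedDeriv k g) x :=
      (hd k hk).differentiableAt (isOpen_interval.mem_nhds hx)
    have := (hgx.hasDerivAt.sub (hp x)).deriv
    rw [hsucc] at this
    exact this.symm
  have e3 : (fun x => iteratedDeriv 3 g x - l₃) =o[nhds c j] fun x => (x - c) ^ 0 := by
    simp only [pow_zero]
    rw [Asymptotics.isLittleO_one_iff]
    simpa using h3.sub_const l₃
  have poly : ∀ (x : ℝ) (n : ℕ), HasDerivAt (fun x => (x - c) ^ n) (n * (x - c) ^ (n - 1)) x :=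
    fun x n => (((hasDerivAt_id x).sub_const c).pow n).congr_deriv (by simp)
  have e2 := step 2 0 (fun x => l₂ + l₃ * (x - c) ^ 1) (fun _ => l₃) (by norm_num)
    (fun x => (((poly x 1).const_mul l₃).const_add l₂).congr_deriv (by norm_num))
    (by simpa using h2) e3
  have e1 := step 1 1 (fun x => l₁ + l₂ * (x - c) ^ 1 + l₃ / 2 * (x - c) ^ 2)
    (fun x => l₂ + l₃ * (x - c) ^ 1) (by norm_num)
    (fun x => ((((poly x 1).const_mul l₂).const_add l₁).add
      ((poly x 2).const_mul (l₃ / 2))).congr_deriv (by push_cast; ring))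
    (by simpa using h1) e2
  have e0 := step 0 2 (fun x => l₀ + l₁ * (x - c) ^ 1 + l₂ / 2 * (x - c) ^ 2 + l₃ / 6 * (x - c) ^ 3)
    (fun x => l₁ + l₂ * (x - c) ^ 1 + l₃ / 2 * (x - c) ^ 2) (by norm_num)
    (fun x => (((((poly x 1).const_mul l₁).const_add l₀).add ((poly x 2).const_mul (l₂ / 2))).add
        ((poly x 3).const_mul (l₃ / 6))).congr_deriv (by push_cast; ring))
    (by simpa using h0) e1
  exact ⟨l₁, by simpa using e0⟩

end Side

variable {κ : Kernel ℝ (ℝ × ℝ)} {c : ℝ} {j : Side}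

theorem HolderClass.exists_tendsto_iteratedDeriv {k : ℕ} {δ : ℝ} {g : ℝ → ℝ} (hδ : 0 < δ)
    (h : HolderClass k (Side.interval c δ j) g) :
    ∃ l, Tendsto (iteratedDeriv k g) (Side.nhds c j) (𝓝 l) := by
  obtain ⟨M, hM, α, hα, -, h⟩ := h.2
  exact Side.exists_tendsto_of_holder hδ hM hα h

theorem HolderClass.differentiableOn_iteratedDeriv {k m : ℕ} {U : Set ℝ} {g : ℝ → ℝ}
    (hU : IsOpen U) (h : HolderClass k U g) (hm : m < k) :
    DifferentiableOn ℝ (iteratedDeriv m g) U := by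
  have := h.1.differentiableOn_iteratedDerivWithin (m := m) (by exact_mod_cast hm) hU.uniqueDiffOn
  exact this.congr fun x hx => (iteratedDerivWithin_of_isOpen hU hx).symm

theorem RegularSide.tendsto_varY (h : RegularSide κ c j) :
    Tendsto (varY κ) (Side.nhds c j) (𝓝 (Side.limit c (varY κ) j)) := by
  obtain ⟨δ, hδ, -, -, h, -⟩ := h.outcome
  exact Side.tendsto_limit (by simpa using h.exists_tendsto_iteratedDeriv hδ)

theorem RegularSide.tendsto_covYD (h : RegularSide κ c j) :
    Tendsto (covYD κ) (Side.nhds c j) (𝓝 (Side.limit c (covYD κ) j)) := by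
  obtain ⟨δ, hδ, -, -, -, h⟩ := h.outcome
  exact Side.tendsto_limit (by simpa using h.exists_tendsto_iteratedDeriv hδ)

/-- The one-sided third order Taylor expansion of `m` at `c`, whose coefficients of order
`0`, `2` and `3` are given by the one-sided limits of `m` and its derivatives. -/
def HasSideTaylor (m : ℝ → ℝ) (c : ℝ) (j : Side) : Prop :=
  ∃ l₁, (fun x => m x - (Side.limit c m j + l₁ * (x - c)
      + Side.limit c (iteratedDeriv 2 m) j / 2 * (x - c) ^ 2
      + Side.limit c (iteratedDeriv 3 m) j / 6 * (x - c) ^ 3))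
    =o[Side.nhds c j] fun x => (x - c) ^ 3

theorem RegularSide.hasSideTaylor_mY (h : RegularSide κ c j) : HasSideTaylor (mY κ) c j := by
  obtain ⟨δ, hδ, -, h, -⟩ := h.outcome
  have hd := fun k (hk : k < 3) => h.differentiableOn_iteratedDeriv Side.isOpen_interval hk
  obtain ⟨l₃, h3⟩ := h.exists_tendsto_iteratedDeriv hδ
  -- The Hölder condition concerns only the third derivative; limits of the lower ones are obtained
  -- by descent.
  have step : ∀ k < 3, (∃ l, Tendsto (iteratedDeriv (k + 1) (mY κ)) (Side.nhds c j) (𝓝 l)) →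
      ∃ l, Tendsto (iteratedDeriv k (mY κ)) (Side.nhds c j) (𝓝 l) := fun k hk ⟨l, hl⟩ =>
    Side.exists_tendsto_of_deriv hδ (hd k hk) (by rwa [← iteratedDeriv_succ])
  have h2 := step 2 (by norm_num) ⟨l₃, h3⟩
  have h0 := step 0 (by norm_num) (step 1 (by norm_num) h2)
  rw [iteratedDeriv_zero] at h0
  exact Side.exists_taylor hδ hd (Side.tendsto_limit h0) (Side.tendsto_limit h2)
    (Side.tendsto_limit ⟨l₃, h3⟩)

theorem RegularSide.hasSideTaylor_mD (h : RegularSide κ c j) : HasSideTaylor (mD κ) c j := by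
  obtain ⟨δ, hδ, hd⟩ := h.treatment
  exact Side.exists_taylor hδ hd (Side.tendsto_limit h.limit_mD) (Side.tendsto_limit h.limit_mD_two)
    (Side.tendsto_limit h.limit_mD_three)

/-! ### Minimizers of perturbed criteria -/

section Optimization

variable {ι : Type*} {l : Filter ι} {t : Side → ℝ}

/-- `w_+ / h_+ + w_- / h_-`. -/
noncomputable def invTerm (w h : Side → ℝ) : ℝ := w .pos / h .pos + w .neg / h .neg

theorem continuous_biasTerm (a : Side → ℝ) (k : ℕ) : Continuous (biasTerm a k) := by
  unfold biasTerm; fun_prop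

theorem continuousOn_invTerm (w : Side → ℝ) : ContinuousOn (invTerm w) bandwidths := by
  unfold invTerm
  have h : ∀ j, ContinuousOn (fun t : Side → ℝ => t j) bandwidths := fun j =>
    (continuous_apply j).continuousOn
  exact (continuousOn_const.div (h _) fun t ht => (ht _).ne').add
    (continuousOn_const.div (h _) fun t ht => (ht _).ne')

theorem tendsto_biasTerm {a s : ι → Side → ℝ} {a₀ : Side → ℝ} (k : ℕ)
    (ha : ∀ j, Tendsto (fun i => a i j) l (𝓝 (a₀ j)))
    (hs : ∀ j, Tendsto (fun i => s i j) l (𝓝 (t j))) :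
    Tendsto (fun i => biasTerm (a i) k (s i)) l (𝓝 (biasTerm a₀ k t)) :=
  ((ha _).mul ((hs _).pow k)).sub ((ha _).mul ((hs _).pow k))

theorem tendsto_invTerm {w s : ι → Side → ℝ} {w₀ : Side → ℝ} (ht : t ∈ bandwidths)
    (hw : ∀ j, Tendsto (fun i => w i j) l (𝓝 (w₀ j)))
    (hs : ∀ j, Tendsto (fun i => s i j) l (𝓝 (t j))) :
    Tendsto (fun i => invTerm (w i) (s i)) l (𝓝 (invTerm w₀ t)) :=
  ((hw _).div (hs _) (ht _).ne').add ((hw _).div (hs _) (ht _).ne')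

theorem invTerm_pos {w : Side → ℝ} (hw : ∀ j, 0 < w j) (ht : t ∈ bandwidths) :
    0 < invTerm w t :=
  add_pos (div_pos (hw _) (ht _)) (div_pos (hw _) (ht _))

theorem div_le_invTerm {w : Side → ℝ} (hw : ∀ j, 0 < w j) (ht : t ∈ bandwidths) (j : Side) :
    w j / t j ≤ invTerm w t := by
  have h1 := div_pos (hw .pos) (ht .pos)
  have h2 := div_pos (hw .neg) (ht .neg)
  unfold invTerm
  cases j <;> linarith

theorem isCompact_box (lo hi : ℝ) : IsCompact (univ.pi fun _ : Side => Icc lo hi) :=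
  isCompact_univ_pi fun _ => isCompact_Icc

/-- The sublevel set of `t₀` lies in a compact box away from zero. A minimum over the box is global,
since points outside the sublevel set exceed `F t₀`. -/
theorem exists_isMinimizer {F : (Side → ℝ) → ℝ} (hF : ContinuousOn F bandwidths) {lo hi : ℝ}
    (hlo : 0 < lo) {t₀ : Side → ℝ} (ht₀ : t₀ ∈ bandwidths)
    (h : ∀ t ∈ bandwidths, F t ≤ F t₀ → ∀ j, t j ∈ Icc lo hi) :
    ∃ t, IsMinimizer F bandwidths t := by
  have hsub : (univ.pi fun _ : Side => Icc lo hi) ⊆ bandwidths := fun t ht j =>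
    hlo.trans_le (ht j (mem_univ _)).1
  have h0 : t₀ ∈ univ.pi fun _ : Side => Icc lo hi := fun j _ => h t₀ ht₀ le_rfl j
  obtain ⟨t, ht, hmin⟩ := (isCompact_box lo hi).exists_isMinOn ⟨t₀, h0⟩ (hF.mono hsub)
  refine ⟨t, hsub ht, fun s hs => ?_⟩
  by_cases hst : F s ≤ F t₀
  · exact hmin fun j _ => h s hs hst j
  · exact (hmin h0).trans (not_le.1 hst).le

/-- Convergence of minimizers and minima: equi-coercivity, a recovery family, and a lower bound
along convergent families. -/
theorem tendsto_minimizer {F : ι → (Side → ℝ) → ℝ} {S : Set (Side → ℝ)} {G : (Side → ℝ) → ℝ}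
    {tStar : Side → ℝ} {M lo hi : ℝ} {rec : ι → Side → ℝ}
    (hF : ∀ i, ContinuousOn (F i) bandwidths)
    (huniq : ∀ t ∈ S, G t ≤ G tStar → t = tStar) (hM : G tStar < M) (hlo : 0 < lo)
    (hcoer : ∀ᶠ i in l, ∀ t ∈ bandwidths, F i t ≤ M → ∀ j, t j ∈ Icc lo hi)
    (hrec : ∀ᶠ i in l, rec i ∈ bandwidths)
    (hrecF : Tendsto (fun i => F i (rec i)) l (𝓝 (G tStar)))
    (hliminf : ∀ (u : Ultrafilter ι) (t : ι → Side → ℝ) (t₀ : Side → ℝ), ↑u ≤ l →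
      t₀ ∈ bandwidths → (∀ j, Tendsto (fun i => t i j) u (𝓝 (t₀ j))) →
      (∀ᶠ i in u, F i (t i) ≤ M) →
      t₀ ∈ S ∧ ∃ H : ι → ℝ, Tendsto H u (𝓝 (G t₀)) ∧ ∀ᶠ i in u, H i ≤ F i (t i)) :
    (∀ᶠ i in l, ∃ t, IsMinimizer (F i) bandwidths t) ∧
    ∀ t : ι → Side → ℝ, (∀ᶠ i in l, IsMinimizer (F i) bandwidths (t i)) →
      (∀ j, Tendsto (fun i => t i j) l (𝓝 (tStar j))) ∧
      Tendsto (fun i => F i (t i)) l (𝓝 (G tStar)) := by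
  have hle : ∀ᶠ i in l, F i (rec i) ≤ M := (hrecF.eventually_lt_const hM).mono fun _ h => h.le
  constructor
  · filter_upwards [hcoer, hrec, hle] with i h1 h2 h3
    exact exists_isMinimizer (hF i) hlo h2 fun t ht hFt => h1 t ht (hFt.trans h3)
  intro t ht
  -- Ultrafilters replace subsequences, which a general filter does not have: along each of them the
  -- minimizers converge in the compact box, and uniqueness identifies the limit.
  have key : ∀ u : Ultrafilter ι, ↑u ≤ l → (∀ j, Tendsto (fun i => t i j) u (𝓝 (tStar j))) ∧
      Tendsto (fun i => F i (t i)) u (𝓝 (G tStar)) := by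
    intro u hu
    have hFle : ∀ᶠ i in (u : Filter ι), F i (t i) ≤ F i (rec i) := by
      filter_upwards [hu ht, hu hrec] with i h1 h2 using h1.2 h2
    have hFM : ∀ᶠ i in (u : Filter ι), F i (t i) ≤ M := by
      filter_upwards [hFle, hu hle] with i h1 h2 using h1.trans h2
    have hbox : ∀ᶠ i in (u : Filter ι), t i ∈ univ.pi fun _ : Side => Icc lo hi := by
      filter_upwards [hu hcoer, hu ht, hFM] with i h1 h2 h3 j _ using h1 _ h2.1 h3 j
    obtain ⟨t₀, ht₀, hlim⟩ := (isCompact_box lo hi).ultrafilter_le_nhds (u.map t)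
      (le_principal_iff.2 hbox)
    have hlim' : Tendsto t u (𝓝 t₀) := hlim
    rw [tendsto_pi_nhds] at hlim'
    obtain ⟨hS, H, hH, hHF⟩ := hliminf u t t₀ hu (fun j => hlo.trans_le (ht₀ j (mem_univ _)).1)
      hlim' hFM
    have hG : G t₀ ≤ G tStar := le_of_tendsto_of_tendsto hH (hrecF.mono_left hu)
      (by filter_upwards [hHF, hFle] with i h1 h2 using h1.trans h2)
    have := huniq t₀ hS hG
    subst this
    exact ⟨hlim', tendsto_of_tendsto_of_tendsto_of_le_of_le' hH (hrecF.mono_left hu) hHF hFle⟩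
  exact ⟨fun j => tendsto_iff_ultrafilter _ _ _ |>.2 fun u hu => (key u hu).1 j,
    tendsto_iff_ultrafilter _ _ _ |>.2 fun u hu => (key u hu).2⟩

/-- The variance term blows up at zero: `w_j / t_j ≤ M` gives `t_j ≥ w_j / M`, and `w_j` eventually
exceeds half its limit. -/
theorem eventually_le_of_invTerm_le {w : ι → Side → ℝ} {w₀ : Side → ℝ} (hw₀ : ∀ j, 0 < w₀ j)
    (hw : ∀ j, Tendsto (fun i => w i j) l (𝓝 (w₀ j))) {M : ℝ} (hM : 0 < M) :
    ∃ lo > 0, ∀ᶠ i in l, (∀ j, 0 < w i j) ∧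
      ∀ t ∈ bandwidths, invTerm (w i) t ≤ M → ∀ j, lo ≤ t j := by
  have hev : ∀ j, ∀ᶠ i in l, w₀ j / 2 < w i j := fun j =>
    (hw j).eventually_const_lt (half_lt_self (hw₀ j))
  refine ⟨min (w₀ .pos / 2 / M) (w₀ .neg / 2 / M), lt_min (div_pos (half_pos (hw₀ _)) hM)
    (div_pos (half_pos (hw₀ _)) hM), ?_⟩
  filter_upwards [hev .pos, hev .neg] with i hp hn
  have hall : ∀ j, w₀ j / 2 < w i j := fun j => by cases j <;> assumption
  have hpos : ∀ j, 0 < w i j := fun j => (half_pos (hw₀ j)).trans (hall j)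
  refine ⟨hpos, fun t ht hle j => ?_⟩
  have h1 : w₀ j / 2 / M ≤ t j := by
    have h := (div_le_invTerm hpos ht j).trans hle
    rw [div_le_iff₀ (ht j)] at h
    rw [div_le_iff₀ hM]
    linarith [hall j]
  refine le_trans ?_ h1
  cases j
  · exact min_le_left _ _
  · exact min_le_right _ _

/-- Two minimizers of `g + w_+ / h_+ + w_- / h_-` over a set stable under midpoints agree if `g`
is midpoint-convex. -/
theorem eq_of_isMinimizer {S : Set (Side → ℝ)} {g : (Side → ℝ) → ℝ} {w s : Side → ℝ}
    (hw : ∀ j, 0 < w j) (hSb : S ⊆ bandwidths)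
    (hS : ∀ t ∈ S, ∀ s ∈ S, (fun j => (t j + s j) / 2) ∈ S)
    (hg : ∀ t ∈ S, ∀ s ∈ S, g (fun j => (t j + s j) / 2) ≤ (g t + g s) / 2)
    (ht : t ∈ S) (hs : IsMinimizer (fun t => g t + invTerm w t) S s)
    (hle : g t + invTerm w t ≤ g s + invTerm w s) : t = s := by
  by_contra hne
  obtain ⟨j, hj⟩ := Function.ne_iff.1 hne
  -- Strict convexity of `1/x` with an explicit gap, which is positive as soon as one coordinate
  -- differs.
  have hinv : ∀ x y : ℝ, 0 < x → 0 < y →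
      (1 / x + 1 / y) / 2 - 1 / ((x + y) / 2) = (x - y) ^ 2 / (2 * x * y * (x + y)) := by
    intro x y hx hy
    have : x + y ≠ 0 := by positivity
    field_simp
    ring
  have hdiff : ∀ j, (w j / t j + w j / s j) / 2 - w j / ((t j + s j) / 2) =
      w j * ((t j - s j) ^ 2 / (2 * t j * s j * (t j + s j))) := fun j => by
    rw [← hinv _ _ (hSb ht j) (hSb hs.1 j)]; ring
  have hnn : ∀ j, 0 ≤ w j * ((t j - s j) ^ 2 / (2 * t j * s j * (t j + s j))) := fun j => by
    have := hSb ht j; have := hSb hs.1 j; have := hw j; positivity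
  have hpos : 0 < w j * ((t j - s j) ^ 2 / (2 * t j * s j * (t j + s j))) := by
    have := hSb ht j; have := hSb hs.1 j; have := hw j
    have : 0 < (t j - s j) ^ 2 := by have := sub_ne_zero.2 hj; positivity
    positivity
  have hmin := hs.2 (hS t ht s hs.1)
  have hgm := hg t ht s hs.1
  have d1 := hdiff .pos
  have d2 := hdiff .neg
  have n1 := hnn .pos
  have n2 := hnn .neg
  simp only [mem_ofPred_eq, invTerm] at hmin hle
  cases j <;> linarith

/-- `α (φ_+ h_+² - φ_- h_-²)² + β (ψ_+ h_+³ - ψ_- h_-³)² + w_+ / h_+ + w_- / h_-`. -/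
noncomputable def scaledCrit (α β : ℝ) (φ ψ w t : Side → ℝ) : ℝ :=
  α * biasTerm φ 2 t ^ 2 + β * biasTerm ψ 3 t ^ 2 + invTerm w t

theorem continuousOn_scaledCrit (α β : ℝ) (φ ψ w : Side → ℝ) :
    ContinuousOn (scaledCrit α β φ ψ w) bandwidths :=
  ((((continuous_biasTerm φ 2).pow 2).const_mul α).add
    (((continuous_biasTerm ψ 3).pow 2).const_mul β)).continuousOn.add (continuousOn_invTerm w)

variable {φ ψ w : ι → Side → ℝ} {φ₀ ψ₀ w₀ tStar : Side → ℝ} {α β : ι → ℝ}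

/-- With opposite signs the bias term is, up to sign, a positive definite quadratic form, and the
square of such a form is convex. -/
theorem eq_of_isMinimizer_of_neg (hφ₀ : φ₀ .pos * φ₀ .neg < 0) (hw₀ : ∀ j, 0 < w₀ j)
    {s : Side → ℝ} (hs : IsMinimizer (fun t => biasTerm φ₀ 2 t ^ 2 + invTerm w₀ t) bandwidths s)
    (ht : t ∈ bandwidths)
    (hle : biasTerm φ₀ 2 t ^ 2 + invTerm w₀ t ≤ biasTerm φ₀ 2 s ^ 2 + invTerm w₀ s) : t = s := by
  refine eq_of_isMinimizer (g := fun t => biasTerm φ₀ 2 t ^ 2) hw₀ Subset.rfl (fun t ht s hs j => ?_)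
    (fun t ht s hs => ?_) ht hs hle
  · have := ht j; have := hs j; positivity
  · simp only [biasTerm]
    generalize φ₀ .pos = p at *
    generalize φ₀ .neg = q at *
    generalize t .pos = x
    generalize t .neg = y
    generalize s .pos = x'
    generalize s .neg = y'
    have h1 : (p * ((x + x') / 2) ^ 2 - q * ((y + y') / 2) ^ 2) ^ 2 ≤
        ((p * x ^ 2 - q * y ^ 2 + (p * x' ^ 2 - q * y' ^ 2)) / 2) ^ 2 := by
      -- The difference has coefficients `p^2`, `q^2` and `-pq` in front of nonnegative expressions;
      -- the last is where the sign condition is used.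
      have e : ((p * x ^ 2 - q * y ^ 2 + (p * x' ^ 2 - q * y' ^ 2)) / 2) ^ 2 -
          (p * ((x + x') / 2) ^ 2 - q * ((y + y') / 2) ^ 2) ^ 2 =
          p ^ 2 * ((x - x') ^ 2 / 4 * ((x ^ 2 + x' ^ 2) / 2 + ((x + x') / 2) ^ 2))
          + q ^ 2 * ((y - y') ^ 2 / 4 * ((y ^ 2 + y' ^ 2) / 2 + ((y + y') / 2) ^ 2))
          + -(p * q) * ((x - x') ^ 2 / 4 * ((y ^ 2 + y' ^ 2) / 2 + ((y + y') / 2) ^ 2)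
            + (y - y') ^ 2 / 4 * ((x ^ 2 + x' ^ 2) / 2 + ((x + x') / 2) ^ 2)) := by ring
      have hpq : 0 ≤ -(p * q) := by linarith
      have : 0 ≤ -(p * q) * ((x - x') ^ 2 / 4 * ((y ^ 2 + y' ^ 2) / 2 + ((y + y') / 2) ^ 2)
            + (y - y') ^ 2 / 4 * ((x ^ 2 + x' ^ 2) / 2 + ((x + x') / 2) ^ 2)) :=
        mul_nonneg hpq (by positivity)
      have : 0 ≤ p ^ 2 * ((x - x') ^ 2 / 4 * ((x ^ 2 + x' ^ 2) / 2 + ((x + x') / 2) ^ 2)) := by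
        positivity
      have : 0 ≤ q ^ 2 * ((y - y') ^ 2 / 4 * ((y ^ 2 + y' ^ 2) / 2 + ((y + y') / 2) ^ 2)) := by
        positivity
      linarith
    nlinarith [sq_nonneg ((p * x ^ 2 - q * y ^ 2) - (p * x' ^ 2 - q * y' ^ 2))]

/-- The cubic bias has vanishing nonnegative weight: it drops out along the constant recovery family
and may be discarded in lower bounds. Coercivity comes from the quadratic bias alone. -/
theorem tendsto_minimizer_of_neg (hφ₀ : φ₀ .pos * φ₀ .neg < 0) (hw₀ : ∀ j, 0 < w₀ j)
    (hφ : ∀ j, Tendsto (fun i => φ i j) l (𝓝 (φ₀ j)))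
    (hψ : ∀ j, Tendsto (fun i => ψ i j) l (𝓝 (ψ₀ j)))
    (hw : ∀ j, Tendsto (fun i => w i j) l (𝓝 (w₀ j)))
    (hβ0 : ∀ i, 0 ≤ β i) (hβ : Tendsto β l (𝓝 0))
    (ht : IsMinimizer (fun t => biasTerm φ₀ 2 t ^ 2 + invTerm w₀ t) bandwidths tStar) :
    (∀ᶠ i in l, ∃ t, IsMinimizer (scaledCrit 1 (β i) (φ i) (ψ i) (w i)) bandwidths t) ∧
    ∀ t : ι → Side → ℝ,
      (∀ᶠ i in l, IsMinimizer (scaledCrit 1 (β i) (φ i) (ψ i) (w i)) bandwidths (t i)) →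
      (∀ j, Tendsto (fun i => t i j) l (𝓝 (tStar j))) ∧
      Tendsto (fun i => scaledCrit 1 (β i) (φ i) (ψ i) (w i) (t i)) l
        (𝓝 (biasTerm φ₀ 2 tStar ^ 2 + invTerm w₀ tStar)) := by
  set M := biasTerm φ₀ 2 tStar ^ 2 + invTerm w₀ tStar + 1 with hM
  have hM0 : 0 < M := by have := invTerm_pos hw₀ ht.1; positivity
  obtain ⟨lo, hlo, hev⟩ := eventually_le_of_invTerm_le hw₀ hw hM0
  have hne : ∀ j, φ₀ j ≠ 0 := fun j h => by cases j <;> simp [h] at hφ₀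
  have hsq : ∀ j, ∀ᶠ i in l, φ₀ j ^ 2 / 2 < φ i j ^ 2 := fun j =>
    ((hφ j).pow 2).eventually_const_lt (half_lt_self (by have := hne j; positivity))
  have hneg : ∀ᶠ i in l, φ i .pos * φ i .neg < 0 :=
    ((hφ .pos).mul (hφ .neg)).eventually_lt_const hφ₀
  refine tendsto_minimizer (S := bandwidths) (M := M) (lo := lo)
    (hi := 1 + (2 * M / φ₀ .pos ^ 2 + 2 * M / φ₀ .neg ^ 2)) (rec := fun _ => tStar)
    (G := fun t => biasTerm φ₀ 2 t ^ 2 + invTerm w₀ t)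
    (fun i => continuousOn_scaledCrit _ _ _ _ _)
    (fun t hts h => eq_of_isMinimizer_of_neg hφ₀ hw₀ ht hts h) (by simp [hM]) hlo ?_
    (Eventually.of_forall fun _ => ht.1) ?_ ?_
  · filter_upwards [hev, hsq .pos, hsq .neg, hneg] with i h1 h2 h3 h4 t htb htM j
    have hinv : 0 < invTerm (w i) t := invTerm_pos h1.1 htb
    have hβB : 0 ≤ β i * biasTerm (ψ i) 3 t ^ 2 := mul_nonneg (hβ0 i) (sq_nonneg _)
    simp only [scaledCrit, one_mul] at htM
    have hA : 0 ≤ biasTerm (φ i) 2 t ^ 2 := sq_nonneg _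
    refine ⟨h1.2 t htb (by linarith) j, ?_⟩
    -- The cross term in the square is nonnegative because the coefficients have opposite signs, so
    -- the biases of the two sides cannot cancel.
    have hcross : φ i j ^ 2 * t j ^ 4 ≤ biasTerm (φ i) 2 t ^ 2 := by
      have hc : 0 ≤ -(φ i .pos * φ i .neg) * (t .pos ^ 2 * t .neg ^ 2) :=
        mul_nonneg (by linarith) (by positivity)
      have e : biasTerm (φ i) 2 t ^ 2 = φ i .pos ^ 2 * t .pos ^ 4 + φ i .neg ^ 2 * t .neg ^ 4 +
        2 * (-(φ i .pos * φ i .neg) * (t .pos ^ 2 * t .neg ^ 2)) := by unfold biasTerm; ring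
      have a1 : 0 ≤ φ i .pos ^ 2 * t .pos ^ 4 := by positivity
      have a2 : 0 ≤ φ i .neg ^ 2 * t .neg ^ 4 := by positivity
      cases j <;> linarith
    have hj : φ₀ j ^ 2 / 2 < φ i j ^ 2 := by cases j <;> assumption
    have hb : ∀ j, 0 ≤ 2 * M / φ₀ j ^ 2 := fun j => by positivity
    have h4 : t j ^ 4 ≤ 2 * M / φ₀ j ^ 2 := by
      have hp : 0 < φ₀ j ^ 2 := by have := hne j; positivity
      rw [le_div_iff₀ hp]
      have : φ₀ j ^ 2 / 2 * t j ^ 4 ≤ φ i j ^ 2 * t j ^ 4 := by gcongr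
      linarith
    -- Turns the quartic bound into a linear one without taking roots, which explains the form of
    -- `hi`.
    have htj : t j ≤ 1 + t j ^ 4 := by
      nlinarith [sq_nonneg (t j ^ 2 - 1 / 2), sq_nonneg (t j - 1 / 2)]
    have b1 := hb .pos
    have b2 := hb .neg
    cases j <;> linarith
  · have h := (((tendsto_biasTerm 2 hφ (fun j => tendsto_const_nhds (x := tStar j))).pow 2).const_mul 1).add
      ((hβ.mul ((tendsto_biasTerm 3 hψ (fun j => tendsto_const_nhds (x := tStar j))).pow 2)))
      |>.add (tendsto_invTerm ht.1 hw (fun j => tendsto_const_nhds))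
    simpa only [scaledCrit, one_mul, zero_mul, add_zero] using h
  · intro u t t₀ hu ht₀ htl _
    refine ⟨ht₀, fun i => biasTerm (φ i) 2 (t i) ^ 2 + invTerm (w i) (t i), ?_, ?_⟩
    · exact ((tendsto_biasTerm 2 (fun j => (hφ j).mono_left hu) htl).pow 2).add
        (tendsto_invTerm ht₀ (fun j => (hw j).mono_left hu) htl)
    · refine Eventually.of_forall fun i => ?_
      have hβB : 0 ≤ β i * biasTerm (ψ i) 3 (t i) ^ 2 := mul_nonneg (hβ0 i) (sq_nonneg _)
      simp only [scaledCrit]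
      linarith

/-- The constraint set is a ray from the origin, so the constrained problem has one free variable.
-/
theorem eq_sqrt_mul_of_biasTerm_eq_zero (hφ₀ : 0 < φ₀ .pos * φ₀ .neg) (ht : ∀ j, 0 ≤ t j)
    (h : biasTerm φ₀ 2 t = 0) : t .neg = √(φ₀ .pos / φ₀ .neg) * t .pos := by
  have hn : φ₀ .neg ≠ 0 := fun h => by simp [h] at hφ₀
  have e : t .neg ^ 2 = φ₀ .pos / φ₀ .neg * t .pos ^ 2 := by
    unfold biasTerm at h
    field_simp
    linarith
  rw [← Real.sqrt_sq (ht .neg), e, Real.sqrt_mul' _ (sq_nonneg _), Real.sqrt_sq (ht .pos)]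

theorem div_nonneg_of_mul_pos {x y : ℝ} (h : 0 < x * y) : 0 ≤ x / y := by
  rw [div_eq_mul_inv, ← mul_self_mul_inv y⁻¹, inv_inv, mul_comm, mul_assoc, mul_comm y x]
  exact mul_nonneg (mul_self_nonneg _) h.le

theorem biasTerm_sqrt_mul (hφ₀ : 0 < φ₀ .pos * φ₀ .neg)
    (h : t .neg = √(φ₀ .pos / φ₀ .neg) * t .pos) : biasTerm φ₀ 2 t = 0 := by
  have hn : φ₀ .neg ≠ 0 := fun h => by simp [h] at hφ₀
  rw [biasTerm, h, mul_pow, Real.sq_sqrt (div_nonneg_of_mul_pos hφ₀)]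
  field_simp
  ring

/-- Cubing the slope `√(φ_+/φ_-)` of the ray produces the exponent `3/2`. This is the origin of the
non-degeneracy condition on `ψ`. -/
theorem biasTerm_three_of_eq_zero (hφ₀ : 0 < φ₀ .pos * φ₀ .neg) (ht : ∀ j, 0 ≤ t j)
    (h : biasTerm φ₀ 2 t = 0) :
    biasTerm ψ₀ 3 t =
      (ψ₀ .pos - (φ₀ .pos / φ₀ .neg) ^ (3 / 2 : ℝ) * ψ₀ .neg) * t .pos ^ 3 := by
  have hr := div_nonneg_of_mul_pos hφ₀
  have e : (φ₀ .pos / φ₀ .neg) ^ (3 / 2 : ℝ) = √(φ₀ .pos / φ₀ .neg) ^ 3 := by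
    rw [Real.sqrt_eq_rpow, ← Real.rpow_natCast, ← Real.rpow_mul hr]; norm_num
  rw [biasTerm, eq_sqrt_mul_of_biasTerm_eq_zero hφ₀ ht h, e]
  ring

/-- The ray is stable under midpoints, and on it the squared bias is a nonnegative multiple of the
convex function `t_+^6`. -/
theorem eq_of_isMinimizer_of_pos (hφ₀ : 0 < φ₀ .pos * φ₀ .neg) (hw₀ : ∀ j, 0 < w₀ j)
    {s : Side → ℝ} (hs : IsMinimizer (fun t => biasTerm ψ₀ 3 t ^ 2 + invTerm w₀ t)
      {h ∈ bandwidths | biasTerm φ₀ 2 h = 0} s)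
    (ht : t ∈ {h ∈ bandwidths | biasTerm φ₀ 2 h = 0})
    (hle : biasTerm ψ₀ 3 t ^ 2 + invTerm w₀ t ≤ biasTerm ψ₀ 3 s ^ 2 + invTerm w₀ s) : t = s := by
  have hmid : ∀ t ∈ {h ∈ bandwidths | biasTerm φ₀ 2 h = 0},
      ∀ s ∈ {h ∈ bandwidths | biasTerm φ₀ 2 h = 0},
      (fun j => (t j + s j) / 2) ∈ {h ∈ bandwidths | biasTerm φ₀ 2 h = 0} := by
    intro t ht s hs
    refine ⟨fun j => ?_, biasTerm_sqrt_mul hφ₀ ?_⟩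
    · have := ht.1 j; have := hs.1 j; positivity
    · have h1 := eq_sqrt_mul_of_biasTerm_eq_zero hφ₀ (fun j => (ht.1 j).le) ht.2
      have h2 := eq_sqrt_mul_of_biasTerm_eq_zero hφ₀ (fun j => (hs.1 j).le) hs.2
      simp only [h1, h2]
      ring
  refine eq_of_isMinimizer (g := fun t => biasTerm ψ₀ 3 t ^ 2) hw₀ (fun _ h => h.1) hmid
    (fun t ht s hs => ?_) ht hs hle
  have hm := hmid t ht s hs
  have e := fun (t : Side → ℝ) (ht : t ∈ {h ∈ bandwidths | biasTerm φ₀ 2 h = 0}) =>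
    biasTerm_three_of_eq_zero (ψ₀ := ψ₀) hφ₀ (fun j => (ht.1 j).le) ht.2
  simp only [e _ ht, e _ hs, e _ hm]
  have h6 := add_pow_le (ht.1 .pos).le (hs.1 .pos).le 6
  have hk := sq_nonneg (ψ₀ .pos - (φ₀ .pos / φ₀ .neg) ^ (3 / 2 : ℝ) * ψ₀ .neg)
  have := mul_le_mul_of_nonneg_left h6 hk
  norm_num at this
  ring_nf at this ⊢
  linarith

/-- If the two bias terms have no common zero, then they control the bandwidths, uniformly in
nearby coefficients. -/
theorem eventually_le_of_biasTerm_le (hφ₀ : 0 < φ₀ .pos * φ₀ .neg)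
    (hψ₀ : ψ₀ .pos - (φ₀ .pos / φ₀ .neg) ^ (3 / 2 : ℝ) * ψ₀ .neg ≠ 0)
    (hφ : ∀ j, Tendsto (fun i => φ i j) l (𝓝 (φ₀ j)))
    (hψ : ∀ j, Tendsto (fun i => ψ i j) l (𝓝 (ψ₀ j))) {M : ℝ} (hM : 0 < M) :
    ∃ hi, ∀ᶠ i in l, ∀ t ∈ bandwidths,
      |biasTerm (φ i) 2 t| ≤ M → |biasTerm (ψ i) 3 t| ≤ M → ∀ j, t j ≤ hi := by
  -- Normalizing to this compact simplex, the absence of a common zero gives a positive lower bound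
  -- `η` for the sum of the absolute bias terms.
  set C : Set (Side → ℝ) := (univ.pi fun _ => Icc 0 1) ∩ {t | t .pos + t .neg = 1} with hC
  have hCc : IsCompact C := (isCompact_box 0 1).inter_right
    (isClosed_eq (by fun_prop) continuous_const)
  have hpos : ∀ t ∈ C, 0 < |biasTerm φ₀ 2 t| + |biasTerm ψ₀ 3 t| := by
    intro t ht
    have ht0 : ∀ j, 0 ≤ t j := fun j => (ht.1 j (mem_univ _)).1
    by_contra hle
    have h1 : biasTerm φ₀ 2 t = 0 := abs_eq_zero.1 (by
      linarith [abs_nonneg (biasTerm φ₀ 2 t), abs_nonneg (biasTerm ψ₀ 3 t)])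
    have h2 : biasTerm ψ₀ 3 t = 0 := abs_eq_zero.1 (by
      linarith [abs_nonneg (biasTerm φ₀ 2 t), abs_nonneg (biasTerm ψ₀ 3 t)])
    rw [biasTerm_three_of_eq_zero hφ₀ ht0 h1] at h2
    have h3 : t .pos = 0 := by simpa [hψ₀] using h2
    have h4 := eq_sqrt_mul_of_biasTerm_eq_zero hφ₀ ht0 h1
    have h5 : t .pos + t .neg = 1 := ht.2
    rw [h4, h3] at h5
    norm_num at h5
  obtain ⟨η, hη, hηC⟩ : ∃ η > 0, ∀ t ∈ C, η ≤ |biasTerm φ₀ 2 t| + |biasTerm ψ₀ 3 t| := by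
    obtain ⟨t, ht, hmin⟩ := hCc.exists_isMinOn
      ⟨fun _ => 1 / 2, fun _ _ => by norm_num, by norm_num⟩
      ((continuous_biasTerm φ₀ 2).abs.add (continuous_biasTerm ψ₀ 3).abs).continuousOn
    exact ⟨_, hpos t ht, fun s hs => hmin hs⟩
  have hd : Tendsto (fun i => |φ i .pos - φ₀ .pos| + |φ i .neg - φ₀ .neg| +
      (|ψ i .pos - ψ₀ .pos| + |ψ i .neg - ψ₀ .neg|)) l (𝓝 0) := by
    have h1 := fun j => ((hφ j).sub_const (φ₀ j)).abs
    have h2 := fun j => ((hψ j).sub_const (ψ₀ j)).abs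
    simpa using ((h1 .pos).add (h1 .neg)).add ((h2 .pos).add (h2 .neg))
  refine ⟨1 + 4 * M / η, ?_⟩
  filter_upwards [hd.eventually_lt_const (half_pos hη)] with i hi t ht hA hB j
  set s := t .pos + t .neg with hs
  have hs0 : 0 < s := add_pos (ht _) (ht _)
  have htj : t j ≤ s := by have := ht .pos; have := ht .neg; cases j <;> linarith
  refine htj.trans ?_
  have hq : 0 ≤ 4 * M / η := by positivity
  -- The bias terms are homogeneous of degrees 2 and 3. For `s ≥ 1` both powers of `s` are at least
  -- `s`, which puts the two bounds on a common linear scale.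
  rcases le_total s 1 with h1 | h1
  · linarith
  have hpC : (fun j => t j / s) ∈ C := by
    refine ⟨fun j _ => ⟨(div_pos (ht j) hs0).le, (div_le_one hs0).2 ?_⟩, ?_⟩
    · have := ht .pos; have := ht .neg; cases j <;> linarith
    · simp only [mem_ofPred_eq]; rw [← add_div]; exact div_self hs0.ne'
  have hp01 : ∀ j k, |(t j / s) ^ k| ≤ 1 := fun j k => by
    have := hpC.1 j (mem_univ _)
    rw [abs_of_nonneg (pow_nonneg this.1 _)]
    exact pow_le_one₀ this.1 this.2
  have hlip : ∀ (a b : Side → ℝ) (k : ℕ), |biasTerm b k fun j => t j / s| ≤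
      |biasTerm a k fun j => t j / s| + (|a .pos - b .pos| + |a .neg - b .neg|) := by
    intro a b k
    have e : biasTerm b k (fun j => t j / s) = biasTerm a k (fun j => t j / s) -
      ((a .pos - b .pos) * (t .pos / s) ^ k - (a .neg - b .neg) * (t .neg / s) ^ k) := by
      unfold biasTerm; ring
    rw [e]
    refine (abs_sub _ _).trans (add_le_add le_rfl ((abs_sub _ _).trans ?_))
    rw [abs_mul, abs_mul]
    exact add_le_add (mul_le_of_le_one_right (abs_nonneg _) (hp01 _ _))
      (mul_le_of_le_one_right (abs_nonneg _) (hp01 _ _))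
  have hscale : ∀ (a : Side → ℝ) (k : ℕ), |biasTerm a k t| =
      s ^ k * |biasTerm a k fun j => t j / s| := by
    intro a k
    have e : biasTerm a k t = s ^ k * biasTerm a k fun j => t j / s := by
      have : s ^ k ≠ 0 := pow_ne_zero _ hs0.ne'
      simp only [biasTerm, div_pow]
      field_simp
    rw [e, abs_mul, abs_of_pos (pow_pos hs0 k)]
  have l1 := hlip (φ i) φ₀ 2
  have l2 := hlip (ψ i) ψ₀ 3
  have l3 := hηC _ hpC
  have bound : ∀ (a : Side → ℝ) (k : ℕ), k ≠ 0 → |biasTerm a k t| ≤ M →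
      s * |biasTerm a k fun j => t j / s| ≤ M := by
    intro a k hk h
    rw [hscale] at h
    refine le_trans ?_ h
    gcongr
    exact le_self_pow₀ h1 hk
  have b1 := bound _ 2 (by norm_num) hA
  have b2 := bound _ 3 (by norm_num) hB
  -- Half of `η` is lost to the perturbed coefficients, and the two bias bounds add up to `2 M`;
  -- hence `4 M / η`.
  have : s * (η / 2) ≤ 2 * M := by
    have : η / 2 ≤ |biasTerm (φ i) 2 fun j => t j / s| + |biasTerm (ψ i) 3 fun j => t j / s| := by
      linarith
    have := mul_le_mul_of_nonneg_left this hs0.le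
    linarith
  have : s ≤ 4 * M / η := by rw [le_div_iff₀ hη]; linarith
  linarith

/-- A penalty argument: with weight `α → ∞` on the quadratic bias, a bounded criterion forces the
limit onto the constraint set, where the remaining terms decide. -/
theorem tendsto_minimizer_of_pos (hφ₀ : 0 < φ₀ .pos * φ₀ .neg)
    (hψ₀ : ψ₀ .pos - (φ₀ .pos / φ₀ .neg) ^ (3 / 2 : ℝ) * ψ₀ .neg ≠ 0) (hw₀ : ∀ j, 0 < w₀ j)
    (hφ : ∀ j, Tendsto (fun i => φ i j) l (𝓝 (φ₀ j)))
    (hψ : ∀ j, Tendsto (fun i => ψ i j) l (𝓝 (ψ₀ j)))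
    (hw : ∀ j, Tendsto (fun i => w i j) l (𝓝 (w₀ j))) (hα : Tendsto α l atTop)
    (ht : IsMinimizer (fun t => biasTerm ψ₀ 3 t ^ 2 + invTerm w₀ t)
      {h ∈ bandwidths | biasTerm φ₀ 2 h = 0} tStar) :
    (∀ᶠ i in l, ∃ t, IsMinimizer (scaledCrit (α i) 1 (φ i) (ψ i) (w i)) bandwidths t) ∧
    ∀ t : ι → Side → ℝ,
      (∀ᶠ i in l, IsMinimizer (scaledCrit (α i) 1 (φ i) (ψ i) (w i)) bandwidths (t i)) →
      (∀ j, Tendsto (fun i => t i j) l (𝓝 (tStar j))) ∧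
      Tendsto (fun i => scaledCrit (α i) 1 (φ i) (ψ i) (w i) (t i)) l
        (𝓝 (biasTerm ψ₀ 3 tStar ^ 2 + invTerm w₀ tStar)) := by
  set M := biasTerm ψ₀ 3 tStar ^ 2 + invTerm w₀ tStar + 1 with hM
  have hM0 : 0 < M := by have := invTerm_pos hw₀ ht.1.1; positivity
  obtain ⟨lo, hlo, hev⟩ := eventually_le_of_invTerm_le hw₀ hw hM0
  obtain ⟨hi, hhi⟩ := eventually_le_of_biasTerm_le hφ₀ hψ₀ hφ hψ (M := M + 1) (by linarith)
  have hpos : ∀ᶠ i in l, 0 < φ i .pos * φ i .neg :=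
    ((hφ .pos).mul (hφ .neg)).eventually_const_lt hφ₀
  have hneg0 : φ₀ .neg ≠ 0 := fun h => by simp [h] at hφ₀
  -- The recovery family moves `tStar` onto the ray of the perturbed coefficients. The quadratic
  -- bias must vanish exactly there, since a merely small value could be magnified by `α`.
  set r : ι → Side → ℝ := fun i j => match j with
    | .pos => tStar .pos
    | .neg => √(φ i .pos / φ i .neg) * tStar .pos with hr
  have hrl : ∀ j, Tendsto (fun i => r i j) l (𝓝 (tStar j)) := by
    rintro (_ | _)
    · exact tendsto_const_nhds
    · rw [eq_sqrt_mul_of_biasTerm_eq_zero hφ₀ (fun j => (ht.1.1 j).le) ht.1.2]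
      exact ((hφ .pos).div (hφ .neg) hneg0).sqrt.mul_const _
  have hr0 : ∀ᶠ i in l, biasTerm (φ i) 2 (r i) = 0 :=
    hpos.mono fun i hi => biasTerm_sqrt_mul hi rfl
  have hα1 : ∀ᶠ i in l, 1 ≤ α i := hα.eventually_ge_atTop 1
  refine tendsto_minimizer (S := {h ∈ bandwidths | biasTerm φ₀ 2 h = 0}) (M := M) (lo := lo)
    (hi := hi) (rec := r) (G := fun t => biasTerm ψ₀ 3 t ^ 2 + invTerm w₀ t)
    (fun i => continuousOn_scaledCrit _ _ _ _ _)
    (fun t hts h => eq_of_isMinimizer_of_pos hφ₀ hw₀ ht hts h) (by simp [hM]) hlo ?_ ?_ ?_ ?_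
  · filter_upwards [hev, hhi, hα1] with i h1 h2 h3 t htb htM j
    have hinv : 0 < invTerm (w i) t := invTerm_pos h1.1 htb
    simp only [scaledCrit, one_mul] at htM
    have hA : biasTerm (φ i) 2 t ^ 2 ≤ α i * biasTerm (φ i) 2 t ^ 2 :=
      le_mul_of_one_le_left (sq_nonneg _) h3
    have hA0 := sq_nonneg (biasTerm (φ i) 2 t)
    have hB0 := sq_nonneg (biasTerm (ψ i) 3 t)
    have habs : ∀ x : ℝ, x ^ 2 ≤ M → |x| ≤ M + 1 := fun x hx => by
      have := sq_abs x
      nlinarith [sq_nonneg (|x| - 1), abs_nonneg x]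
    exact ⟨h1.2 t htb (by linarith) j, h2 t htb (habs _ (by linarith)) (habs _ (by linarith)) j⟩
  · filter_upwards [(hrl .pos).eventually_const_lt (ht.1.1 .pos),
      (hrl .neg).eventually_const_lt (ht.1.1 .neg)] with i h1 h2 j
    cases j <;> assumption
  · have h := ((tendsto_biasTerm 3 hψ hrl).pow 2).add (tendsto_invTerm ht.1.1 hw hrl)
    refine h.congr' ?_
    filter_upwards [hr0] with i hi
    simp [scaledCrit, hi]
  · intro u t t₀ hu ht₀ htl htM
    have hAlim := tendsto_biasTerm 2 (fun j => (hφ j).mono_left hu) htl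
    have hle : ∀ᶠ i in (u : Filter ι), biasTerm (φ i) 2 (t i) ^ 2 ≤ M / α i ∧
        biasTerm (ψ i) 3 (t i) ^ 2 + invTerm (w i) (t i) ≤
          scaledCrit (α i) 1 (φ i) (ψ i) (w i) (t i) := by
      have htb : ∀ᶠ i in (u : Filter ι), t i ∈ bandwidths := by
        filter_upwards [(htl .pos).eventually_const_lt (ht₀ .pos),
          (htl .neg).eventually_const_lt (ht₀ .neg)] with i h1 h2 j
        cases j <;> assumption
      filter_upwards [htM, hu hα1, hu hev, htb] with i h1 h2 h3 h4
      have hinv : 0 < invTerm (w i) (t i) := invTerm_pos h3.1 h4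
      simp only [scaledCrit, one_mul] at h1 ⊢
      have hB0 := sq_nonneg (biasTerm (ψ i) 3 (t i))
      have hA0 := sq_nonneg (biasTerm (φ i) 2 (t i))
      constructor
      · rw [le_div_iff₀ (by linarith)]; linarith
      · have := mul_nonneg (zero_le_one.trans h2) hA0
        linarith
    -- The squared quadratic bias is at most `M / α`, hence zero in the limit.
    have hA0 : biasTerm φ₀ 2 t₀ ^ 2 ≤ 0 :=
      le_of_tendsto_of_tendsto (hAlim.pow 2)
        (tendsto_const_nhds.div_atTop (hα.mono_left hu)) (hle.mono fun _ h => h.1)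
    refine ⟨⟨ht₀, by simpa using le_antisymm hA0 (sq_nonneg _)⟩,
      fun i => biasTerm (ψ i) 3 (t i) ^ 2 + invTerm (w i) (t i), ?_, hle.mono fun _ h => h.2⟩
    exact ((tendsto_biasTerm 3 (fun j => (hψ j).mono_left hu) htl).pow 2).add
      (tendsto_invTerm ht₀ (fun j => (hw j).mono_left hu) htl)

end Optimization

/-! ### Rates of the optimal bandwidths -/

section Rates

/-- `(A / n)^{1/q}`. -/
noncomputable def rate (q : ℕ) (A : ℝ) (n : ℕ) : ℝ := (A / n) ^ ((q : ℝ)⁻¹)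

variable {q : ℕ} {A : ℝ}

theorem rate_pos (hA : 0 < A) {n : ℕ} (hn : 0 < n) : 0 < rate q A n :=
  Real.rpow_pos_of_pos (div_pos hA (by exact_mod_cast hn)) _

theorem rate_pow (hq : q ≠ 0) (hA : 0 < A) (n : ℕ) : rate q A n ^ q = A / n :=
  Real.rpow_inv_natCast_pow (by positivity) hq

theorem tendsto_rate (hq : q ≠ 0) : Tendsto (rate q A) atTop (𝓝 0) := by
  have h : Tendsto (fun n : ℕ => A / n) atTop (𝓝 0) := tendsto_const_div_atTop_nhds_zero_nat A
  have := (Real.continuousAt_rpow_const 0 ((q : ℝ)⁻¹) (Or.inr (by positivity))).tendsto.comp h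
  rwa [Real.zero_rpow (by positivity)] at this

theorem isTheta_rate (hA : 0 < A) {b : ℝ} (hb : b ≠ 0) {h : ℕ → ℝ}
    (hh : ∀ n, 0 < n → h n = rate q A n * b) :
    h =Θ[atTop] fun n : ℕ => (n : ℝ) ^ (-(1 / q) : ℝ) := by
  have e : h =ᶠ[atTop] fun n : ℕ => A ^ ((q : ℝ)⁻¹) * b * (n : ℝ) ^ (-(1 / q) : ℝ) := by
    filter_upwards [eventually_gt_atTop 0] with n hn
    rw [hh n hn, rate, Real.div_rpow hA.le (Nat.cast_nonneg _), Real.rpow_neg (Nat.cast_nonneg _),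
      one_div]
    ring
  exact e.trans_isTheta ((Asymptotics.isTheta_refl _ _).const_mul_left
    (mul_ne_zero (Real.rpow_pos_of_pos hA _).ne' hb))

theorem biasTerm_mul (φ t : Side → ℝ) (k : ℕ) (a : ℝ) :
    biasTerm φ k (fun j => a * t j) = a ^ k * biasTerm φ k t := by
  unfold biasTerm; ring

theorem varTerm_mul (v f₀ : ℝ) (w t : Side → ℝ) (n : ℕ) (a : ℝ) :
    varTerm v f₀ w n (fun j => a * t j) = v / (n * f₀) / a * invTerm w t := by
  unfold varTerm invTerm
  simp only [div_eq_mul_inv, mul_inv]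
  ring

theorem invTerm_mul (b : ℝ) (w t : Side → ℝ) :
    invTerm (fun j => b * w j) t = b * invTerm w t := by
  unfold invTerm; ring

theorem IsMinimizer.scale {F G : (Side → ℝ) → ℝ} {S : Set (Side → ℝ)} {h : Side → ℝ} {a C : ℝ}
    (hC : 0 < C) (ha : a ≠ 0) (hS : ∀ t, (fun j => a * t j) ∈ S ↔ t ∈ S)
    (hFG : ∀ t ∈ S, F (fun j => a * t j) = C * G t) (hF : IsMinimizer F S h) :
    IsMinimizer G S fun j => h j / a := by
  have e : (fun j => a * (h j / a)) = h := by funext j; field_simp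
  have h0 : (fun j => h j / a) ∈ S := by rw [← hS, e]; exact hF.1
  refine ⟨h0, fun t ht => ?_⟩
  have h1 := hF.2 ((hS t).2 ht)
  have h2 := hFG _ h0
  rw [e] at h2
  simp only [mem_ofPred_eq] at h1 ⊢
  rw [h2, hFG t ht] at h1
  exact le_of_mul_le_mul_left h1 hC

theorem IsMinimizer.unscale {F G : (Side → ℝ) → ℝ} {S : Set (Side → ℝ)} {t : Side → ℝ} {a C : ℝ}
    (hC : 0 < C) (ha : a ≠ 0) (hS : ∀ t, (fun j => a * t j) ∈ S ↔ t ∈ S)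
    (hFG : ∀ t ∈ S, F (fun j => a * t j) = C * G t) (hG : IsMinimizer G S t) :
    IsMinimizer F S fun j => a * t j := by
  refine ⟨(hS t).2 hG.1, fun s hs => ?_⟩
  have e : s = fun j => a * (s j / a) := by funext j; field_simp
  have h0 : (fun j => s j / a) ∈ S := by rw [← hS, ← e]; exact hs
  simp only [mem_ofPred_eq]
  rw [e, hFG _ h0, hFG _ hG.1]
  exact mul_le_mul_of_nonneg_left (hG.2 h0) hC.le

theorem mul_mem_bandwidths {a : ℝ} (ha : 0 < a) (t : Side → ℝ) :
    (fun j => a * t j) ∈ bandwidths ↔ t ∈ bandwidths :=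
  forall_congr' fun _ => mul_pos_iff_of_pos_left ha

variable {K f : ℝ → ℝ} {κ : Kernel ℝ (ℝ × ℝ)} {c : ℝ} {hAFO : ℕ → Side → ℝ}

/-- The exponent 5 balances a squared bias of order `a^4` against a variance of order `1 / (n a)`.
-/
theorem AMSE1_mul {a : ℝ} (ha : 0 < a) {n : ℕ} (hn : a ^ 5 = constV K / f c / n) (t : Side → ℝ) :
    AMSE1 K f κ c n (fun j => a * t j) =
      a ^ 4 / tauD κ c ^ 2 * (biasTerm (phi K κ c) 2 t ^ 2 + invTerm (omega κ c) t) := by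
  have e : constV K / (n * f c) / a = a ^ 4 := by
    rw [div_eq_iff ha.ne', ← pow_succ, hn, div_div, mul_comm (n : ℝ)]
  rw [AMSE1, biasTerm_mul, varTerm_mul, e]
  ring

/-- The exponent 7 balances a squared bias of order `a^6` against a variance of order `1 / (n a)`.
-/
theorem AMSE2_mul {a : ℝ} (ha : 0 < a) {n : ℕ} (hn : a ^ 7 = constV K / f c / n) (t : Side → ℝ) :
    AMSE2 K f κ c n (fun j => a * t j) =
      a ^ 6 / tauD κ c ^ 2 * (biasTerm (psi K f κ c) 3 t ^ 2 + invTerm (omega κ c) t) := by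
  have e : constV K / (n * f c) / a = a ^ 6 := by
    rw [div_eq_iff ha.ne', ← pow_succ, hn, div_div, mul_comm (n : ℝ)]
  rw [AMSE2, biasTerm_mul, varTerm_mul, e]
  ring

/-- If `φ_+ φ_- < 0`, the optimal bandwidths are a constant pair times the rate `n^{-1/5}`. -/
theorem exists_eq_rate_mul_of_neg (hv : 0 < constV K) (hf : 0 < f c) (hτ : tauD κ c ≠ 0)
    (hω : ∀ j, 0 < omega κ c j) (hφ : phi K κ c .pos * phi K κ c .neg < 0)
    (hAFO_def : ∀ n, 0 < n → IsAFO K f κ c n (hAFO n)) :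
    ∃ t, IsMinimizer (fun t => biasTerm (phi K κ c) 2 t ^ 2 + invTerm (omega κ c) t) bandwidths t ∧
      ∀ n, 0 < n → ∀ j, hAFO n j = rate 5 (constV K / f c) n * t j := by
  have hA : 0 < constV K / f c := div_pos hv hf
  have hmin : ∀ n, 0 < n →
      IsMinimizer (fun t => biasTerm (phi K κ c) 2 t ^ 2 + invTerm (omega κ c) t) bandwidths
        fun j => hAFO n j / rate 5 (constV K / f c) n := fun n hn => by
    have ha := rate_pos (q := 5) hA hn
    exact ((hAFO_def n hn).1 hφ).scale (C := rate 5 (constV K / f c) n ^ 4 / tauD κ c ^ 2)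
      (by positivity) ha.ne' (mul_mem_bandwidths ha)
      fun t _ => AMSE1_mul ha (rate_pow (by norm_num) hA n) t
  -- The rescaled bandwidths minimize the same function for every `n`, so uniqueness identifies them
  -- all with the one for `n = 1`.
  refine ⟨_, hmin 1 one_pos, fun n hn j => ?_⟩
  have := congrFun (eq_of_isMinimizer_of_neg hφ hω (hmin 1 one_pos) (hmin n hn).1
    ((hmin n hn).2 (hmin 1 one_pos).1)) j
  rw [← this, mul_div_cancel₀ _ (rate_pos (q := 5) hA hn).ne']

/-- If `φ_+ φ_- > 0`, the optimal bandwidths are a constant pair times the rate `n^{-1/7}`. -/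
theorem exists_eq_rate_mul_of_pos (hv : 0 < constV K) (hf : 0 < f c) (hτ : tauD κ c ≠ 0)
    (hω : ∀ j, 0 < omega κ c j) (hφ : 0 < phi K κ c .pos * phi K κ c .neg)
    (hAFO_def : ∀ n, 0 < n → IsAFO K f κ c n (hAFO n)) :
    ∃ t, IsMinimizer (fun t => biasTerm (psi K f κ c) 3 t ^ 2 + invTerm (omega κ c) t)
        {h ∈ bandwidths | biasTerm (phi K κ c) 2 h = 0} t ∧
      ∀ n, 0 < n → ∀ j, hAFO n j = rate 7 (constV K / f c) n * t j := by
  have hA : 0 < constV K / f c := div_pos hv hf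
  have hmin : ∀ n, 0 < n →
      IsMinimizer (fun t => biasTerm (psi K f κ c) 3 t ^ 2 + invTerm (omega κ c) t)
        {h ∈ bandwidths | biasTerm (phi K κ c) 2 h = 0}
        fun j => hAFO n j / rate 7 (constV K / f c) n := fun n hn => by
    have ha := rate_pos (q := 7) hA hn
    refine ((hAFO_def n hn).2 hφ).scale (C := rate 7 (constV K / f c) n ^ 6 / tauD κ c ^ 2)
      (by positivity) ha.ne' (fun t => ?_)
      fun t _ => AMSE2_mul ha (rate_pow (by norm_num) hA n) t
    rw [mem_ofPred_eq, mem_ofPred_eq, mul_mem_bandwidths ha, biasTerm_mul, mul_eq_zero]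
    simp [ha.ne']
  refine ⟨_, hmin 1 one_pos, fun n hn j => ?_⟩
  have := congrFun (eq_of_isMinimizer_of_pos hφ hω (hmin 1 one_pos) (hmin n hn).1
    ((hmin n hn).2 (hmin 1 one_pos).1)) j
  rw [← this, mul_div_cancel₀ _ (rate_pos (q := 7) hA hn).ne']

/-! ### Feasible bandwidths after rescaling. -/

variable {ι : Type*} {l : Filter ι} {N : ι → ℕ} {phiHat psiHat omegaHat hHat : ι → Side → ℝ}
  {fHat : ι → ℝ} {v f₀ : ℝ} {φ₀ ψ₀ ω₀ tStar : Side → ℝ}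

theorem tendsto_rate_comp (hN : Tendsto N l atTop) (hq : q ≠ 0) :
    Tendsto (fun i => rate q A (N i)) l (𝓝 0) :=
  (tendsto_rate hq).comp hN

/-- The scale uses the true density value and stays deterministic; the estimated one is moved into
the weights through the factor `f₀ / g`, which tends to one. -/
theorem MMSE_mul (hf₀ : f₀ ≠ 0) {φ ψ ω : Side → ℝ} {g a : ℝ} {n : ℕ} (t : Side → ℝ)
    (ha : 0 < a) {p : ℕ} (hn : a ^ (2 * p + 1) = constV K / f₀ / n) :
    MMSE K φ ψ g ω n (fun j => a * t j) =
      (a ^ 2 * biasTerm φ 2 t) ^ 2 + (a ^ 3 * biasTerm ψ 3 t) ^ 2 +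
        a ^ (2 * p) * invTerm (fun j => f₀ / g * ω j) t := by
  have e : constV K / (n * g) / a = a ^ (2 * p) * (f₀ / g) := by
    rw [div_eq_iff ha.ne', mul_right_comm, ← pow_succ, hn, div_div, mul_comm (n : ℝ)]
    field_simp
  rw [MMSE, biasTerm_mul, biasTerm_mul, varTerm_mul, e, invTerm_mul]
  ring

theorem tendsto_feasible_of_neg (hv : 0 < constV K) (hf : 0 < f₀) (hω₀ : ∀ j, 0 < ω₀ j)
    (hφ₀ : φ₀ .pos * φ₀ .neg < 0) (hN : Tendsto N l atTop)
    (hφ : ∀ j, Tendsto (fun i => phiHat i j) l (𝓝 (φ₀ j)))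
    (hψ : ∀ j, Tendsto (fun i => psiHat i j) l (𝓝 (ψ₀ j)))
    (hω : ∀ j, Tendsto (fun i => omegaHat i j) l (𝓝 (ω₀ j)))
    (hfHat : Tendsto fHat l (𝓝 f₀))
    (ht : IsMinimizer (fun t => biasTerm φ₀ 2 t ^ 2 + invTerm ω₀ t) bandwidths tStar)
    (hHat_def : ∀ i,
      (∃ h, IsMinimizer (MMSE K (phiHat i) (psiHat i) (fHat i) (omegaHat i) (N i)) bandwidths h) →
      IsMinimizer (MMSE K (phiHat i) (psiHat i) (fHat i) (omegaHat i) (N i)) bandwidths (hHat i)) :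
    (∀ j, Tendsto (fun i => hHat i j / rate 5 (constV K / f₀) (N i)) l (𝓝 (tStar j))) ∧
    Tendsto (fun i => MMSE K (phiHat i) (psiHat i) (fHat i) (omegaHat i) (N i) (hHat i) /
      rate 5 (constV K / f₀) (N i) ^ 4) l (𝓝 (biasTerm φ₀ 2 tStar ^ 2 + invTerm ω₀ tStar)) := by
  have hA : 0 < constV K / f₀ := div_pos hv hf
  set a := fun i => rate 5 (constV K / f₀) (N i) with ha
  have ha0 : Tendsto a l (𝓝 0) := tendsto_rate_comp hN (by norm_num)
  have hw : ∀ j, Tendsto (fun i => f₀ / fHat i * omegaHat i j) l (𝓝 (ω₀ j)) := fun j => by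
    simpa [div_self hf.ne'] using ((tendsto_const_nhds (x := f₀)).div hfHat hf.ne').mul (hω j)
  obtain ⟨hex, hlim⟩ := tendsto_minimizer_of_neg (β := fun i => a i ^ 2) hφ₀ hω₀ hφ hψ hw
    (fun i => sq_nonneg _) (by simpa using ha0.pow 2) ht
  have hpos : ∀ᶠ i in l, 0 < a i ∧ ∀ t, MMSE K (phiHat i) (psiHat i) (fHat i) (omegaHat i) (N i)
      (fun j => a i * t j) = a i ^ 4 * scaledCrit 1 (a i ^ 2) (phiHat i) (psiHat i)
        (fun j => f₀ / fHat i * omegaHat i j) t := by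
    filter_upwards [hN.eventually_gt_atTop 0] with i hi
    have hai : 0 < a i := rate_pos hA hi
    refine ⟨hai, fun t => ?_⟩
    rw [MMSE_mul (p := 2) hf.ne' t hai (rate_pow (by norm_num) hA _), scaledCrit]
    ring
  have hmin : ∀ᶠ i in l, IsMinimizer (scaledCrit 1 (a i ^ 2) (phiHat i) (psiHat i)
      (fun j => f₀ / fHat i * omegaHat i j)) bandwidths (fun j => hHat i j / a i) := by
    filter_upwards [hpos, hex] with i hi ⟨t, ht⟩
    have h4 : 0 < a i ^ 4 := pow_pos hi.1 _
    -- A minimizer of the rescaled criterion, dilated back, certifies that the plug-in criterion has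
    -- one; only then is `hHat` known to be a minimizer.
    exact (hHat_def i ⟨_, ht.unscale h4 hi.1.ne' (mul_mem_bandwidths hi.1)
      fun t _ => hi.2 t⟩).scale h4 hi.1.ne' (mul_mem_bandwidths hi.1) fun t _ => hi.2 t
  refine ⟨(hlim _ hmin).1, (hlim _ hmin).2.congr' ?_⟩
  filter_upwards [hpos] with i hi
  have e : hHat i = fun j => a i * (hHat i j / a i) := by
    funext j; have := hi.1.ne'; field_simp
  rw [eq_div_iff (pow_pos hi.1 _).ne', mul_comm, ← hi.2, ← e]

/-- Dividing by `a^6` leaves weight `a^{-2}` on the squared quadratic bias, the diverging penalty of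
`tendsto_minimizer_of_pos`. -/
theorem tendsto_feasible_of_pos (hv : 0 < constV K) (hf : 0 < f₀) (hω₀ : ∀ j, 0 < ω₀ j)
    (hφ₀ : 0 < φ₀ .pos * φ₀ .neg)
    (hψ₀ : ψ₀ .pos - (φ₀ .pos / φ₀ .neg) ^ (3 / 2 : ℝ) * ψ₀ .neg ≠ 0) (hN : Tendsto N l atTop)
    (hφ : ∀ j, Tendsto (fun i => phiHat i j) l (𝓝 (φ₀ j)))
    (hψ : ∀ j, Tendsto (fun i => psiHat i j) l (𝓝 (ψ₀ j)))
    (hω : ∀ j, Tendsto (fun i => omegaHat i j) l (𝓝 (ω₀ j)))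
    (hfHat : Tendsto fHat l (𝓝 f₀))
    (ht : IsMinimizer (fun t => biasTerm ψ₀ 3 t ^ 2 + invTerm ω₀ t)
      {h ∈ bandwidths | biasTerm φ₀ 2 h = 0} tStar)
    (hHat_def : ∀ i,
      (∃ h, IsMinimizer (MMSE K (phiHat i) (psiHat i) (fHat i) (omegaHat i) (N i)) bandwidths h) →
      IsMinimizer (MMSE K (phiHat i) (psiHat i) (fHat i) (omegaHat i) (N i)) bandwidths (hHat i)) :
    (∀ j, Tendsto (fun i => hHat i j / rate 7 (constV K / f₀) (N i)) l (𝓝 (tStar j))) ∧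
    Tendsto (fun i => MMSE K (phiHat i) (psiHat i) (fHat i) (omegaHat i) (N i) (hHat i) /
      rate 7 (constV K / f₀) (N i) ^ 6) l (𝓝 (biasTerm ψ₀ 3 tStar ^ 2 + invTerm ω₀ tStar)) := by
  have hA : 0 < constV K / f₀ := div_pos hv hf
  set a := fun i => rate 7 (constV K / f₀) (N i) with ha
  have ha0 : Tendsto a l (𝓝 0) := tendsto_rate_comp hN (by norm_num)
  have hapos : ∀ᶠ i in l, 0 < a i := (hN.eventually_gt_atTop 0).mono fun i hi => rate_pos hA hi
  have hα : Tendsto (fun i => (a i)⁻¹ ^ 2) l atTop :=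
    (tendsto_pow_atTop (by norm_num)).comp
      (tendsto_inv_nhdsGT_zero.comp (tendsto_nhdsWithin_iff.2 ⟨ha0, hapos⟩))
  have hw : ∀ j, Tendsto (fun i => f₀ / fHat i * omegaHat i j) l (𝓝 (ω₀ j)) := fun j => by
    simpa [div_self hf.ne'] using ((tendsto_const_nhds (x := f₀)).div hfHat hf.ne').mul (hω j)
  obtain ⟨hex, hlim⟩ := tendsto_minimizer_of_pos hφ₀ hψ₀ hω₀ hφ hψ hw hα ht
  have hpos : ∀ᶠ i in l, 0 < a i ∧ ∀ t, MMSE K (phiHat i) (psiHat i) (fHat i) (omegaHat i) (N i)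
      (fun j => a i * t j) = a i ^ 6 * scaledCrit ((a i)⁻¹ ^ 2) 1 (phiHat i) (psiHat i)
        (fun j => f₀ / fHat i * omegaHat i j) t := by
    filter_upwards [hapos] with i hai
    refine ⟨hai, fun t => ?_⟩
    rw [MMSE_mul (p := 3) hf.ne' t hai (rate_pow (by norm_num) hA _), scaledCrit]
    have := hai.ne'
    field_simp
    ring
  have hmin : ∀ᶠ i in l, IsMinimizer (scaledCrit ((a i)⁻¹ ^ 2) 1 (phiHat i) (psiHat i)
      (fun j => f₀ / fHat i * omegaHat i j)) bandwidths (fun j => hHat i j / a i) := by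
    filter_upwards [hpos, hex] with i hi ⟨t, ht⟩
    have h6 : 0 < a i ^ 6 := pow_pos hi.1 _
    exact (hHat_def i ⟨_, ht.unscale h6 hi.1.ne' (mul_mem_bandwidths hi.1)
      fun t _ => hi.2 t⟩).scale h6 hi.1.ne' (mul_mem_bandwidths hi.1) fun t _ => hi.2 t
  refine ⟨(hlim _ hmin).1, (hlim _ hmin).2.congr' ?_⟩
  filter_upwards [hpos] with i hi
  have e : hHat i = fun j => a i * (hHat i j / a i) := by
    funext j; have := hi.1.ne'; field_simp
  rw [eq_div_iff (pow_pos hi.1 _).ne', mul_comm, ← hi.2, ← e]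

end Rates

/-! ### Mixed moments of sums of independent pairs -/

section Moments

variable {Ω : Type*} [MeasurableSpace Ω] {μ : Measure Ω}

/-- `g` is integrable with integral `r`. -/
def HasInt (μ : Measure Ω) (g : Ω → ℝ) (r : ℝ) : Prop := Integrable g μ ∧ ∫ ω, g ω ∂μ = r

theorem HasInt.add {g g' : Ω → ℝ} {r r' : ℝ} (h : HasInt μ g r) (h' : HasInt μ g' r') :
    HasInt μ (fun ω => g ω + g' ω) (r + r') :=
  ⟨h.1.add h'.1, by rw [integral_add h.1 h'.1, h.2, h'.2]⟩

theorem HasInt.const_mul {g : Ω → ℝ} {r : ℝ} (a : ℝ) (h : HasInt μ g r) :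
    HasInt μ (fun ω => a * g ω) (a * r) :=
  ⟨h.1.const_mul a, by rw [integral_const_mul, h.2]⟩

theorem hasInt_const [IsProbabilityMeasure μ] (a : ℝ) : HasInt μ (fun _ => a) a :=
  ⟨integrable_const a, by simp⟩

theorem HasInt.mul_of_indep {X Y : Ω → ℝ × ℝ} (h : IndepFun X Y μ) {F G : ℝ × ℝ → ℝ}
    (hF : Measurable F) (hG : Measurable G) {r s : ℝ} (hX : HasInt μ (fun ω => F (X ω)) r)
    (hY : HasInt μ (fun ω => G (Y ω)) s) : HasInt μ (fun ω => F (X ω) * G (Y ω)) (r * s) := by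
  have hi : IndepFun (fun ω => F (X ω)) (fun ω => G (Y ω)) μ := h.comp hF hG
  refine ⟨hi.integrable_mul hX.1 hY.1, ?_⟩
  rw [hi.integral_fun_mul_eq_mul_integral hX.1.aestronglyMeasurable hY.1.aestronglyMeasurable,
    hX.2, hY.2]

/-- A pair of centred random variables, the first one square integrable and the second one
bounded by `B`. -/
structure CentredPair (μ : Measure Ω) (X : Ω → ℝ × ℝ) (B : ℝ) : Prop where
  measurable : Measurable X
  memLp : MemLp (fun ω => (X ω).1) 2 μ
  bound : ∀ᵐ ω ∂μ, |(X ω).2| ≤ B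
  mean_fst : ∫ ω, (X ω).1 ∂μ = 0
  mean_snd : ∫ ω, (X ω).2 ∂μ = 0

namespace CentredPair

variable {X Y : Ω → ℝ × ℝ} {B β : ℝ}

theorem measurable_fst (h : CentredPair μ X B) : Measurable fun ω => (X ω).1 := h.measurable.fst

theorem measurable_snd (h : CentredPair μ X B) : Measurable fun ω => (X ω).2 := h.measurable.snd

variable [IsProbabilityMeasure μ]

theorem integrable_pow (h : CentredPair μ X B) {i : ℕ} (hi : i ≤ 2) (k : ℕ) :
    Integrable (fun ω => (X ω).1 ^ i * (X ω).2 ^ k) μ := by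
  have h1 : Integrable (fun ω => (X ω).1 ^ i) μ := by
    interval_cases i
    · simp
    · simpa using h.memLp.integrable one_le_two
    · exact h.memLp.integrable_sq
  refine h1.mul_bdd (c := B ^ k) (h.measurable_snd.pow_const k).aestronglyMeasurable ?_
  filter_upwards [h.bound] with ω hω
  rw [norm_pow, Real.norm_eq_abs]
  exact pow_le_pow_left₀ (abs_nonneg _) hω k

theorem hasInt (h : CentredPair μ X B) {i : ℕ} (hi : i ≤ 2) (k : ℕ) :
    HasInt μ (fun ω => (X ω).1 ^ i * (X ω).2 ^ k) (∫ ω, (X ω).1 ^ i * (X ω).2 ^ k ∂μ) :=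
  ⟨h.integrable_pow hi k, rfl⟩

theorem integral_snd_sq_le (h : CentredPair μ X B) : ∫ ω, (X ω).2 ^ 2 ∂μ ≤ B ^ 2 := by
  have : ∫ ω, (X ω).2 ^ 2 ∂μ ≤ ∫ _, B ^ 2 ∂μ := by
    refine integral_mono_ae (by simpa using h.integrable_pow (i := 0) (by norm_num) 2)
      (integrable_const _) ?_
    filter_upwards [h.bound] with ω hω
    rw [← sq_abs]
    exact pow_le_pow_left₀ (abs_nonneg _) hω 2
  simpa using this

theorem integral_mul_sq_le (h : CentredPair μ X B) :
    ∫ ω, (X ω).1 ^ 2 * (X ω).2 ^ 2 ∂μ ≤ (∫ ω, (X ω).1 ^ 2 ∂μ) * B ^ 2 := by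
  rw [← integral_mul_const]
  refine integral_mono_ae (h.integrable_pow le_rfl 2) (h.memLp.integrable_sq.mul_const _) ?_
  filter_upwards [h.bound] with ω hω
  have : (X ω).2 ^ 2 ≤ B ^ 2 := by
    rw [← sq_abs]
    exact pow_le_pow_left₀ (abs_nonneg _) hω 2
  exact mul_le_mul_of_nonneg_left this (sq_nonneg _)

variable (hX : CentredPair μ X B) (hY : CentredPair μ Y β) (hXY : IndepFun X Y μ)
include hX hY

theorem add : CentredPair μ (X + Y) (B + β) where
  measurable := hX.measurable.add hY.measurable
  memLp := hX.memLp.add hY.memLp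
  bound := by
    filter_upwards [hX.bound, hY.bound] with ω h1 h2
    exact (abs_add_le _ _).trans (add_le_add h1 h2)
  mean_fst := by
    simp only [Pi.add_apply, Prod.fst_add]
    rw [integral_add (hX.memLp.integrable one_le_two) (hY.memLp.integrable one_le_two),
      hX.mean_fst, hY.mean_fst, add_zero]
  mean_snd := by
    simp only [Pi.add_apply, Prod.snd_add]
    rw [integral_add (by simpa using hX.integrable_pow (i := 0) (by norm_num) 1)
      (by simpa using hY.integrable_pow (i := 0) (by norm_num) 1),
      hX.mean_snd, hY.mean_snd, add_zero]

include hXY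

theorem hasInt_mul {i i' : ℕ} (hi : i ≤ 2) (hi' : i' ≤ 2) (k k' : ℕ) :
    HasInt μ (fun ω => ((X ω).1 ^ i * (X ω).2 ^ k) * ((Y ω).1 ^ i' * (Y ω).2 ^ k'))
      ((∫ ω, (X ω).1 ^ i * (X ω).2 ^ k ∂μ) * ∫ ω, (Y ω).1 ^ i' * (Y ω).2 ^ k' ∂μ) :=
  HasInt.mul_of_indep hXY (F := fun p => p.1 ^ i * p.2 ^ k) (G := fun p => p.1 ^ i' * p.2 ^ k')
    (by fun_prop) (by fun_prop) (hX.hasInt hi k) (hY.hasInt hi' k')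

theorem integral_fst_sq_add :
    ∫ ω, ((X + Y) ω).1 ^ 2 ∂μ = ∫ ω, (X ω).1 ^ 2 ∂μ + ∫ ω, (Y ω).1 ^ 2 ∂μ := by
  have h := ((hX.hasInt le_rfl 0).add (hY.hasInt le_rfl 0)).add
    ((hX.hasInt_mul hY hXY (i := 1) (i' := 1) (by norm_num) (by norm_num) 0 0).const_mul 2)
  simp only [pow_one, pow_zero, mul_one, hX.mean_fst, hY.mean_fst, mul_zero, add_zero] at h
  rw [← h.2]
  refine integral_congr_ae (Eventually.of_forall fun ω => ?_)
  simp only [Pi.add_apply, Prod.fst_add]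
  ring

theorem integral_snd_sq_add :
    ∫ ω, ((X + Y) ω).2 ^ 2 ∂μ = ∫ ω, (X ω).2 ^ 2 ∂μ + ∫ ω, (Y ω).2 ^ 2 ∂μ := by
  have h := ((hX.hasInt (i := 0) (by norm_num) 2).add (hY.hasInt (i := 0) (by norm_num) 2)).add
    ((hX.hasInt_mul hY hXY (i := 0) (i' := 0) (by norm_num) (by norm_num) 1 1).const_mul 2)
  simp only [pow_one, pow_zero, one_mul, hX.mean_snd, hY.mean_snd, mul_zero, add_zero] at h
  rw [← h.2]
  refine integral_congr_ae (Eventually.of_forall fun ω => ?_)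
  simp only [Pi.add_apply, Prod.snd_add]
  ring

/-- Terms of degree one in `X` or in `Y` vanish by centring and independence. The term `4 X₁ X₂ Y₁
Y₂` is at most `2 X₁² Y₂² + 2 X₂² Y₁²` pointwise, which raises the coefficients of these two
products from 1 to 3. -/
theorem integral_sq_mul_sq_add_le :
    ∫ ω, ((X + Y) ω).1 ^ 2 * ((X + Y) ω).2 ^ 2 ∂μ ≤
      ∫ ω, (X ω).1 ^ 2 * (X ω).2 ^ 2 ∂μ
      + 3 * ((∫ ω, (X ω).1 ^ 2 ∂μ) * ∫ ω, (Y ω).2 ^ 2 ∂μ)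
      + 3 * ((∫ ω, (X ω).2 ^ 2 ∂μ) * ∫ ω, (Y ω).1 ^ 2 ∂μ)
      + ∫ ω, (Y ω).1 ^ 2 * (Y ω).2 ^ 2 ∂μ := by
  have m := fun {i i' : ℕ} (hi : i ≤ 2) (hi' : i' ≤ 2) k k' => hX.hasInt_mul hY hXY hi hi' k k'
  have h := (((((((hX.hasInt le_rfl 2).add
    ((m (i := 2) (i' := 0) (by norm_num) (by norm_num) 0 2).const_mul 3)).add
    ((m (i := 0) (i' := 2) (by norm_num) (by norm_num) 2 0).const_mul 3)).add
    (hY.hasInt le_rfl 2)).add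
    ((m (i := 2) (i' := 0) (by norm_num) (by norm_num) 1 1).const_mul 2)).add
    ((m (i := 1) (i' := 1) (by norm_num) (by norm_num) 2 0).const_mul 2)).add
    ((m (i := 1) (i' := 1) (by norm_num) (by norm_num) 0 2).const_mul 2)).add
    ((m (i := 0) (i' := 2) (by norm_num) (by norm_num) 1 1).const_mul 2)
  simp only [pow_one, pow_zero, mul_one, one_mul, hX.mean_fst, hY.mean_fst, hX.mean_snd,
    hY.mean_snd, mul_zero, zero_mul, add_zero] at h
  rw [← h.2]
  refine integral_mono ((hX.add hY).integrable_pow le_rfl 2) h.1 fun ω => ?_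
  simp only [Pi.add_apply, Prod.fst_add, Prod.snd_add]
  nlinarith [sq_nonneg ((X ω).1 * (Y ω).2 - (X ω).2 * (Y ω).1)]

end CentredPair

variable [IsProbabilityMeasure μ] {ι : Type*} {X : ι → Ω → ℝ × ℝ} {β : ι → ℝ}

/-- Moments of sums of independent centred pairs. -/
theorem centredPair_sum (hX : ∀ i, CentredPair μ (X i) (β i)) (hind : iIndepFun X μ)
    (s : Finset ι) :
    CentredPair μ (∑ i ∈ s, X i) (∑ i ∈ s, β i) ∧
    ∫ ω, ((∑ i ∈ s, X i) ω).1 ^ 2 ∂μ = ∑ i ∈ s, ∫ ω, (X i ω).1 ^ 2 ∂μ ∧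
    ∫ ω, ((∑ i ∈ s, X i) ω).2 ^ 2 ∂μ ≤ ∑ i ∈ s, β i ^ 2 ∧
    ∫ ω, ((∑ i ∈ s, X i) ω).1 ^ 2 * ((∑ i ∈ s, X i) ω).2 ^ 2 ∂μ ≤
      3 * ((∑ i ∈ s, ∫ ω, (X i ω).1 ^ 2 ∂μ) * ∑ i ∈ s, β i ^ 2) := by
  classical
  induction s using Finset.induction_on with
  | empty =>
    refine ⟨⟨?_, ?_, ?_, ?_, ?_⟩, ?_, ?_, ?_⟩ <;>
      simp [Pi.zero_def, measurable_const]
  | insert a s ha ih =>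
    obtain ⟨h1, h2, h3, h4⟩ := ih
    have hi : IndepFun (∑ i ∈ s, X i) (X a) μ :=
      hind.indepFun_finsetSum_of_notMem (fun i => (hX i).measurable) ha
    have e := h1.integral_fst_sq_add (hX a) hi
    have e' := h1.integral_snd_sq_add (hX a) hi
    have le := h1.integral_sq_mul_sq_add_le (hX a) hi
    have b1 := (hX a).integral_snd_sq_le
    have b2 := (hX a).integral_mul_sq_le
    rw [Finset.sum_insert ha, Finset.sum_insert ha, Finset.sum_insert ha, Finset.sum_insert ha,
      add_comm (X a), add_comm (β a), add_comm (∫ ω, (X a ω).1 ^ 2 ∂μ), add_comm (β a ^ 2)]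
    refine ⟨h1.add (hX a), by rw [e, h2], by rw [e']; exact add_le_add h3 b1, le.trans ?_⟩
    rw [h2]
    set V := ∑ i ∈ s, ∫ ω, (X i ω).1 ^ 2 ∂μ
    set Q := ∑ i ∈ s, β i ^ 2
    have hV : 0 ≤ V := Finset.sum_nonneg fun i _ => integral_nonneg fun ω => sq_nonneg _
    have hv : 0 ≤ ∫ ω, (X a ω).1 ^ 2 ∂μ := integral_nonneg fun ω => sq_nonneg _
    -- The target `3 (V + v)(Q + β²)` contains each of the four terms of the recursion; the last
    -- one, `v β²`, is even covered three times.
    have m1 := mul_le_mul_of_nonneg_left b1 hV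
    have m2 := mul_le_mul_of_nonneg_right h3 hv
    have m3 := mul_nonneg hv (sq_nonneg (β a))
    linarith

/-- Second moment of `b + S` and mixed moment of `b + S` and `b' + T`, for a centred pair
`(S, T)`. -/
theorem CentredPair.integral_shift {X : Ω → ℝ × ℝ} {B V Q : ℝ} (hX : CentredPair μ X B)
    (hV : ∫ ω, (X ω).1 ^ 2 ∂μ = V) (hQ : ∫ ω, (X ω).2 ^ 2 ∂μ ≤ Q)
    (hVQ : ∫ ω, (X ω).1 ^ 2 * (X ω).2 ^ 2 ∂μ ≤ 3 * (V * Q)) (b b' : ℝ) :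
    HasInt μ (fun ω => (b + (X ω).1) ^ 2) (b ^ 2 + V) ∧
    Integrable (fun ω => (b + (X ω).1) ^ 2 * (b' + (X ω).2) ^ 2) μ ∧
    ∫ ω, (b + (X ω).1) ^ 2 * (b' + (X ω).2) ^ 2 ∂μ ≤ 4 * ((b ^ 2 + V) * (b' ^ 2 + 3 * Q)) := by
  have h10 := hX.hasInt (i := 1) (by norm_num) 0
  have h20 := hX.hasInt (i := 2) (by norm_num) 0
  have h02 := hX.hasInt (i := 0) (by norm_num) 2
  have h22 := hX.hasInt (i := 2) (by norm_num) 2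
  simp only [pow_one, pow_zero, mul_one, one_mul, hX.mean_fst, hV] at h10 h20 h02
  have hV0 : 0 ≤ V := hV ▸ integral_nonneg fun ω => sq_nonneg _
  have hQ0 : 0 ≤ Q := le_trans (integral_nonneg fun ω => sq_nonneg _) hQ
  have hb : ∀ b : ℝ, MemLp (fun ω => b + (X ω).1) 2 μ := fun b => (memLp_const b).add hX.memLp
  have hint : Integrable (fun ω => (b + (X ω).1) ^ 2 * (b' + (X ω).2) ^ 2) μ := by
    refine (hb b).integrable_sq.mul_bdd (c := (|b'| + B) ^ 2)
      ((hX.measurable_snd.const_add b').pow_const 2).aestronglyMeasurable ?_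
    filter_upwards [hX.bound] with ω hω
    rw [norm_pow, Real.norm_eq_abs]
    exact pow_le_pow_left₀ (abs_nonneg _) ((abs_add_le _ _).trans (by gcongr)) 2
  refine ⟨?_, hint, ?_⟩
  · have h := ((hasInt_const (μ := μ) (b ^ 2)).add (h10.const_mul (2 * b))).add h20
    rw [mul_zero, add_zero] at h
    convert h using 2
    ring
  · have h := ((((hasInt_const (μ := μ) (b ^ 2 * b' ^ 2)).add (h02.const_mul (b ^ 2))).add
      (h20.const_mul (b' ^ 2))).add h22).const_mul 4
    refine (integral_mono hint h.1 fun ω => ?_).trans (h.2.le.trans ?_)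
    -- Used once in each factor, this inequality is the source of the constant 4.
    · have e1 : (b + (X ω).1) ^ 2 ≤ 2 * (b ^ 2 + (X ω).1 ^ 2) := by
        nlinarith [sq_nonneg (b - (X ω).1)]
      have e2 : (b' + (X ω).2) ^ 2 ≤ 2 * (b' ^ 2 + (X ω).2 ^ 2) := by
        nlinarith [sq_nonneg (b' - (X ω).2)]
      refine (mul_le_mul e1 e2 (sq_nonneg _) (by positivity)).trans (le_of_eq ?_)
      ring
    · have m1 := mul_le_mul_of_nonneg_left hQ (sq_nonneg b)
      have m2 := mul_nonneg (sq_nonneg b) hQ0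
      linarith

end Moments

/-! ### The conditional mean squared error given the design points -/

section CondMSE

/-- The effect of replacing `1 / t²` by `1 / τ²` is controlled by `(t - τ)²`. -/
theorem exists_ratio_bound {r τ : ℝ} (hr : 0 < r) (hτ : r < |τ|) {ε : ℝ} (hε : 0 < ε) :
    ∃ C, 0 ≤ C ∧ ∀ t : ℝ, |(if r ≤ |t| then τ ^ 2 / t ^ 2 else 0) - 1| ≤ ε + C * (t - τ) ^ 2 := by
  have hτ0 : τ ≠ 0 := fun h => by rw [h, abs_zero] at hτ; linarith
  have hcont : Tendsto (fun t : ℝ => |τ ^ 2 / t ^ 2 - 1|) (𝓝 τ) (𝓝 0) := by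
    have : Tendsto (fun t : ℝ => |τ ^ 2 / t ^ 2 - 1|) (𝓝 τ) (𝓝 |τ ^ 2 / τ ^ 2 - 1|) :=
      ((tendsto_const_nhds.div (tendsto_id.pow 2) (pow_ne_zero 2 hτ0)).sub_const 1).abs
    rwa [div_self (pow_ne_zero 2 hτ0), sub_self, abs_zero] at this
  obtain ⟨δ, hδ, h⟩ := Metric.eventually_nhds_iff.1 ((hcont.eventually_lt_const hε).and
    ((continuous_abs.tendsto τ).eventually_const_lt hτ))
  -- Within `δ` of `τ` continuity gives `ε`. Farther away the left side is at most `τ² / r² + 1`,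
  -- thanks to the truncation at `r`, while `(t - τ)² ≥ δ²`.
  refine ⟨(τ ^ 2 / r ^ 2 + 1) / δ ^ 2, by positivity, fun t => ?_⟩
  rcases lt_or_ge (dist t τ) δ with hd | hd
  · have := h hd
    rw [if_pos this.2.le]
    exact this.1.le.trans (le_add_of_nonneg_right (by positivity))
  · have hsq : δ ^ 2 ≤ (t - τ) ^ 2 := by
      rw [← sq_abs (t - τ)]; exact pow_le_pow_left₀ hδ.le hd 2
    have h1 : |(if r ≤ |t| then τ ^ 2 / t ^ 2 else 0) - 1| ≤ τ ^ 2 / r ^ 2 + 1 := by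
      refine (abs_sub _ _).trans (add_le_add ?_ (by simp))
      split_ifs with hrt
      · rw [abs_of_nonneg (by positivity), ← sq_abs t]
        gcongr
      · rw [abs_zero]; positivity
    have h2 : τ ^ 2 / r ^ 2 + 1 ≤ (τ ^ 2 / r ^ 2 + 1) / δ ^ 2 * (t - τ) ^ 2 := by
      rw [div_mul_eq_mul_div, le_div_iff₀ (by positivity)]
      gcongr
    linarith

/-- The conditional mean of `Y - τ D`. -/
noncomputable def mResid (κ : Kernel ℝ (ℝ × ℝ)) (τ x : ℝ) : ℝ := mY κ x - τ * mD κ x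

/-- The conditional variance of `Y - τ D`. -/
noncomputable def varResid (κ : Kernel ℝ (ℝ × ℝ)) (τ x : ℝ) : ℝ :=
  varY κ x + τ ^ 2 * varD κ x - 2 * τ * covYD κ x

variable {κ : Kernel ℝ (ℝ × ℝ)} {τ : ℝ}

/-- The weighted centred values of `Y - τ D` and `D` at `x`. -/
noncomputable def residPair (κ : Kernel ℝ (ℝ × ℝ)) (τ w x : ℝ) (p : ℝ × ℝ) : ℝ × ℝ :=
  (w * (p.1 - τ * p.2 - mResid κ τ x), w * (p.2 - mD κ x))

theorem measurable_residPair (w x : ℝ) : Measurable (residPair κ τ w x) := by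
  unfold residPair; fun_prop

theorem memLp_fst {x : ℝ} (hY : Integrable (fun p : ℝ × ℝ => p.1 ^ 2) (κ x)) :
    MemLp (fun p : ℝ × ℝ => p.1) 2 (κ x) :=
  (memLp_two_iff_integrable_sq measurable_fst.aestronglyMeasurable).2 hY

variable [IsMarkovKernel κ]

theorem ae_abs_snd_sub_le {x : ℝ} (hD : ∀ᵐ p ∂κ x, p.2 = 0 ∨ p.2 = 1) :
    ∀ᵐ p ∂κ x, |p.2 - mD κ x| ≤ 1 := by
  have h01 : ∀ᵐ p ∂κ x, 0 ≤ p.2 ∧ p.2 ≤ 1 := by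
    filter_upwards [hD] with p hp
    rcases hp with h | h <;> simp [h]
  have hint : Integrable (fun p : ℝ × ℝ => p.2) (κ x) :=
    (integrable_const (1 : ℝ)).mono' measurable_snd.aestronglyMeasurable
      (h01.mono fun p hp => by rw [Real.norm_eq_abs, abs_le]; constructor <;> linarith)
  have h0 : 0 ≤ mD κ x := integral_nonneg_of_ae (h01.mono fun p hp => hp.1)
  have h1 : mD κ x ≤ 1 := by
    have := integral_mono_ae hint (integrable_const (1 : ℝ)) (h01.mono fun p hp => hp.2)
    simpa [mD, condMean] using this
  filter_upwards [h01] with p hp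
  rw [abs_le]
  constructor <;> linarith

theorem integrable_snd {x : ℝ} (hD : ∀ᵐ p ∂κ x, p.2 = 0 ∨ p.2 = 1) :
    Integrable (fun p : ℝ × ℝ => p.2) (κ x) :=
  (integrable_const (1 : ℝ)).mono' measurable_snd.aestronglyMeasurable
    (hD.mono fun p hp => by rcases hp with h | h <;> simp [h])

theorem memLp_snd {x : ℝ} (hD : ∀ᵐ p ∂κ x, p.2 = 0 ∨ p.2 = 1) :
    MemLp (fun p : ℝ × ℝ => p.2) 2 (κ x) :=
  MemLp.of_bound measurable_snd.aestronglyMeasurable 1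
    (hD.mono fun p hp => by rcases hp with h | h <;> simp [h])

/-- The second moment of `Y` is available only near the cut-off, so it is requested only where the
weight is nonzero; a zero weight makes the pair identically zero. -/
theorem centredPair_residPair {w x : ℝ}
    (hY : w ≠ 0 → Integrable (fun p : ℝ × ℝ => p.1 ^ 2) (κ x))
    (hD : ∀ᵐ p ∂κ x, p.2 = 0 ∨ p.2 = 1) : CentredPair (κ x) (residPair κ τ w x) |w| := by
  have hD1 := integrable_snd hD
  rcases eq_or_ne w 0 with rfl | hw
  · refine ⟨measurable_residPair _ _, ?_, ?_, ?_, ?_⟩ <;> simp [residPair]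
  have hY2 := memLp_fst (hY hw)
  have hY1 : Integrable (fun p : ℝ × ℝ => p.1) (κ x) := hY2.integrable one_le_two
  refine ⟨measurable_residPair _ _, ?_, ?_, ?_, ?_⟩
  · exact ((hY2.sub ((memLp_snd hD).const_mul τ)).sub (memLp_const _)).const_mul w
  · filter_upwards [ae_abs_snd_sub_le hD] with p hp
    simp only [residPair]
    rw [abs_mul]
    exact mul_le_of_le_one_right (abs_nonneg _) hp
  · simp only [residPair]
    have hYD : Integrable (fun p : ℝ × ℝ => p.1 - τ * p.2) (κ x) := hY1.sub (hD1.const_mul τ)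
    rw [integral_const_mul, integral_sub hYD (integrable_const _),
      integral_sub hY1 (hD1.const_mul τ), integral_const_mul]
    simp [mResid, mY, mD, condMean]
  · simp only [residPair]
    rw [integral_const_mul, integral_sub hD1 (integrable_const _)]
    simp [mD, condMean]

theorem integral_residPair_sq {w x : ℝ}
    (hY : w ≠ 0 → Integrable (fun p : ℝ × ℝ => p.1 ^ 2) (κ x))
    (hD : ∀ᵐ p ∂κ x, p.2 = 0 ∨ p.2 = 1) :
    ∫ p, (residPair κ τ w x p).1 ^ 2 ∂κ x = w ^ 2 * varResid κ τ x := by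
  rcases eq_or_ne w 0 with rfl | hw
  · simp [residPair]
  have hY2 : MemLp (fun p : ℝ × ℝ => p.1 - mY κ x) 2 (κ x) := (memLp_fst (hY hw)).sub (memLp_const _)
  have hD2 : MemLp (fun p : ℝ × ℝ => p.2 - mD κ x) 2 (κ x) := (memLp_snd hD).sub (memLp_const _)
  have h1 : HasInt (κ x) (fun p : ℝ × ℝ => (p.1 - mY κ x) * (p.1 - mY κ x)) (varY κ x) :=
    ⟨hY2.integrable_mul hY2, rfl⟩
  have h2 : HasInt (κ x) (fun p : ℝ × ℝ => (p.2 - mD κ x) * (p.2 - mD κ x)) (varD κ x) :=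
    ⟨hD2.integrable_mul hD2, rfl⟩
  have h3 : HasInt (κ x) (fun p : ℝ × ℝ => (p.1 - mY κ x) * (p.2 - mD κ x)) (covYD κ x) :=
    ⟨hY2.integrable_mul hD2, rfl⟩
  have h := ((h1.add (h2.const_mul (τ ^ 2))).add (h3.const_mul (-(2 * τ)))).const_mul (w ^ 2)
  calc ∫ p, (residPair κ τ w x p).1 ^ 2 ∂κ x = _ := by
        refine integral_congr_ae (Eventually.of_forall fun p => ?_)
        simp only [residPair, mResid]
        ring
    _ = _ := h.2
    _ = _ := by unfold varResid; ring

/-- Bound for the conditional mean squared error of a ratio of linear statistics, in terms of the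
conditional bias and variance of the linearized statistic. -/
theorem abs_condMSE_sub_le {n : ℕ} {x w : Fin n → ℝ}
    (hY : ∀ i, w i ≠ 0 → Integrable (fun p : ℝ × ℝ => p.1 ^ 2) (κ (x i)))
    (hD : ∀ i, ∀ᵐ p ∂κ (x i), p.2 = 0 ∨ p.2 = 1) {r τD ε C : ℝ} (hr : 0 < r)
    (hC : 0 ≤ C)
    (hbound : ∀ t : ℝ, |(if r ≤ |t| then τD ^ 2 / t ^ 2 else 0) - 1| ≤ ε + C * (t - τD) ^ 2) :
    |τD ^ 2 * ∫ z in {z : Fin n → ℝ × ℝ | r ≤ |∑ i, w i * (z i).2|},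
        ((∑ i, w i * (z i).1) / (∑ i, w i * (z i).2) - τ) ^ 2 ∂(Measure.pi fun i => κ (x i))
      - ((∑ i, w i * mResid κ τ (x i)) ^ 2 + ∑ i, w i ^ 2 * varResid κ τ (x i))| ≤
    ((∑ i, w i * mResid κ τ (x i)) ^ 2 + ∑ i, w i ^ 2 * varResid κ τ (x i)) *
      (ε + 4 * C * ((∑ i, w i * mD κ (x i) - τD) ^ 2 + 3 * ∑ i, w i ^ 2)) := by
  set μ := Measure.pi fun i => κ (x i) with hμ
  set b := ∑ i, w i * mResid κ τ (x i) with hb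
  set b' := ∑ i, w i * mD κ (x i) - τD with hb'
  set V := ∑ i, w i ^ 2 * varResid κ τ (x i) with hV
  set Q := ∑ i, w i ^ 2 with hQ
  have hpair := fun i => centredPair_residPair (τ := τ) (hY i) (hD i)
  have hX : ∀ i, CentredPair μ (fun z => residPair κ τ (w i) (x i) (z i)) |w i| := fun i =>
    ⟨(hpair i).measurable.comp (measurable_pi_apply i),
      (hpair i).memLp.comp_measurePreserving (measurePreserving_eval (fun i => κ (x i)) i),
      (measurePreserving_eval (fun i => κ (x i)) i).quasiMeasurePreserving.ae (hpair i).bound,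
      by rw [← (hpair i).mean_fst]
         exact integral_comp_eval (μ := fun i => κ (x i))
          (hpair i).measurable_fst.aestronglyMeasurable,
      by rw [← (hpair i).mean_snd]
         exact integral_comp_eval (μ := fun i => κ (x i))
          (hpair i).measurable_snd.aestronglyMeasurable⟩
  have hsq : ∀ i, ∫ z, (residPair κ τ (w i) (x i) (z i)).1 ^ 2 ∂μ = w i ^ 2 * varResid κ τ (x i) :=
    fun i => by
      rw [← integral_residPair_sq (hY i) (hD i)]
      exact integral_comp_eval (μ := fun i => κ (x i))
        (f := fun p => (residPair κ τ (w i) (x i) p).1 ^ 2)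
        ((hpair i).measurable_fst.pow_const 2).aestronglyMeasurable
  have hind : iIndepFun (fun i (z : Fin n → ℝ × ℝ) => residPair κ τ (w i) (x i) (z i)) μ :=
    iIndepFun_pi (μ := fun i => κ (x i)) (X := fun i => residPair κ τ (w i) (x i))
      fun i => (measurable_residPair _ _).aemeasurable
  obtain ⟨c1, c2, c3, c4⟩ := centredPair_sum hX hind Finset.univ
  simp only [hsq, sq_abs] at c2 c3 c4
  obtain ⟨m1, m2, m3⟩ := c1.integral_shift c2 c3 c4 b b'
  set S := ∑ i, (fun z : Fin n → ℝ × ℝ => residPair κ τ (w i) (x i) (z i)) with hS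
  have hS1 : ∀ z, b + (S z).1 = ∑ i, w i * ((z i).1 - τ * (z i).2) := fun z => by
    simp only [hS, Finset.sum_apply, Prod.fst_sum, residPair, hb, ← Finset.sum_add_distrib]
    exact Finset.sum_congr rfl fun i _ => by ring
  have hS2 : ∀ z, b' + (S z).2 = ∑ i, w i * (z i).2 - τD := fun z => by
    simp only [hS, Finset.sum_apply, Prod.snd_sum, residPair, hb', mul_sub, Finset.sum_sub_distrib]
    ring
  set g : ℝ → ℝ := fun t => if r ≤ |t| then τD ^ 2 / t ^ 2 else 0 with hg
  have hgm : Measurable g := by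
    refine Measurable.ite (measurableSet_le measurable_const measurable_id.abs) (by fun_prop)
      measurable_const
  have hDm : Measurable fun z : Fin n → ℝ × ℝ => ∑ i, w i * (z i).2 := by fun_prop
  have hset : MeasurableSet {z : Fin n → ℝ × ℝ | r ≤ |∑ i, w i * (z i).2|} :=
    measurableSet_le measurable_const hDm.abs
  -- Subtracting `τ` from the ratio turns the numerator into the linear statistic in `Y - τ D`; the
  -- truncation and the factor `τD² / (∑ w D)²` are collected in `g`.
  have e1 : τD ^ 2 * ∫ z in {z : Fin n → ℝ × ℝ | r ≤ |∑ i, w i * (z i).2|},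
        ((∑ i, w i * (z i).1) / (∑ i, w i * (z i).2) - τ) ^ 2 ∂μ =
      ∫ z, (b + (S z).1) ^ 2 * g (∑ i, w i * (z i).2) ∂μ := by
    rw [← integral_const_mul, ← integral_indicator hset]
    refine integral_congr_ae (Eventually.of_forall fun z => ?_)
    simp only [indicator_apply, mem_ofPred_eq, hg, hS1]
    split_ifs with h
    · have hne : ∑ i, w i * (z i).2 ≠ 0 := fun h0 => by rw [h0, abs_zero] at h; linarith
      have : ∑ i, w i * ((z i).1 - τ * (z i).2) =
          ∑ i, w i * (z i).1 - τ * ∑ i, w i * (z i).2 := by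
        rw [Finset.mul_sum, ← Finset.sum_sub_distrib]
        exact Finset.sum_congr rfl fun i _ => by ring
      rw [this]
      field_simp
    · rw [mul_zero]
  have hint : Integrable (fun z => (b + (S z).1) ^ 2 * g (∑ i, w i * (z i).2)) μ := by
    refine m1.1.mul_bdd (c := τD ^ 2 / r ^ 2) (hgm.comp hDm).aestronglyMeasurable
      (Eventually.of_forall fun z => ?_)
    simp only [hg, Real.norm_eq_abs]
    split_ifs with h
    · rw [abs_of_nonneg (by positivity), ← sq_abs (∑ i, _)]
      gcongr
    · rw [abs_zero]; positivity
  rw [e1, ← m1.2, ← integral_sub hint m1.1]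
  have hle : ∫ z, |(b + (S z).1) ^ 2 * g (∑ i, w i * (z i).2) - (b + (S z).1) ^ 2| ∂μ ≤
      ∫ z, ε * (b + (S z).1) ^ 2 + C * ((b + (S z).1) ^ 2 * (b' + (S z).2) ^ 2) ∂μ := by
    refine integral_mono (hint.sub m1.1).abs ((m1.1.const_mul ε).add (m2.const_mul C)) fun z => ?_
    have h := mul_le_mul_of_nonneg_left (hbound (∑ i, w i * (z i).2)) (sq_nonneg (b + (S z).1))
    simp only
    rw [← mul_sub_one, abs_mul, abs_of_nonneg (sq_nonneg _), hS2]
    refine h.trans (le_of_eq ?_)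
    ring
  refine abs_integral_le_integral_abs.trans (hle.trans ?_)
  rw [integral_add (m1.1.const_mul ε) (m2.const_mul C), integral_const_mul, integral_const_mul]
  have := mul_le_mul_of_nonneg_left m3 hC
  rw [m1.2]
  linarith

/-- The weights of the jump estimator. -/
noncomputable def llrWeight (K : ℝ → ℝ) (c h : ℝ) (j : Side) {n : ℕ} (x : Fin n → ℝ) (i : Fin n) :
    ℝ :=
  (wsum K c h j x 1 2 *
      (Side.region c j).indicator (fun t => K ((t - c) / h) * (t - c) ^ 0) (x i)
    - wsum K c h j x 1 1 *
      (Side.region c j).indicator (fun t => K ((t - c) / h) * (t - c) ^ 1) (x i)) /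
    (wsum K c h j x 1 0 * wsum K c h j x 1 2 - wsum K c h j x 1 1 ^ 2)

/-- The weights of the estimated jump. -/
noncomputable def jumpWeight (K : ℝ → ℝ) (c : ℝ) (h : Side → ℝ) {n : ℕ} (x : Fin n → ℝ)
    (i : Fin n) : ℝ :=
  llrWeight K c (h .pos) .pos x i - llrWeight K c (h .neg) .neg x i

variable {K : ℝ → ℝ} {c : ℝ} {n : ℕ}

theorem llr_eq_sum (h : ℝ) (j : Side) (x y : Fin n → ℝ) :
    llr K c h j x y = ∑ i, llrWeight K c h j x i * y i := by
  have e : ∀ a b : ℝ, a * wsum K c h j x y 0 - b * wsum K c h j x y 1 =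
      ∑ i, (a * (Side.region c j).indicator (fun t => K ((t - c) / h) * (t - c) ^ 0) (x i)
        - b * (Side.region c j).indicator (fun t => K ((t - c) / h) * (t - c) ^ 1) (x i)) * y i := by
    intro a b
    rw [wsum, wsum, Finset.mul_sum, Finset.mul_sum, ← Finset.sum_sub_distrib]
    exact Finset.sum_congr rfl fun i _ => by ring
  simp only [llr, llrWeight, div_mul_eq_mul_div, ← Finset.sum_div, e]

theorem jumpHat_eq_sum (h : Side → ℝ) (x y : Fin n → ℝ) :
    jumpHat K c h x y = ∑ i, jumpWeight K c h x i * y i := by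
  simp only [jumpHat, llr_eq_sum, jumpWeight, sub_mul, Finset.sum_sub_distrib]

theorem llrWeight_of_notMem (h : ℝ) {j : Side} (x : Fin n → ℝ) {i : Fin n}
    (hi : x i ∉ Side.region c j) : llrWeight K c h j x i = 0 := by
  simp [llrWeight, hi]

theorem llrWeight_of_eq_zero {h : ℝ} {j : Side} (x : Fin n → ℝ) {i : Fin n}
    (hi : K ((x i - c) / h) = 0) : llrWeight K c h j x i = 0 := by
  have e : ∀ k : ℕ, (Side.region c j).indicator (fun t => K ((t - c) / h) * (t - c) ^ k) (x i) = 0 :=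
    fun k => indicator_apply_eq_zero.2 fun _ => by rw [hi, zero_mul]
  rw [llrWeight, e, e]
  simp

/-- Each observation belongs to one side only, so the cross product of the weights vanishes and the
variances add. -/
theorem jumpWeight_sq (h : Side → ℝ) (x : Fin n → ℝ) (i : Fin n) :
    jumpWeight K c h x i ^ 2 =
      llrWeight K c (h .pos) .pos x i ^ 2 + llrWeight K c (h .neg) .neg x i ^ 2 := by
  rcases lt_or_ge (x i) c with hx | hx
  · rw [jumpWeight, llrWeight_of_notMem (j := .pos) _ _ (by simpa [Side.region] using hx)]
    ring
  · rw [jumpWeight, llrWeight_of_notMem (j := .neg) _ _ (by simpa [Side.region] using hx)]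
    ring

/-- Conditional bias and variance of the linearized estimator control its conditional mean
squared error. -/
theorem abs_tauD_sq_mul_condMSE_sub_le {x : Fin n → ℝ} {h : Side → ℝ}
    (hY : ∀ i, jumpWeight K c h x i ≠ 0 → Integrable (fun p : ℝ × ℝ => p.1 ^ 2) (κ (x i)))
    (hD : ∀ i, ∀ᵐ p ∂κ (x i), p.2 = 0 ∨ p.2 = 1) {r ε C : ℝ} (hr : 0 < r) (hC : 0 ≤ C)
    (hbound : ∀ t : ℝ,
      |(if r ≤ |t| then tauD κ c ^ 2 / t ^ 2 else 0) - 1| ≤ ε + C * (t - tauD κ c) ^ 2) :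
    |tauD κ c ^ 2 * condMSE K κ c r h x
      - (jumpHat K c h x (fun i => mResid κ (tau κ c) (x i)) ^ 2
        + ∑ i, jumpWeight K c h x i ^ 2 * varResid κ (tau κ c) (x i))| ≤
    (jumpHat K c h x (fun i => mResid κ (tau κ c) (x i)) ^ 2
        + ∑ i, jumpWeight K c h x i ^ 2 * varResid κ (tau κ c) (x i)) *
      (ε + 4 * C * ((jumpHat K c h x (fun i => mD κ (x i)) - tauD κ c) ^ 2
        + 3 * ∑ i, jumpWeight K c h x i ^ 2)) := by
  simp only [condMSE, tauHat, jumpHat_eq_sum]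
  exact abs_condMSE_sub_le hY hD hr hC hbound

end CondMSE

/-! ### Kernel-weighted empirical means -/

section Empirical

/-- Bounded measurable functions with bounded support. -/
structure IsWeightFun (g : ℝ → ℝ) : Prop where
  measurable : Measurable g
  bounded : ∃ B, ∀ u, |g u| ≤ B
  support : ∃ R, ∀ u, R < |u| → g u = 0

namespace IsWeightFun

variable {g : ℝ → ℝ}

theorem integrable (hg : IsWeightFun g) : Integrable g := by
  obtain ⟨B, hB⟩ := hg.bounded
  obtain ⟨R, hR⟩ := hg.support
  have hsub : Function.support g ⊆ Icc (-R) R := fun u hu => by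
    by_contra h
    exact hu (hR u (not_le.1 fun h' => h (abs_le.1 h')))
  rw [← integrableOn_iff_integrable_of_support_subset hsub]
  exact Measure.integrableOn_of_bounded (M := B) (by simp) hg.measurable.aestronglyMeasurable
    (Eventually.of_forall hB)

theorem mul_pow (hg : IsWeightFun g) (k : ℕ) : IsWeightFun fun u => g u * u ^ k := by
  obtain ⟨B, hB⟩ := hg.bounded
  obtain ⟨R, hR⟩ := hg.support
  refine ⟨hg.measurable.mul (by fun_prop), ⟨B * |R| ^ k, fun u => ?_⟩, R, fun u hu => by
    rw [hR u hu, zero_mul]⟩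
  rw [abs_mul, abs_pow]
  have hB0 := (abs_nonneg _).trans (hB u)
  rcases lt_or_ge R |u| with h | h
  · rw [hR u h, abs_zero, zero_mul]; positivity
  · exact mul_le_mul (hB u) (pow_le_pow_left₀ (abs_nonneg _) (h.trans (le_abs_self R)) k)
      (by positivity) hB0

theorem abs (hg : IsWeightFun g) : IsWeightFun fun u => |g u| :=
  ⟨hg.measurable.abs, by simpa using hg.bounded, by simpa using hg.support⟩

theorem sq (hg : IsWeightFun g) : IsWeightFun fun u => g u ^ 2 := by
  obtain ⟨B, hB⟩ := hg.bounded
  obtain ⟨R, hR⟩ := hg.support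
  refine ⟨hg.measurable.pow_const 2, ⟨B ^ 2, fun u => ?_⟩, R, fun u hu => by
    rw [hR u hu, zero_pow two_ne_zero]⟩
  rw [abs_pow]
  exact pow_le_pow_left₀ (abs_nonneg _) (hB u) 2

end IsWeightFun

/-- `(n h)⁻¹ ∑ g ((x_i - c) / h)`. -/
noncomputable def empMean (c h : ℝ) {n : ℕ} (x : Fin n → ℝ) (g : ℝ → ℝ) : ℝ :=
  1 / (n * h) * ∑ i, g ((x i - c) / h)

/-- The mean of `empMean`. -/
noncomputable def smoothed (f : ℝ → ℝ) (c h : ℝ) (g : ℝ → ℝ) : ℝ := ∫ u, g u * f (c + h * u)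

variable {Ω : Type*} [MeasurableSpace Ω] {P : Measure Ω} {X : ℕ → Ω → ℝ} {f : ℝ → ℝ} {c : ℝ}
  {g : ℝ → ℝ}

/-- Differentiability at the single point `c` suffices: the support of `g` is bounded, so `f(c + h
u) - f(c) - f'(c) h u` is `o(h |u|)` uniformly over the `u` that matter. -/
theorem smoothed_expansion (hf : DifferentiableAt ℝ f c) (hfm : Measurable f)
    (hfb : ∃ M, ∀ x, |f x| ≤ M) (hg : IsWeightFun g) {h : ℕ → ℝ}
    (hpos : ∀ᶠ n in atTop, 0 < h n) (h0 : Tendsto h atTop (𝓝 0)) :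
    Tendsto (fun n => (smoothed f c (h n) g - f c * ∫ u, g u) / h n) atTop
      (𝓝 (deriv f c * ∫ u, g u * u)) := by
  have hgu : IsWeightFun fun u => g u * u := by simpa using hg.mul_pow 1
  obtain ⟨R, hR⟩ := hg.support
  obtain ⟨M, hM⟩ := hfb
  rw [Metric.tendsto_nhds]
  intro ε hε
  set I := ∫ u, |g u * u| with hI
  have hI0 : 0 ≤ I := integral_nonneg fun u => abs_nonneg _
  set η := ε / (I + 1) with hη
  have hη0 : 0 < η := by positivity
  have hder := hasDerivAt_iff_isLittleO.1 hf.hasDerivAt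
  obtain ⟨δ, hδ, hδf⟩ := Metric.eventually_nhds_iff.1 (Asymptotics.isLittleO_iff.1 hder hη0)
  have hhR : ∀ᶠ n in atTop, h n * (|R| + 1) < δ := by
    have : Tendsto (fun n => h n * (|R| + 1)) atTop (𝓝 0) := by simpa using h0.mul_const (|R| + 1)
    exact this.eventually_lt_const hδ
  filter_upwards [hpos, hhR] with n hn hnR
  have i1 : Integrable fun u => g u * f (c + h n * u) :=
    hg.integrable.mul_bdd (c := M)
      (hfm.comp (by fun_prop : Measurable fun u => c + h n * u)).aestronglyMeasurable
      (Eventually.of_forall fun u => hM _)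
  have i2 : Integrable fun u => f c * g u := hg.integrable.const_mul _
  have i12 : Integrable fun u => g u * f (c + h n * u) - f c * g u := i1.sub i2
  have i3 : Integrable fun u => deriv f c * h n * (g u * u) := hgu.integrable.const_mul _
  have e : smoothed f c (h n) g - f c * (∫ u, g u) - deriv f c * h n * (∫ u, g u * u) =
      ∫ u, (g u * f (c + h n * u) - f c * g u - deriv f c * h n * (g u * u)) := by
    rw [integral_sub i12 i3, integral_sub i1 i2, integral_const_mul, integral_const_mul,
      smoothed]
  have hb : |smoothed f c (h n) g - f c * (∫ u, g u) - deriv f c * h n * (∫ u, g u * u)| ≤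
      η * h n * I := by
    rw [e, hI, ← integral_const_mul]
    refine abs_integral_le_integral_abs.trans (integral_mono (i12.sub i3).abs
      (hgu.abs.integrable.const_mul _) fun u => ?_)
    simp only
    rcases lt_or_ge R |u| with hu | hu
    · simp [hR u hu]
    · have hd : dist (c + h n * u) c < δ := by
        rw [Real.dist_eq, add_sub_cancel_left, abs_mul, abs_of_pos hn]
        refine lt_of_le_of_lt ?_ hnR
        have := le_abs_self R
        gcongr
        linarith
      have := hδf hd
      simp only [add_sub_cancel_left, smul_eq_mul, Real.norm_eq_abs, abs_mul, abs_of_pos hn] at this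
      have e2 : g u * f (c + h n * u) - f c * g u - deriv f c * h n * (g u * u) =
          g u * (f (c + h n * u) - f c - h n * u * deriv f c) := by ring
      rw [e2, abs_mul, abs_mul]
      calc |g u| * |f (c + h n * u) - f c - h n * u * deriv f c| ≤ |g u| * (η * (h n * |u|)) := by
            gcongr
        _ = _ := by ring
  have e3 : (smoothed f c (h n) g - f c * ∫ u, g u) / h n - deriv f c * ∫ u, g u * u =
      (smoothed f c (h n) g - f c * (∫ u, g u) - deriv f c * h n * (∫ u, g u * u)) / h n := by
    field_simp
  rw [Real.dist_eq, e3, abs_div, abs_of_pos hn, div_lt_iff₀ hn]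
  refine hb.trans_lt ?_
  have : η * (I + 1) = ε := by rw [hη]; field_simp
  nlinarith

theorem tendsto_smoothed (hf : DifferentiableAt ℝ f c) (hfm : Measurable f)
    (hfb : ∃ M, ∀ x, |f x| ≤ M) (hg : IsWeightFun g) {h : ℕ → ℝ}
    (hpos : ∀ᶠ n in atTop, 0 < h n) (h0 : Tendsto h atTop (𝓝 0)) :
    Tendsto (fun n => smoothed f c (h n) g) atTop (𝓝 (f c * ∫ u, g u)) := by
  have h1 := ((smoothed_expansion hf hfm hfb hg hpos h0).mul h0).add_const (f c * ∫ u, g u)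
  rw [mul_zero, zero_add] at h1
  refine h1.congr' ?_
  filter_upwards [hpos] with n hn
  field_simp
  ring

variable [IsProbabilityMeasure P]

/-- `X_i` has density `f`. -/
def HasDensity (P : Measure Ω) (X : ℕ → Ω → ℝ) (f : ℝ → ℝ) : Prop :=
  ∀ i, P.map (X i) = volume.withDensity fun x => ENNReal.ofReal (f x)

omit [IsProbabilityMeasure P] in
theorem HasDensity.integral_comp (hX : ∀ i, Measurable (X i)) (hd : HasDensity P X f)
    (hfm : Measurable f) (hf0 : ∀ x, 0 ≤ f x) (hg : Measurable g) {h : ℝ} (hh : 0 < h) (i : ℕ) :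
    ∫ ω, g ((X i ω - c) / h) ∂P = h * smoothed f c h g := by
  have hgm : Measurable fun x => g ((x - c) / h) := by fun_prop
  rw [← integral_map (hX i).aemeasurable (f := fun x => g ((x - c) / h)) hgm.aestronglyMeasurable,
    hd i, integral_withDensity_eq_integral_toReal_smul (by fun_prop)
      (Eventually.of_forall fun x => ENNReal.ofReal_lt_top)]
  simp only [ENNReal.toReal_ofReal (hf0 _), smul_eq_mul]
  have e : ∀ x, f x * g ((x - c) / h) =
      (fun y => (fun u => g u * f (c + h * u)) (y / h)) (x - c) := fun x => by
    have : c + h * ((x - c) / h) = x := by field_simp; ring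
    simp only [this, mul_comm]
  simp only [e]
  rw [integral_sub_right_eq_self (fun y => (fun u => g u * f (c + h * u)) (y / h)) c,
    Measure.integral_comp_div (fun u => g u * f (c + h * u)) h, abs_of_pos hh, smul_eq_mul, smoothed]

/-- Chebyshev's inequality: the second moment of each summand is at most `h M ∫ g²`, the factor `h`
coming from the change of variables. -/
theorem HasDensity.measure_empMean_le (hX : ∀ i, Measurable (X i)) (hd : HasDensity P X f)
    (hind : iIndepFun X P) (hfm : Measurable f) (hf0 : ∀ x, 0 ≤ f x) {M : ℝ} (hM : ∀ x, f x ≤ M)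
    (hg : IsWeightFun g) {h : ℝ} (hh : 0 < h) {n : ℕ} (hn : 0 < n) {δ : ℝ} (hδ : 0 < δ) :
    P {ω | δ ≤ |empMean c h (fun i : Fin n => X i ω) g - smoothed f c h g|} ≤
      ENNReal.ofReal (M * (∫ u, g u ^ 2) / (n * h * δ ^ 2)) := by
  obtain ⟨B, hB⟩ := hg.bounded
  set Z : Fin n → Ω → ℝ := fun i ω => g ((X i ω - c) / h) with hZ
  have hZm : ∀ i, Measurable (Z i) := fun i => by
    have := hX i; have := hg.measurable; fun_prop
  have hZL : ∀ i, MemLp (Z i) 2 P := fun i =>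
    MemLp.of_bound (hZm i).aestronglyMeasurable B (Eventually.of_forall fun ω => hB _)
  have hn0 : (0 : ℝ) < n := by exact_mod_cast hn
  have hS : MemLp (fun ω => 1 / (n * h) * (∑ i, Z i) ω) 2 P :=
    (memLp_finsetSum' _ fun i _ => hZL i).const_mul _
  have hmean : ∫ ω, 1 / (n * h) * (∑ i, Z i) ω ∂P = smoothed f c h g := by
    simp only [Finset.sum_apply]
    rw [integral_const_mul, integral_finsetSum _ fun i _ => (hZL i).integrable one_le_two]
    simp only [hZ, hd.integral_comp hX hfm hf0 hg.measurable hh, Finset.sum_const,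
      Finset.card_univ, Fintype.card_fin, nsmul_eq_mul]
    field_simp
  have hsm : smoothed f c h (fun u => g u ^ 2) ≤ M * ∫ u, g u ^ 2 := by
    rw [smoothed, ← integral_const_mul]
    refine integral_mono_of_nonneg (Eventually.of_forall fun u => mul_nonneg (sq_nonneg _) (hf0 _))
      (hg.sq.integrable.const_mul _) (Eventually.of_forall fun u => ?_)
    simp only
    rw [mul_comm]
    exact mul_le_mul_of_nonneg_right (hM _) (sq_nonneg _)
  have hvar : Var[fun ω => 1 / (n * h) * (∑ i, Z i) ω; P] ≤ M * (∫ u, g u ^ 2) / (n * h) := by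
    have hpair : Set.Pairwise (↑(Finset.univ : Finset (Fin n))) fun i j => Z i ⟂ᵢ[P] Z j := by
      intro i _ j _ hij
      have hne : (i : ℕ) ≠ j := fun h => hij (Fin.ext h)
      have hm : Measurable fun x => g ((x - c) / h) := by
        have := hg.measurable; fun_prop
      exact (hind.indepFun hne).comp hm hm
    rw [variance_const_mul, IndepFun.variance_sum (fun i _ => hZL i) hpair]
    have hle : ∀ i, Var[Z i; P] ≤ h * (M * ∫ u, g u ^ 2) := fun i => by
      refine (variance_le_expectation_sq (hZm i).aestronglyMeasurable).trans ?_
      have := hd.integral_comp (c := c) hX hfm hf0 (g := fun u => g u ^ 2)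
        (hg.measurable.pow_const 2) hh i
      simp only [Pi.pow_apply, hZ]
      rw [this]
      gcongr
    calc (1 / (n * h)) ^ 2 * ∑ i, Var[Z i; P] ≤ (1 / (n * h)) ^ 2 * ∑ i : Fin n,
            h * (M * ∫ u, g u ^ 2) := by gcongr; exact hle _
      _ = _ := by
        simp only [Finset.sum_const, Finset.card_univ, Fintype.card_fin, nsmul_eq_mul]
        field_simp
  have hch := meas_ge_le_variance_div_sq hS hδ
  rw [hmean] at hch
  simp only [Finset.sum_apply] at hch hvar
  exact hch.trans (ENNReal.ofReal_le_ofReal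
    ((div_le_div_of_nonneg_right hvar (sq_nonneg δ)).trans_eq (div_div _ _ _)))

/-- The tolerance `δ` serves two purposes: `δ = 1` gives consistency when `n h → ∞`, and `δ = h`
gives precision `o(h)` when `n h³ → ∞`. -/
theorem HasDensity.tendsto_empMean_sub (hX : ∀ i, Measurable (X i)) (hd : HasDensity P X f)
    (hind : iIndepFun X P) (hfm : Measurable f) (hf0 : ∀ x, 0 ≤ f x) (hM : ∃ M, ∀ x, f x ≤ M)
    (hg : IsWeightFun g) {h δ : ℕ → ℝ} (hpos : ∀ᶠ n in atTop, 0 < h n)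
    (hδ : ∀ᶠ n in atTop, 0 < δ n) (hrate : Tendsto (fun n => n * h n * δ n ^ 2) atTop atTop) :
    Tendsto (fun q : ℕ × Ω => (empMean c (h q.1) (fun i : Fin q.1 => X i q.2) g
      - smoothed f c (h q.1) g) / δ q.1) (inProb P) (𝓝 0) := by
  obtain ⟨M, hM⟩ := hM
  rw [Metric.tendsto_nhds]
  intro ε hε
  rw [eventually_inProb]
  have hlim : Tendsto (fun n : ℕ => ENNReal.ofReal
      (M * (∫ u, g u ^ 2) / (n * h n * (ε * δ n) ^ 2))) atTop (𝓝 0) := by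
    rw [← ENNReal.ofReal_zero]
    refine ENNReal.tendsto_ofReal (tendsto_const_nhds.div_atTop ?_)
    have := hrate.const_mul_atTop (by positivity : 0 < ε ^ 2)
    refine this.congr fun n => ?_
    ring
  refine tendsto_of_tendsto_of_tendsto_of_le_of_le' tendsto_const_nhds hlim
    (Eventually.of_forall fun _ => zero_le) ?_
  filter_upwards [hpos, hδ, eventually_gt_atTop 0] with n hn hδn hn0
  refine le_trans (measure_mono fun ω hω => ?_)
    (hd.measure_empMean_le (c := c) hX hind hfm hf0 hM hg hn hn0 (mul_pos hε hδn))
  simp only [mem_ofPred_eq, not_lt, dist_zero_right, Real.norm_eq_abs, abs_div, abs_of_pos hδn]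
    at hω ⊢
  rwa [le_div_iff₀ hδn] at hω

/-- The sampling assumptions on the design points. -/
structure IsDesign (P : Measure Ω) (X : ℕ → Ω → ℝ) (f : ℝ → ℝ) (c : ℝ) : Prop where
  measurable : ∀ i, Measurable (X i)
  indep : iIndepFun X P
  density : HasDensity P X f
  density_measurable : Measurable f
  density_nonneg : ∀ x, 0 ≤ f x
  density_bounded : ∃ M, ∀ x, f x ≤ M
  density_differentiable : DifferentiableAt ℝ f c

namespace IsDesign

omit [IsProbabilityMeasure P] in
theorem abs_bounded (hD : IsDesign P X f c) : ∃ M, ∀ x, |f x| ≤ M := by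
  obtain ⟨M, hM⟩ := hD.density_bounded
  exact ⟨M, fun x => by rw [abs_of_nonneg (hD.density_nonneg x)]; exact hM x⟩

variable {h : ℕ → ℝ}

theorem tendsto_empMean (hD : IsDesign P X f c) (hg : IsWeightFun g)
    (hpos : ∀ᶠ n in atTop, 0 < h n) (h0 : Tendsto h atTop (𝓝 0))
    (hnh : Tendsto (fun n => n * h n) atTop atTop) :
    Tendsto (fun q : ℕ × Ω => empMean c (h q.1) (fun i : Fin q.1 => X i q.2) g) (inProb P)
      (𝓝 (f c * ∫ u, g u)) := by
  have h1 := hD.density.tendsto_empMean_sub (c := c) hD.measurable hD.indep hD.density_measurable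
    hD.density_nonneg hD.density_bounded hg hpos (δ := fun _ => 1)
    (Eventually.of_forall fun _ => one_pos) (by simpa using hnh)
  have h2 := (tendsto_smoothed hD.density_differentiable hD.density_measurable hD.abs_bounded hg
    hpos h0).comp (tendsto_fst_inProb (P := P))
  simpa using h1.add h2

theorem tendsto_empMean_order (hD : IsDesign P X f c) (hg : IsWeightFun g)
    (hpos : ∀ᶠ n in atTop, 0 < h n) (h0 : Tendsto h atTop (𝓝 0))
    (hnh : Tendsto (fun n => n * h n ^ 3) atTop atTop) :
    Tendsto (fun q : ℕ × Ω =>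
      (empMean c (h q.1) (fun i : Fin q.1 => X i q.2) g - f c * ∫ u, g u) / h q.1) (inProb P)
      (𝓝 (deriv f c * ∫ u, g u * u)) := by
  have h1 := hD.density.tendsto_empMean_sub (c := c) hD.measurable hD.indep hD.density_measurable
    hD.density_nonneg hD.density_bounded hg hpos hpos (hnh.congr fun n => by ring)
  have h2 := (smoothed_expansion hD.density_differentiable hD.density_measurable hD.abs_bounded hg
    hpos h0).comp (tendsto_fst_inProb (P := P))
  have h3 := h1.add h2
  rw [zero_add] at h3
  refine h3.congr fun q => ?_
  simp only [Function.comp_apply]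
  ring

end IsDesign

end Empirical

/-! ### Kernel moments on one side of the cut-off -/

section KernelMoments

variable {K : ℝ → ℝ}

/-- The kernel restricted to one side of the origin. -/
noncomputable def sideKernel (K : ℝ → ℝ) (j : Side) : ℝ → ℝ := (Side.region 0 j).indicator K

theorem Side.measurableSet_region (c : ℝ) (j : Side) : MeasurableSet (Side.region c j) := by
  cases j
  · exact measurableSet_Ici
  · exact measurableSet_Iio

theorem IsSecondOrderKernel.exists_support (hK : IsSecondOrderKernel K) :
    ∃ R, ∀ u, R < |u| → K u = 0 := by
  obtain ⟨R, hR⟩ := hK.hasCompactSupport.isCompact.isBounded.subset_closedBall 0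
  refine ⟨R, fun u hu => image_eq_zero_of_notMem_tsupport fun h => ?_⟩
  have := hR h
  rw [mem_closedBall_zero_iff, Real.norm_eq_abs] at this
  linarith

theorem IsSecondOrderKernel.isWeightFun (hK : IsSecondOrderKernel K) (j : Side) :
    IsWeightFun (sideKernel K j) := by
  obtain ⟨B, hB⟩ := hK.hasCompactSupport.exists_bound_of_continuous hK.continuous
  obtain ⟨R, hR⟩ := hK.exists_support
  refine ⟨hK.continuous.measurable.indicator (Side.measurableSet_region 0 j), ⟨B, fun u => ?_⟩, R,
    fun u hu => indicator_apply_eq_zero.2 fun _ => hR u hu⟩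
  rw [← Real.norm_eq_abs]
  exact (norm_indicator_le_norm_self _ _).trans (hB u)

theorem sideKernel_of_notMem {j : Side} {u : ℝ} (h : u ∉ Side.region 0 j) : sideKernel K j u = 0 :=
  indicator_of_notMem h _

theorem integral_region (F : ℝ → ℝ) (j : Side) :
    ∫ u, (Side.region 0 j).indicator F u = ∫ u in Ioi (0 : ℝ), F (j.sign * u) := by
  rw [integral_indicator (Side.measurableSet_region 0 j)]
  cases j
  · simp only [Side.region, Side.sign, one_mul]
    exact integral_Ici_eq_integral_Ioi
  · simp only [Side.region, Side.sign, neg_mul, one_mul]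
    rw [integral_comp_neg_Ioi, neg_zero, integral_Iic_eq_integral_Iio]

theorem IsSecondOrderKernel.sign_mul (hK : IsSecondOrderKernel K) (j : Side) (u : ℝ) :
    K (j.sign * u) = K u := by
  cases j
  · simp [Side.sign]
  · simpa [Side.sign] using hK.symmetric u

theorem IsSecondOrderKernel.integral_sideKernel (hK : IsSecondOrderKernel K) (j : Side) (k : ℕ) :
    ∫ u, sideKernel K j u * u ^ k = j.sign ^ k * mu K k := by
  have e : (fun u => sideKernel K j u * u ^ k) = (Side.region 0 j).indicator fun u => K u * u ^ k :=
    funext fun u => (indicator_mul_left _ _ _).symm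
  rw [e, integral_region, mu, ← integral_const_mul]
  refine integral_congr_ae (Eventually.of_forall fun u => ?_)
  simp only [hK.sign_mul, mul_pow]
  ring

theorem IsSecondOrderKernel.integral_sideKernel_sq (hK : IsSecondOrderKernel K) (j : Side) (k : ℕ) :
    ∫ u, sideKernel K j u ^ 2 * u ^ k = j.sign ^ k * nu K k := by
  have e : (fun u => sideKernel K j u ^ 2 * u ^ k) =
      (Side.region 0 j).indicator fun u => K u ^ 2 * u ^ k := funext fun u => by
    by_cases h : u ∈ Side.region 0 j <;> simp [sideKernel, h]
  rw [e, integral_region, nu, ← integral_const_mul]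
  refine integral_congr_ae (Eventually.of_forall fun u => ?_)
  simp only [hK.sign_mul, mul_pow]
  ring

/-- The variance constant is positive. -/
theorem IsSecondOrderKernel.constV_pos (hK : IsSecondOrderKernel K)
    (hΔ : mu K 0 * mu K 2 - mu K 1 ^ 2 ≠ 0) : 0 < constV K := by
  have hw := hK.isWeightFun .pos
  -- The numerator of the constant is the integral of this square.
  set F : ℝ → ℝ := fun u => sideKernel K .pos u ^ 2 * (mu K 2 - mu K 1 * u) ^ 2 with hF
  have hFe : F = fun u => mu K 2 ^ 2 * (sideKernel K .pos u ^ 2 * u ^ 0)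
      + -2 * mu K 1 * mu K 2 * (sideKernel K .pos u ^ 2 * u ^ 1)
      + mu K 1 ^ 2 * (sideKernel K .pos u ^ 2 * u ^ 2) := funext fun u => by
    simp only [hF]; ring
  have hi := fun k => (hw.sq.mul_pow k).integrable
  have h0 := (hi 0).const_mul (mu K 2 ^ 2)
  have h1 := (hi 1).const_mul (-2 * mu K 1 * mu K 2)
  have h2 := (hi 2).const_mul (mu K 1 ^ 2)
  have h01 : Integrable fun u => mu K 2 ^ 2 * (sideKernel K .pos u ^ 2 * u ^ 0)
      + -2 * mu K 1 * mu K 2 * (sideKernel K .pos u ^ 2 * u ^ 1) := h0.add h1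
  have hval : ∫ u, F u =
      mu K 2 ^ 2 * nu K 0 - 2 * mu K 1 * mu K 2 * nu K 1 + mu K 1 ^ 2 * nu K 2 := by
    rw [hFe, integral_add h01 h2, integral_add h0 h1, integral_const_mul, integral_const_mul,
      integral_const_mul, hK.integral_sideKernel_sq, hK.integral_sideKernel_sq,
      hK.integral_sideKernel_sq]
    simp only [Side.sign]
    ring
  have hFint : Integrable F := by rw [hFe]; exact h01.add h2
  have hF0 : ∀ u, 0 ≤ F u := fun u => by simp only [hF]; positivity
  have hne : mu K 1 ≠ 0 ∨ mu K 2 ≠ 0 := by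
    by_contra h
    push Not at h
    exact hΔ (by rw [h.1, h.2]; ring)
  rw [constV]
  refine div_pos ?_ (by positivity)
  rw [← hval]
  -- If the integral vanished, `K` would be zero on the half line except possibly at the root of the
  -- affine factor. All one-sided moments would then be zero, contradicting `hΔ`.
  refine lt_of_le_of_ne (integral_nonneg hF0) fun h => ?_
  have hae := (integral_eq_zero_iff_of_nonneg hF0 hFint).1 h.symm
  have hcont : ContinuousOn (fun u => K u * (mu K 2 - mu K 1 * u)) (Ioi 0) :=
    (hK.continuous.mul (by fun_prop)).continuousOn
  have hz : EqOn (fun u => K u * (mu K 2 - mu K 1 * u)) 0 (Ioi 0) := by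
    refine Measure.eqOn_open_of_ae_eq (μ := volume) ?_ isOpen_Ioi hcont continuousOn_const
    refine (ae_restrict_iff' measurableSet_Ioi).2 ?_
    filter_upwards [hae] with u hu hu0
    have hm : u ∈ Side.region 0 .pos := mem_Ici.2 (mem_Ioi.1 hu0).le
    simp only [hF, sideKernel, indicator_of_mem hm, Pi.zero_apply, ← mul_pow] at hu
    simpa using hu
  have hK0 : ∀ u ∈ Ioi (0 : ℝ), mu K 2 - mu K 1 * u ≠ 0 → K u = 0 := fun u hu hne' => by
    simpa [hne'] using hz hu
  have hmu : ∀ k, mu K k = 0 := fun k => by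
    rw [mu]
    refine integral_eq_zero_of_ae ((ae_restrict_iff' measurableSet_Ioi).2 ?_)
    have hnull : ∀ᵐ u : ℝ, u ≠ mu K 2 / mu K 1 := by
      rw [ae_iff]; simp
    filter_upwards [hnull] with u hu hu0
    have : mu K 2 - mu K 1 * u ≠ 0 := fun h0 => by
      rcases eq_or_ne (mu K 1) 0 with h1 | h1
      · rw [h1, zero_mul, sub_zero] at h0
        exact hne.elim (fun h => h h1) fun h => h h0
      · exact hu (by field_simp; linarith)
    simp [hK0 u hu0 this]
  exact hΔ (by simp [hmu])

end KernelMoments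

/-! ### Asymptotics of the local linear weights -/

section LocalLinear

/-- `(n h)⁻¹ ∑ g ((x_i - c) / h) σ(x_i)`. -/
noncomputable def weightedMean (c h : ℝ) {n : ℕ} (x : Fin n → ℝ) (g σ : ℝ → ℝ) : ℝ :=
  1 / (n * h) * ∑ i, g ((x i - c) / h) * σ (x i)

theorem weightedMean_add (c h : ℝ) {n : ℕ} (x : Fin n → ℝ) (g σ σ' : ℝ → ℝ) :
    weightedMean c h x g (fun t => σ t + σ' t) =
      weightedMean c h x g σ + weightedMean c h x g σ' := by
  simp only [weightedMean, mul_add, Finset.sum_add_distrib]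

theorem weightedMean_mul_pow {c h : ℝ} (hh : h ≠ 0) {n : ℕ} (x : Fin n → ℝ) (g σ : ℝ → ℝ) (k : ℕ) :
    weightedMean c h x g (fun t => σ t * (t - c) ^ k) =
      h ^ k * weightedMean c h x (fun u => g u * u ^ k) σ := by
  simp only [weightedMean, Finset.mul_sum]
  refine Finset.sum_congr rfl fun i _ => ?_
  have : x i - c = h * ((x i - c) / h) := by field_simp
  conv_lhs => rw [this, mul_div_cancel_left₀ _ hh, mul_pow]
  ring

theorem weightedMean_const (c h : ℝ) {n : ℕ} (x : Fin n → ℝ) (g : ℝ → ℝ) (a : ℝ) :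
    weightedMean c h x g (fun _ => a) = a * empMean c h x g := by
  simp only [weightedMean, empMean, ← Finset.sum_mul]
  ring

theorem Side.div_mem_region {c h x : ℝ} (hh : 0 < h) (j : Side) :
    (x - c) / h ∈ Side.region 0 j ↔ x ∈ Side.region c j := by
  cases j
  · simp [Side.region, le_div_iff₀ hh]
  · simp [Side.region, div_lt_iff₀ hh]

theorem Side.mem_interval_of_region {c δ x : ℝ} {j : Side} (hx : x ∈ Side.region c j) (hne : x ≠ c)
    (hδ : |x - c| < δ) : x ∈ Side.interval c δ j := by
  rw [abs_lt] at hδ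
  cases j
  · exact ⟨lt_of_le_of_ne hx hne.symm, by linarith⟩
  · exact ⟨by linarith, hx⟩

variable {Ω : Type*} [MeasurableSpace Ω] {P : Measure Ω} [IsProbabilityMeasure P]
  {X : ℕ → Ω → ℝ} {f g σ K : ℝ → ℝ} {c : ℝ} {j : Side} {h : ℕ → ℝ}

omit [IsProbabilityMeasure P] in
theorem IsDesign.eventually_ae (hD : IsDesign P X f c) {p : ℝ → Prop} (hp : ∀ᵐ x, p x) :
    ∀ᶠ q in inProb P, ∀ i : Fin q.1, p (X i q.2) := by
  refine eventually_inProb_of_ae fun n => (ae_all_iff (ι := Fin n)).2 fun i => ?_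
  have : ∀ᵐ x ∂(P.map (X i)), p x := by
    rw [hD.density i]
    exact (withDensity_absolutelyContinuous _ _).ae_le hp
  exact ae_of_ae_map (hD.measurable i).aemeasurable this

omit [IsProbabilityMeasure P] in
-- The right-hand region contains `c`, where one-sided limits say nothing; a law with a density
-- gives that point no mass.
theorem IsDesign.eventually_ne (hD : IsDesign P X f c) :
    ∀ᶠ q in inProb P, ∀ i : Fin q.1, X i q.2 ≠ c :=
  hD.eventually_ae (p := fun x => x ≠ c) (by rw [ae_iff]; simp)

/-- Eventually, all design points that carry weight lie in a given one-sided neighbourhood. -/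
theorem eventually_mem_interval (hpos : ∀ᶠ n in atTop, 0 < h n) (h0 : Tendsto h atTop (𝓝 0))
    (R : ℝ) {δ : ℝ} (hδ : 0 < δ) : ∀ᶠ n in atTop, ∀ x : ℝ, x ≠ c →
      |(x - c) / h n| ≤ R → x ∈ Side.region c j → x ∈ Side.interval c δ j := by
  have hhR : ∀ᶠ n in atTop, h n * R < δ := by
    have : Tendsto (fun n => h n * R) atTop (𝓝 0) := by simpa using h0.mul_const R
    exact this.eventually_lt_const hδ
  filter_upwards [hpos, hhR] with n hn hnR x hne hR hx
  refine Side.mem_interval_of_region hx hne (lt_of_le_of_lt ?_ hnR)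
  rwa [abs_div, abs_of_pos hn, div_le_iff₀ hn, mul_comm] at hR

namespace IsDesign

/-- As `h → 0`, every point carrying weight enters a one-sided neighbourhood on which `σ` is close
to `s`. The error is therefore a small multiple of the empirical mean of `|g|`, which stays bounded.
-/
theorem tendsto_weightedMean (hD : IsDesign P X f c) (hg : IsWeightFun g)
    (hgj : ∀ u, u ∉ Side.region 0 j → g u = 0) (hpos : ∀ᶠ n in atTop, 0 < h n)
    (h0 : Tendsto h atTop (𝓝 0)) (hnh : Tendsto (fun n => n * h n) atTop atTop) {s : ℝ}
    (hσ : Tendsto σ (Side.nhds c j) (𝓝 s)) :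
    Tendsto (fun q : ℕ × Ω => weightedMean c (h q.1) (fun i : Fin q.1 => X i q.2) g σ) (inProb P)
      (𝓝 (s * (f c * ∫ u, g u))) := by
  have hE := (hD.tendsto_empMean hg hpos h0 hnh).const_mul s
  have habs := hD.tendsto_empMean hg.abs hpos h0 hnh
  have hdiff : Tendsto (fun q : ℕ × Ω => weightedMean c (h q.1) (fun i : Fin q.1 => X i q.2) g σ
      - s * empMean c (h q.1) (fun i : Fin q.1 => X i q.2) g) (inProb P) (𝓝 0) := by
    obtain ⟨R, hR⟩ := hg.support
    set I := f c * ∫ u, |g u| with hI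
    have hI0 : 0 ≤ I := mul_nonneg (hD.density_nonneg c) (integral_nonneg fun u => abs_nonneg _)
    rw [Metric.tendsto_nhds]
    intro ε hε
    have hη : 0 < ε / (I + 1) := by positivity
    obtain ⟨δ, hδ, hs⟩ := Side.exists_interval_subset (Metric.tendsto_nhds.1 hσ _ hη)
    filter_upwards [habs.eventually_lt_const (lt_add_one I), hD.eventually_ne,
      eventually_inProb_of_atTop (P := P) hpos,
      eventually_inProb_of_atTop (P := P) (eventually_mem_interval (c := c) (j := j) hpos h0 R hδ)]
      with q h1 h2 h3 h4
    rw [dist_zero_right, Real.norm_eq_abs]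
    have hc : 0 ≤ 1 / (q.1 * h q.1) := by have := h3.le; positivity
    have hle : |weightedMean c (h q.1) (fun i : Fin q.1 => X i q.2) g σ
        - s * empMean c (h q.1) (fun i : Fin q.1 => X i q.2) g| ≤
        ε / (I + 1) * empMean c (h q.1) (fun i : Fin q.1 => X i q.2) fun u => |g u| := by
      have e : weightedMean c (h q.1) (fun i : Fin q.1 => X i q.2) g σ
          - s * empMean c (h q.1) (fun i : Fin q.1 => X i q.2) g =
          1 / (q.1 * h q.1) * ∑ i : Fin q.1, g ((X i q.2 - c) / h q.1) * (σ (X i q.2) - s) := by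
        simp only [weightedMean, empMean, mul_sub, Finset.sum_sub_distrib, ← Finset.sum_mul]
        ring
      rw [e, abs_mul, abs_of_nonneg hc, empMean, mul_left_comm]
      refine mul_le_mul_of_nonneg_left ((Finset.abs_sum_le_sum_abs _ _).trans ?_) hc
      rw [Finset.mul_sum]
      refine Finset.sum_le_sum fun i _ => ?_
      rw [abs_mul, mul_comm]
      by_cases hgi : g ((X i q.2 - c) / h q.1) = 0
      · simp [hgi]
      · refine mul_le_mul_of_nonneg_right (le_of_lt ?_) (abs_nonneg _)
        have hreg : X i q.2 ∈ Side.region c j :=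
          (Side.div_mem_region h3 j).1 (by_contra fun h => hgi (hgj _ h))
        exact hs (h4 _ (h2 i) (not_lt.1 fun h => hgi (hR _ h)) hreg)
    refine hle.trans_lt ?_
    rw [div_mul_eq_mul_div, div_lt_iff₀ (by positivity)]
    gcongr
  simpa using hdiff.add hE

end IsDesign

/-- The scaled kernel moments of the design points on one side. -/
noncomputable def sMean (K : ℝ → ℝ) (c h : ℝ) (j : Side) {n : ℕ} (x : Fin n → ℝ) (k : ℕ) : ℝ :=
  empMean c h x fun u => sideKernel K j u * u ^ k

theorem indicator_region_eq {h : ℝ} (hh : 0 < h) (t : ℝ) (k : ℕ) :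
    (Side.region c j).indicator (fun t => K ((t - c) / h) * (t - c) ^ k) t =
      h ^ k * (sideKernel K j ((t - c) / h) * ((t - c) / h) ^ k) := by
  by_cases ht : t ∈ Side.region c j
  · rw [indicator_of_mem ht, sideKernel, indicator_of_mem ((Side.div_mem_region hh j).2 ht), div_pow]
    field_simp
  · rw [indicator_of_notMem ht, sideKernel_of_notMem fun h => ht ((Side.div_mem_region hh j).1 h),
      zero_mul, mul_zero]

theorem wsum_eq {h : ℝ} (hh : 0 < h) {n : ℕ} (hn : 0 < n) (x : Fin n → ℝ) (m : ℝ → ℝ) (k : ℕ) :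
    wsum K c h j x (fun i => m (x i)) k =
      n * h * h ^ k * weightedMean c h x (fun u => sideKernel K j u * u ^ k) m := by
  have : (n : ℝ) ≠ 0 := by exact_mod_cast hn.ne'
  simp only [wsum, weightedMean, indicator_region_eq hh, mul_assoc]
  rw [← Finset.mul_sum]
  field_simp

theorem wsum_one_eq {h : ℝ} (hh : 0 < h) {n : ℕ} (hn : 0 < n) (x : Fin n → ℝ) (k : ℕ) :
    wsum K c h j x 1 k = n * h * h ^ k * sMean K c h j x k := by
  rw [show (1 : Fin n → ℝ) = fun i => (fun _ => (1 : ℝ)) (x i) from rfl,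
    wsum_eq hh hn x fun _ => 1]
  simp [weightedMean, sMean, empMean]

/-- Numerator and denominator share the factor `(n h²)²`; after cancelling it only moments with
finite limits remain. -/
theorem llr_eq {h : ℝ} (hh : 0 < h) {n : ℕ} (hn : 0 < n) (x : Fin n → ℝ) (m : ℝ → ℝ) :
    llr K c h j x (fun i => m (x i)) =
      (sMean K c h j x 2 * weightedMean c h x (fun u => sideKernel K j u * u ^ 0) m
        - sMean K c h j x 1 * weightedMean c h x (fun u => sideKernel K j u * u ^ 1) m) /
      (sMean K c h j x 0 * sMean K c h j x 2 - sMean K c h j x 1 ^ 2) := by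
  have hn' : (n : ℝ) ≠ 0 := by exact_mod_cast hn.ne'
  have hne : (n * h * h) ^ 2 ≠ 0 := by positivity
  rw [llr, wsum_one_eq hh hn, wsum_one_eq hh hn, wsum_one_eq hh hn, wsum_eq hh hn, wsum_eq hh hn,
    ← mul_div_mul_left _ (sMean K c h j x 0 * sMean K c h j x 2 - _) hne]
  congr 1 <;> ring

theorem llrWeight_eq {h : ℝ} (hh : 0 < h) {n : ℕ} (hn : 0 < n) (x : Fin n → ℝ) (i : Fin n) :
    llrWeight K c h j x i = 1 / (n * h) * (sideKernel K j ((x i - c) / h) *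
      (sMean K c h j x 2 - sMean K c h j x 1 * ((x i - c) / h))) /
      (sMean K c h j x 0 * sMean K c h j x 2 - sMean K c h j x 1 ^ 2) := by
  have hn' : (n : ℝ) ≠ 0 := by exact_mod_cast hn.ne'
  have hne : (n * h * h) ^ 2 ≠ 0 := by positivity
  rw [llrWeight, wsum_one_eq hh hn, wsum_one_eq hh hn, wsum_one_eq hh hn, indicator_region_eq hh,
    indicator_region_eq hh,
    ← mul_div_mul_left _ (sMean K c h j x 0 * sMean K c h j x 2 - _) hne]
  congr 1
  · field_simp
  · ring

/-- The conditional variance of a local linear estimator as a ratio of scaled moments. -/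
theorem sum_llrWeight_sq {h : ℝ} (hh : 0 < h) {n : ℕ} (hn : 0 < n) (x : Fin n → ℝ) (σ : ℝ → ℝ) :
    n * h * ∑ i, llrWeight K c h j x i ^ 2 * σ (x i) =
      (sMean K c h j x 2 ^ 2 * weightedMean c h x (fun u => sideKernel K j u ^ 2 * u ^ 0) σ
        - 2 * sMean K c h j x 1 * sMean K c h j x 2 *
          weightedMean c h x (fun u => sideKernel K j u ^ 2 * u ^ 1) σ
        + sMean K c h j x 1 ^ 2 * weightedMean c h x (fun u => sideKernel K j u ^ 2 * u ^ 2) σ) /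
      (sMean K c h j x 0 * sMean K c h j x 2 - sMean K c h j x 1 ^ 2) ^ 2 := by
  have hn' : (n : ℝ) ≠ 0 := by exact_mod_cast hn.ne'
  simp only [llrWeight_eq hh hn, weightedMean, Finset.mul_sum, ← Finset.sum_sub_distrib,
    ← Finset.sum_add_distrib, Finset.sum_div]
  refine Finset.sum_congr rfl fun i _ => ?_
  generalize sMean K c h j x 0 * sMean K c h j x 2 - sMean K c h j x 1 ^ 2 = D
  generalize (x i - c) / h = u
  rw [div_pow, mul_pow, mul_pow]
  have : (n * h) * (1 / (n * h)) ^ 2 = 1 / (n * h) := by field_simp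
  rw [div_mul_eq_mul_div, ← mul_div_assoc, ← mul_assoc, ← mul_assoc, this]
  ring

namespace IsDesign

variable (hD : IsDesign P X f c) (hK : IsSecondOrderKernel K)
  (hpos : ∀ᶠ n in atTop, 0 < h n) (h0 : Tendsto h atTop (𝓝 0))
include hD hK hpos h0

theorem tendsto_sMean (hnh : Tendsto (fun n => n * h n) atTop atTop) (k : ℕ) :
    Tendsto (fun q : ℕ × Ω => sMean K c (h q.1) j (fun i : Fin q.1 => X i q.2) k) (inProb P)
      (𝓝 (f c * (j.sign ^ k * mu K k))) := by
  rw [← hK.integral_sideKernel]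
  exact hD.tendsto_empMean ((hK.isWeightFun j).mul_pow k) hpos h0 hnh

theorem tendsto_sMean_order (hnh : Tendsto (fun n => n * h n ^ 3) atTop atTop) (k : ℕ) :
    Tendsto (fun q : ℕ × Ω => (sMean K c (h q.1) j (fun i : Fin q.1 => X i q.2) k
      - f c * (j.sign ^ k * mu K k)) / h q.1) (inProb P)
      (𝓝 (deriv f c * (j.sign ^ (k + 1) * mu K (k + 1)))) := by
  rw [← hK.integral_sideKernel, ← hK.integral_sideKernel]
  simp only [pow_succ, ← mul_assoc]
  exact hD.tendsto_empMean_order ((hK.isWeightFun j).mul_pow k) hpos h0 hnh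

/-- Conditional variance of a local linear estimator. -/
theorem tendsto_sum_llrWeight_sq (hf : 0 < f c) (hΔ : mu K 0 * mu K 2 - mu K 1 ^ 2 ≠ 0)
    (hnh : Tendsto (fun n => n * h n) atTop atTop) {s : ℝ}
    (hσ : Tendsto σ (Side.nhds c j) (𝓝 s)) :
    Tendsto (fun q : ℕ × Ω => q.1 * h q.1 *
      ∑ i : Fin q.1, llrWeight K c (h q.1) j (fun i => X i q.2) i ^ 2 * σ (X i q.2)) (inProb P)
      (𝓝 (constV K / f c * s)) := by
  have hs := fun k => hD.tendsto_sMean (j := j) hK hpos h0 hnh k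
  have hq : ∀ k, Tendsto (fun q : ℕ × Ω => weightedMean c (h q.1) (fun i : Fin q.1 => X i q.2)
      (fun u => sideKernel K j u ^ 2 * u ^ k) σ) (inProb P)
      (𝓝 (s * (f c * (j.sign ^ k * nu K k)))) := fun k => by
    rw [← hK.integral_sideKernel_sq]
    exact hD.tendsto_weightedMean ((hK.isWeightFun j).sq.mul_pow k)
      (fun u hu => by simp [sideKernel_of_notMem hu]) hpos h0 hnh hσ
  have hsg : j.sign ^ 2 = 1 := by rw [sq]; exact j.sign_mul_self
  have hsg4 : j.sign ^ 4 = 1 := by rw [show 4 = 2 * 2 from rfl, pow_mul, hsg, one_pow]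
  -- Every product of moments here has even total degree, so the side's sign disappears and both
  -- sides share the same constants.
  have hD0 : f c * (j.sign ^ 0 * mu K 0) * (f c * (j.sign ^ 2 * mu K 2))
      - (f c * (j.sign ^ 1 * mu K 1)) ^ 2 = f c ^ 2 * (mu K 0 * mu K 2 - mu K 1 ^ 2) := by
    linear_combination (f c ^ 2 * (mu K 0 * mu K 2 - mu K 1 ^ 2)) * hsg
  have hDne : (f c * (j.sign ^ 0 * mu K 0) * (f c * (j.sign ^ 2 * mu K 2))
      - (f c * (j.sign ^ 1 * mu K 1)) ^ 2) ^ 2 ≠ 0 := by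
    rw [hD0]; positivity
  have hlim := (((((hs 2).pow 2).mul (hq 0)).sub ((((hs 1).const_mul 2).mul (hs 2)).mul (hq 1))).add
    (((hs 1).pow 2).mul (hq 2))).div ((((hs 0).mul (hs 2)).sub ((hs 1).pow 2)).pow 2) hDne
  have hval : constV K / f c * s = ((f c * (j.sign ^ 2 * mu K 2)) ^ 2 *
      (s * (f c * (j.sign ^ 0 * nu K 0)))
      - 2 * (f c * (j.sign ^ 1 * mu K 1)) * (f c * (j.sign ^ 2 * mu K 2)) *
        (s * (f c * (j.sign ^ 1 * nu K 1)))
      + (f c * (j.sign ^ 1 * mu K 1)) ^ 2 * (s * (f c * (j.sign ^ 2 * nu K 2)))) /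
      (f c * (j.sign ^ 0 * mu K 0) * (f c * (j.sign ^ 2 * mu K 2))
        - (f c * (j.sign ^ 1 * mu K 1)) ^ 2) ^ 2 := by
    rw [hD0, constV]
    have e : (f c * (j.sign ^ 2 * mu K 2)) ^ 2 * (s * (f c * (j.sign ^ 0 * nu K 0)))
      - 2 * (f c * (j.sign ^ 1 * mu K 1)) * (f c * (j.sign ^ 2 * mu K 2)) *
        (s * (f c * (j.sign ^ 1 * nu K 1)))
      + (f c * (j.sign ^ 1 * mu K 1)) ^ 2 * (s * (f c * (j.sign ^ 2 * nu K 2))) =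
      f c ^ 3 * s *
        (mu K 2 ^ 2 * nu K 0 - 2 * mu K 1 * mu K 2 * nu K 1 + mu K 1 ^ 2 * nu K 2) := by
      linear_combination (f c ^ 3 * s *
        (mu K 2 ^ 2 * nu K 0 - 2 * mu K 1 * mu K 2 * nu K 1 + mu K 1 ^ 2 * nu K 2)) * hsg4
    rw [e]
    field_simp
  rw [hval]
  refine hlim.congr' ?_
  filter_upwards [eventually_inProb_of_atTop (P := P) hpos,
    eventually_inProb_of_atTop (P := P) (eventually_gt_atTop 0)] with q h1 h2
  exact (sum_llrWeight_sq h1 h2 (fun i : Fin q.1 => X i q.2) σ).symm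

end IsDesign

end LocalLinear

/-! ### Bias of the local linear estimator -/

section Bias

variable {Ω : Type*} [MeasurableSpace Ω] {P : Measure Ω} [IsProbabilityMeasure P]
  {X : ℕ → Ω → ℝ} {f K m : ℝ → ℝ} {c : ℝ} {j : Side} {h : ℕ → ℝ}

/-- Local linear moments of a cubic polynomial plus a remainder. -/
theorem weightedMean_cubic {h : ℝ} (hh : h ≠ 0) {n : ℕ} (x : Fin n → ℝ) (hx : ∀ i, x i ≠ c)
    {ρ : ℝ → ℝ} {l₀ l₁ l₂ l₃ : ℝ}
    (hm : ∀ t, t ≠ c → m t =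
      l₀ + l₁ * (t - c) + l₂ * (t - c) ^ 2 + l₃ * (t - c) ^ 3 + ρ t * (t - c) ^ 3) (k : ℕ) :
    weightedMean c h x (fun u => sideKernel K j u * u ^ k) m =
      l₀ * sMean K c h j x k + l₁ * h * sMean K c h j x (k + 1)
        + l₂ * h ^ 2 * sMean K c h j x (k + 2) + l₃ * h ^ 3 * sMean K c h j x (k + 3)
        + h ^ 3 * weightedMean c h x (fun u => sideKernel K j u * u ^ (k + 3)) ρ := by
  have e : weightedMean c h x (fun u => sideKernel K j u * u ^ k) m =
      weightedMean c h x (fun u => sideKernel K j u * u ^ k) (fun t =>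
        (fun _ => l₀) t * (t - c) ^ 0 + (fun _ => l₁) t * (t - c) ^ 1 + (fun _ => l₂) t * (t - c) ^ 2
          + (fun _ => l₃) t * (t - c) ^ 3 + ρ t * (t - c) ^ 3) := by
    unfold weightedMean
    congr 1
    refine Finset.sum_congr rfl fun i _ => ?_
    rw [hm _ (hx i)]
    ring
  have hp : ∀ r, (fun u => sideKernel K j u * u ^ k * u ^ r) =
      fun u => sideKernel K j u * u ^ (k + r) := fun r => funext fun u => by rw [pow_add]; ring
  rw [e, weightedMean_add, weightedMean_add, weightedMean_add, weightedMean_add]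
  simp only [weightedMean_mul_pow hh, hp, weightedMean_const, sMean]
  ring_nf

/-- Exact expansion of the local linear estimator of a cubic polynomial plus a remainder. -/
theorem llr_cubic {h : ℝ} (hh : 0 < h) {n : ℕ} (hn : 0 < n) (x : Fin n → ℝ) (hx : ∀ i, x i ≠ c)
    {ρ : ℝ → ℝ} {l₀ l₁ l₂ l₃ : ℝ}
    (hm : ∀ t, t ≠ c → m t =
      l₀ + l₁ * (t - c) + l₂ * (t - c) ^ 2 + l₃ * (t - c) ^ 3 + ρ t * (t - c) ^ 3)
    (hne : sMean K c h j x 0 * sMean K c h j x 2 - sMean K c h j x 1 ^ 2 ≠ 0) :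
    llr K c h j x (fun i => m (x i)) - l₀ =
      h ^ 2 * ((l₂ * (sMean K c h j x 2 ^ 2 - sMean K c h j x 1 * sMean K c h j x 3)
        + h * (l₃ * (sMean K c h j x 2 * sMean K c h j x 3 - sMean K c h j x 1 * sMean K c h j x 4)
          + (sMean K c h j x 2 * weightedMean c h x (fun u => sideKernel K j u * u ^ 3) ρ
            - sMean K c h j x 1 * weightedMean c h x (fun u => sideKernel K j u * u ^ 4) ρ))) /
        (sMean K c h j x 0 * sMean K c h j x 2 - sMean K c h j x 1 ^ 2)) := by
  -- Local linear regression reproduces affine functions: the `l₁` terms cancel and the `l₀` terms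
  -- give exactly `l₀`.
  rw [llr_eq hh hn, weightedMean_cubic hh.ne' x hx hm, weightedMean_cubic hh.ne' x hx hm]
  simp only [zero_add, Nat.reduceAdd]
  rw [← mul_div_assoc, div_sub' hne, div_left_inj' hne]
  ring

theorem HasSideTaylor.exists_remainder (hm : HasSideTaylor m c j) :
    ∃ l₁, ∃ ρ : ℝ → ℝ, Tendsto ρ (Side.nhds c j) (𝓝 0) ∧ ∀ t, t ≠ c → m t =
      Side.limit c m j + l₁ * (t - c) + Side.limit c (iteratedDeriv 2 m) j / 2 * (t - c) ^ 2
        + Side.limit c (iteratedDeriv 3 m) j / 6 * (t - c) ^ 3 + ρ t * (t - c) ^ 3 := by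
  obtain ⟨l₁, h⟩ := hm
  refine ⟨l₁, _, h.tendsto_div_nhds_zero, fun t ht => ?_⟩
  have : t - c ≠ 0 := sub_ne_zero.2 ht
  field_simp
  ring

namespace IsDesign

variable (hD : IsDesign P X f c) (hK : IsSecondOrderKernel K) (hf : 0 < f c)
  (hΔ : mu K 0 * mu K 2 - mu K 1 ^ 2 ≠ 0) (hm : HasSideTaylor m c j)
  (hpos : ∀ᶠ n in atTop, 0 < h n) (h0 : Tendsto h atTop (𝓝 0))
include hD hK hf hΔ hm hpos h0

/-- Second order bias of the local linear estimator. -/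
theorem tendsto_llr_sub_div_sq (hnh : Tendsto (fun n => n * h n) atTop atTop) :
    Tendsto (fun q : ℕ × Ω => (llr K c (h q.1) j (fun i : Fin q.1 => X i q.2) (fun i => m (X i q.2))
      - Side.limit c m j) / h q.1 ^ 2) (inProb P)
      (𝓝 (constC1 K * Side.limit c (iteratedDeriv 2 m) j)) := by
  obtain ⟨l₁, ρ, hρ, hmt⟩ := hm.exists_remainder
  have hs := fun k => hD.tendsto_sMean (j := j) hK hpos h0 hnh k
  have hr : ∀ k, Tendsto (fun q : ℕ × Ω => weightedMean c (h q.1) (fun i : Fin q.1 => X i q.2)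
      (fun u => sideKernel K j u * u ^ k) ρ) (inProb P) (𝓝 0) := fun k => by
    simpa using hD.tendsto_weightedMean ((hK.isWeightFun j).mul_pow k)
      (fun u hu => by simp [sideKernel_of_notMem hu]) hpos h0 hnh hρ
  have hh := h0.comp (tendsto_fst_inProb (P := P))
  have hsg : j.sign ^ 2 = 1 := by rw [sq]; exact j.sign_mul_self
  have hsg4 : j.sign ^ 4 = 1 := by rw [show 4 = 2 * 2 from rfl, pow_mul, hsg, one_pow]
  have hDlim := ((hs 0).mul (hs 2)).sub ((hs 1).pow 2)
  have hD0 : f c * (j.sign ^ 0 * mu K 0) * (f c * (j.sign ^ 2 * mu K 2))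
      - (f c * (j.sign ^ 1 * mu K 1)) ^ 2 = f c ^ 2 * (mu K 0 * mu K 2 - mu K 1 ^ 2) := by
    linear_combination (f c ^ 2 * (mu K 0 * mu K 2 - mu K 1 ^ 2)) * hsg
  have hDne : f c ^ 2 * (mu K 0 * mu K 2 - mu K 1 ^ 2) ≠ 0 := by positivity
  rw [hD0] at hDlim
  set l₂ := Side.limit c (iteratedDeriv 2 m) j
  set l₃ := Side.limit c (iteratedDeriv 3 m) j
  have hlim := ((((((hs 2).pow 2).sub ((hs 1).mul (hs 3))).const_mul (l₂ / 2)).add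
    (hh.mul (((((hs 2).mul (hs 3)).sub ((hs 1).mul (hs 4))).const_mul (l₃ / 6)).add
      (((hs 2).mul (hr 3)).sub ((hs 1).mul (hr 4)))))).div hDlim hDne)
  have hval : constC1 K * l₂ = (l₂ / 2 * ((f c * (j.sign ^ 2 * mu K 2)) ^ 2
      - f c * (j.sign ^ 1 * mu K 1) * (f c * (j.sign ^ 3 * mu K 3)))
      + 0 * (l₃ / 6 * (f c * (j.sign ^ 2 * mu K 2) * (f c * (j.sign ^ 3 * mu K 3))
        - f c * (j.sign ^ 1 * mu K 1) * (f c * (j.sign ^ 4 * mu K 4)))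
        + (f c * (j.sign ^ 2 * mu K 2) * 0 - f c * (j.sign ^ 1 * mu K 1) * 0))) /
      (f c ^ 2 * (mu K 0 * mu K 2 - mu K 1 ^ 2)) := by
    have e : (f c * (j.sign ^ 2 * mu K 2)) ^ 2
      - f c * (j.sign ^ 1 * mu K 1) * (f c * (j.sign ^ 3 * mu K 3)) =
      f c ^ 2 * (mu K 2 ^ 2 - mu K 1 * mu K 3) := by
      linear_combination (f c ^ 2 * (mu K 2 ^ 2 - mu K 1 * mu K 3)) * hsg4
    rw [e, constC1]
    field_simp
    ring
  rw [hval]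
  refine hlim.congr' ?_
  filter_upwards [eventually_inProb_of_atTop (P := P) hpos, hD.eventually_ne,
    eventually_inProb_of_atTop (P := P) (eventually_gt_atTop 0), hDlim.eventually_ne hDne]
    with q h1 h2 h3 h4
  rw [llr_cubic h1 h3 (fun i : Fin q.1 => X i q.2) h2 hmt h4, mul_div_cancel_left₀ _ (by positivity)]
  rfl

/-- Third order bias of the local linear estimator. -/
theorem tendsto_llr_sub_div_cube (hnh : Tendsto (fun n => n * h n ^ 3) atTop atTop) :
    Tendsto (fun q : ℕ × Ω => (llr K c (h q.1) j (fun i : Fin q.1 => X i q.2) (fun i => m (X i q.2))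
      - Side.limit c m j - constC1 K * Side.limit c (iteratedDeriv 2 m) j * h q.1 ^ 2) / h q.1 ^ 3)
      (inProb P) (𝓝 (-zeta K f m c j)) := by
  -- Eventually `h ≤ 1`, so `h³ ≤ h`.
  have hnh1 : Tendsto (fun n => n * h n) atTop atTop := by
    refine tendsto_atTop_mono' _ ?_ hnh
    filter_upwards [hpos, h0.eventually_le_const one_pos] with n h1 h2
    gcongr
    exact pow_le_of_le_one h1.le h2 (by norm_num)
  obtain ⟨l₁, ρ, hρ, hmt⟩ := hm.exists_remainder
  have hs := fun k => hD.tendsto_sMean (j := j) hK hpos h0 hnh1 k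
  have hd := fun k => hD.tendsto_sMean_order (j := j) hK hpos h0 hnh k
  have hr : ∀ k, Tendsto (fun q : ℕ × Ω => weightedMean c (h q.1) (fun i : Fin q.1 => X i q.2)
      (fun u => sideKernel K j u * u ^ k) ρ) (inProb P) (𝓝 0) := fun k => by
    simpa using hD.tendsto_weightedMean ((hK.isWeightFun j).mul_pow k)
      (fun u hu => by simp [sideKernel_of_notMem hu]) hpos h0 hnh1 hρ
  have hsg : j.sign ^ 2 = 1 := by rw [sq]; exact j.sign_mul_self
  have hsg4 : j.sign ^ 4 = 1 := by rw [show 4 = 2 * 2 from rfl, pow_mul, hsg, one_pow]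
  have hsg5 : j.sign ^ 5 = j.sign := by rw [pow_succ, hsg4, one_mul]
  have hDlim := ((hs 0).mul (hs 2)).sub ((hs 1).pow 2)
  have hD0 : f c * (j.sign ^ 0 * mu K 0) * (f c * (j.sign ^ 2 * mu K 2))
      - (f c * (j.sign ^ 1 * mu K 1)) ^ 2 = f c ^ 2 * (mu K 0 * mu K 2 - mu K 1 ^ 2) := by
    linear_combination (f c ^ 2 * (mu K 0 * mu K 2 - mu K 1 ^ 2)) * hsg
  have hDne : f c ^ 2 * (mu K 0 * mu K 2 - mu K 1 ^ 2) ≠ 0 := by positivity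
  rw [hD0] at hDlim
  set l₂ := Side.limit c (iteratedDeriv 2 m) j with hl₂
  set l₃ := Side.limit c (iteratedDeriv 3 m) j with hl₃
  set M : ℕ → ℝ := fun k => f c * (j.sign ^ k * mu K k) with hM
  set Δ := mu K 0 * mu K 2 - mu K 1 ^ 2 with hΔdef
  set s : ℕ → ℕ × Ω → ℝ := fun k q => sMean K c (h q.1) j (fun i : Fin q.1 => X i q.2) k with hsdef
  -- First-order fluctuations of the moments. Their limits contain `f'(c)`, so a ratio of moments
  -- multiplying `h²` contributes at order `h³`.
  set d : ℕ → ℕ × Ω → ℝ := fun k q => (s k q - M k) / h q.1 with hddef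
  set r : ℕ → ℕ × Ω → ℝ := fun k q => weightedMean c (h q.1) (fun i : Fin q.1 => X i q.2)
    (fun u => sideKernel K j u * u ^ k) ρ with hrdef
  have hs : ∀ k, Tendsto (s k) (inProb P) (𝓝 (M k)) := hs
  have hd : ∀ k, Tendsto (d k) (inProb P) (𝓝 (deriv f c * (j.sign ^ (k + 1) * mu K (k + 1)))) := hd
  -- A discrete product rule: `hN` and `hDd` are the increments, divided by `h`, of `s₂² - s₁ s₃`
  -- and of `s₀ s₂ - s₁²`. They are then combined as in the quotient rule.
  have hN := ((hd 2).mul ((hs 2).add_const (M 2))).sub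
    (((hd 1).mul (hs 3)).add ((hd 3).const_mul (M 1)))
  have hDd := (((hd 0).mul (hs 2)).add ((hd 2).const_mul (M 0))).sub
    ((hd 1).mul ((hs 1).add_const (M 1)))
  have hlim := (((((hN.const_mul Δ).sub (hDd.const_mul (mu K 2 ^ 2 - mu K 1 * mu K 3))).const_mul
    (l₂ / 2 / Δ)).add ((((hs 2).mul (hs 3)).sub ((hs 1).mul (hs 4))).const_mul (l₃ / 6))).add
      (((hs 2).mul (hr 3)).sub ((hs 1).mul (hr 4)))).div hDlim hDne
  have e2 : M 2 ^ 2 - M 1 * M 3 = f c ^ 2 * (mu K 2 ^ 2 - mu K 1 * mu K 3) := by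
    simp only [hM]
    linear_combination (f c ^ 2 * (mu K 2 ^ 2 - mu K 1 * mu K 3)) * hsg4
  have e3 : M 2 * M 3 - M 1 * M 4 =
      f c ^ 2 * (j.sign * (mu K 2 * mu K 3 - mu K 1 * mu K 4)) := by
    simp only [hM]
    linear_combination (f c ^ 2 * (mu K 2 * mu K 3 - mu K 1 * mu K 4)) * hsg5
  have hval : -zeta K f m c j = (l₂ / 2 / Δ * (Δ *
      (deriv f c * (j.sign ^ (2 + 1) * mu K (2 + 1)) * (M 2 + M 2)
        - (deriv f c * (j.sign ^ (1 + 1) * mu K (1 + 1)) * M 3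
          + M 1 * (deriv f c * (j.sign ^ (3 + 1) * mu K (3 + 1)))))
      - (mu K 2 ^ 2 - mu K 1 * mu K 3) *
        (deriv f c * (j.sign ^ (0 + 1) * mu K (0 + 1)) * M 2
          + M 0 * (deriv f c * (j.sign ^ (2 + 1) * mu K (2 + 1)))
          - deriv f c * (j.sign ^ (1 + 1) * mu K (1 + 1)) * (M 1 + M 1)))
      + l₃ / 6 * (M 2 * M 3 - M 1 * M 4) + (M 2 * 0 - M 1 * 0)) / (f c ^ 2 * Δ) := by
    have a1 : deriv f c * (j.sign ^ (2 + 1) * mu K (2 + 1)) * (M 2 + M 2)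
        - (deriv f c * (j.sign ^ (1 + 1) * mu K (1 + 1)) * M 3
          + M 1 * (deriv f c * (j.sign ^ (3 + 1) * mu K (3 + 1)))) =
        f c * deriv f c * (j.sign * (mu K 2 * mu K 3 - mu K 1 * mu K 4)) := by
      simp only [hM, Nat.reduceAdd]
      linear_combination (f c * deriv f c * (mu K 2 * mu K 3 - mu K 1 * mu K 4)) * hsg5
    have a2 : deriv f c * (j.sign ^ (0 + 1) * mu K (0 + 1)) * M 2
          + M 0 * (deriv f c * (j.sign ^ (2 + 1) * mu K (2 + 1)))
          - deriv f c * (j.sign ^ (1 + 1) * mu K (1 + 1)) * (M 1 + M 1) =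
        f c * deriv f c * (j.sign * (mu K 0 * mu K 3 - mu K 1 * mu K 2)) := by
      simp only [hM, Nat.reduceAdd]
      linear_combination
        (f c * deriv f c * j.sign * (mu K 0 * mu K 3 - mu K 1 * mu K 2)) * hsg
    rw [a1, a2, e3, zeta, xi1, xi2, ← hl₂, ← hl₃, ← hΔdef]
    field_simp
    ring
  rw [hval]
  refine hlim.congr' ?_
  filter_upwards [eventually_inProb_of_atTop (P := P) hpos, hD.eventually_ne,
    eventually_inProb_of_atTop (P := P) (eventually_gt_atTop 0), hDlim.eventually_ne hDne]
    with q h1 h2 h3 h4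
  have hexp := llr_cubic h1 h3 (fun i : Fin q.1 => X i q.2) h2 hmt h4
  change _ = h q.1 ^ 2 * ((l₂ / 2 * (s 2 q ^ 2 - s 1 q * s 3 q) + h q.1 * (l₃ / 6 *
    (s 2 q * s 3 q - s 1 q * s 4 q) + (s 2 q * r 3 q - s 1 q * r 4 q))) /
      (s 0 q * s 2 q - s 1 q ^ 2)) at hexp
  have h4 : s 0 q * s 2 q - s 1 q ^ 2 ≠ 0 := h4
  rw [hexp]
  have hsd : ∀ k, h q.1 * d k q = s k q - M k := fun k => by
    simp only [hddef]; field_simp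
  have k1 : h q.1 * (d 2 q * (s 2 q + M 2) - (d 1 q * s 3 q + M 1 * d 3 q)) =
      s 2 q ^ 2 - s 1 q * s 3 q - f c ^ 2 * (mu K 2 ^ 2 - mu K 1 * mu K 3) := by
    rw [← e2]
    linear_combination (s 2 q + M 2) * hsd 2 - s 3 q * hsd 1 - M 1 * hsd 3
  have k2 : h q.1 * (d 0 q * s 2 q + M 0 * d 2 q - d 1 q * (s 1 q + M 1)) =
      s 0 q * s 2 q - s 1 q ^ 2 - f c ^ 2 * Δ := by
    have : M 0 * M 2 - M 1 ^ 2 = f c ^ 2 * Δ := hD0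
    rw [← this]
    linear_combination s 2 q * hsd 0 + M 0 * hsd 2 - (s 1 q + M 1) * hsd 1
  have k3 : constC1 K = (mu K 2 ^ 2 - mu K 1 * mu K 3) / (2 * Δ) := rfl
  change (l₂ / 2 / Δ * (Δ * (d 2 q * (s 2 q + M 2) - (d 1 q * s 3 q + M 1 * d 3 q))
      - (mu K 2 ^ 2 - mu K 1 * mu K 3) * (d 0 q * s 2 q + M 0 * d 2 q - d 1 q * (s 1 q + M 1)))
      + l₃ / 6 * (s 2 q * s 3 q - s 1 q * s 4 q) + (s 2 q * r 3 q - s 1 q * r 4 q)) /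
      (s 0 q * s 2 q - s 1 q ^ 2) = _
  rw [k3]
  generalize d 2 q * (s 2 q + M 2) - (d 1 q * s 3 q + M 1 * d 3 q) = A at k1 ⊢
  generalize d 0 q * s 2 q + M 0 * d 2 q - d 1 q * (s 1 q + M 1) = B at k2 ⊢
  generalize s 2 q * r 3 q - s 1 q * r 4 q = Cr
  generalize s 2 q * s 3 q - s 1 q * s 4 q = E
  generalize s 0 q * s 2 q - s 1 q ^ 2 = D at k2 h4 ⊢
  generalize s 2 q ^ 2 - s 1 q * s 3 q = N at k1 ⊢
  have h1' := h1.ne'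
  have hN' : N = h q.1 * A + f c ^ 2 * (mu K 2 ^ 2 - mu K 1 * mu K 3) := by linarith
  have hD' : h q.1 * B + f c ^ 2 * Δ = D := by linarith
  rw [hN']
  field_simp
  rw [← hD']
  ring

end IsDesign

end Bias

/-! ### Asymptotics of the conditional mean squared error -/

section MSE

variable {Ω : Type*} [MeasurableSpace Ω] {P : Measure Ω} [IsProbabilityMeasure P]
  {X : ℕ → Ω → ℝ} {f K : ℝ → ℝ} {c : ℝ} {κ : Kernel ℝ (ℝ × ℝ)} {H : ℕ → Side → ℝ}

theorem llr_sub_mul (h : ℝ) (j : Side) {n : ℕ} (x y z : Fin n → ℝ) (τ : ℝ) :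
    llr K c h j x (fun i => y i - τ * z i) = llr K c h j x y - τ * llr K c h j x z := by
  simp only [llr_eq_sum, Finset.mul_sum, ← Finset.sum_sub_distrib]
  exact Finset.sum_congr rfl fun i _ => by ring

/-- The common intercepts cancel in the bias of the linearized estimator. -/
theorem jumpHat_mResid (hτ : tauD κ c ≠ 0) (h : Side → ℝ) {n : ℕ} (x : Fin n → ℝ) :
    jumpHat K c h x (fun i => mResid κ (tau κ c) (x i)) =
      ((llr K c (h .pos) .pos x (fun i => mY κ (x i)) - Side.limit c (mY κ) .pos)
          - tau κ c * (llr K c (h .pos) .pos x (fun i => mD κ (x i)) - Side.limit c (mD κ) .pos))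
        - ((llr K c (h .neg) .neg x (fun i => mY κ (x i)) - Side.limit c (mY κ) .neg)
          - tau κ c * (llr K c (h .neg) .neg x (fun i => mD κ (x i)) - Side.limit c (mD κ) .neg)) := by
  have e : tau κ c * tauD κ c = Side.limit c (mY κ) .pos - Side.limit c (mY κ) .neg :=
    div_mul_cancel₀ _ hτ
  rw [tauD] at e
  simp only [jumpHat, mResid, llr_sub_mul]
  linear_combination -e

theorem sum_jumpWeight_sq (h : Side → ℝ) {n : ℕ} (x : Fin n → ℝ) (σ : ℝ → ℝ) :
    ∑ i, jumpWeight K c h x i ^ 2 * σ (x i) =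
      ∑ i, llrWeight K c (h .pos) .pos x i ^ 2 * σ (x i)
        + ∑ i, llrWeight K c (h .neg) .neg x i ^ 2 * σ (x i) := by
  simp only [jumpWeight_sq, add_mul, Finset.sum_add_distrib]

theorem RegularSide.tendsto_varResid {j : Side} (h : RegularSide κ c j) :
    Tendsto (varResid κ (tau κ c)) (Side.nhds c j) (𝓝 (omega κ c j)) :=
  (h.tendsto_varY.add ((Side.tendsto_limit h.limit_varD).const_mul _)).sub
    (h.tendsto_covYD.const_mul _)

omit [IsProbabilityMeasure P] in
/-- Outcomes have conditional second moments at the observations used by the estimator. -/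
theorem IsDesign.eventually_integrable (hD : IsDesign P X f c) (hK : IsSecondOrderKernel K)
    (hreg : ∀ j, RegularSide κ c j) (hpos : ∀ j, ∀ᶠ n in atTop, 0 < H n j)
    (h0 : ∀ j, Tendsto (fun n => H n j) atTop (𝓝 0)) :
    ∀ᶠ q : ℕ × Ω in inProb P, ∀ i : Fin q.1,
      jumpWeight K c (H q.1) (fun i : Fin q.1 => X i q.2) i ≠ 0 →
        Integrable (fun p : ℝ × ℝ => p.1 ^ 2) (κ (X i q.2)) := by
  obtain ⟨R, hR⟩ := hK.exists_support
  have key : ∀ j, ∀ᶠ q : ℕ × Ω in inProb P, ∀ i : Fin q.1,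
      llrWeight K c (H q.1 j) j (fun i : Fin q.1 => X i q.2) i ≠ 0 →
        Integrable (fun p : ℝ × ℝ => p.1 ^ 2) (κ (X i q.2)) := fun j => by
    obtain ⟨δ, hδ, hint, -⟩ := (hreg j).outcome
    filter_upwards [hD.eventually_ne, eventually_inProb_of_atTop (P := P)
      (eventually_mem_interval (c := c) (j := j) (hpos j) (h0 j) R hδ)] with q h1 h2 i hi
    refine hint _ (h2 _ (h1 i) (not_lt.1 fun h => hi ?_) (by_contra fun h => hi ?_))
    · exact llrWeight_of_eq_zero (fun i : Fin q.1 => X i q.2) (hR _ h)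
    · exact llrWeight_of_notMem _ (fun i : Fin q.1 => X i q.2) h
  filter_upwards [key .pos, key .neg] with q h1 h2 i hi
  by_contra hn
  refine hi ?_
  rw [jumpWeight, by_contra fun h => hn (h1 i h), by_contra fun h => hn (h2 i h), sub_zero]

/-! ### Bandwidths with `h → 0` and `n h → ∞`. -/

section Bandwidths

variable (hD : IsDesign P X f c) (hK : IsSecondOrderKernel K) (hf : 0 < f c)
  (hΔ : mu K 0 * mu K 2 - mu K 1 ^ 2 ≠ 0) (hreg : ∀ j, RegularSide κ c j)
  (hpos : ∀ j, ∀ᶠ n in atTop, 0 < H n j) (h0 : ∀ j, Tendsto (fun n => H n j) atTop (𝓝 0))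
  (hnh : ∀ j, Tendsto (fun n : ℕ => (n : ℝ) * H n j) atTop atTop)
include hD hK hf hΔ hpos h0 hnh

include hreg in
theorem IsDesign.tendsto_jumpHat_mD :
    Tendsto (fun q : ℕ × Ω => jumpHat K c (H q.1) (fun i : Fin q.1 => X i q.2)
      (fun i => mD κ (X i q.2))) (inProb P) (𝓝 (tauD κ c)) := by
  have key : ∀ j, Tendsto (fun q : ℕ × Ω => llr K c (H q.1 j) j (fun i : Fin q.1 => X i q.2)
      (fun i => mD κ (X i q.2))) (inProb P) (𝓝 (Side.limit c (mD κ) j)) := fun j => by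
    have h1 := hD.tendsto_llr_sub_div_sq (h := fun n => H n j) hK hf hΔ (hreg j).hasSideTaylor_mD
      (hpos j) (h0 j) (hnh j)
    have h2 := (h1.mul (((h0 j).comp (tendsto_fst_inProb (P := P))).pow 2)).add_const
      (Side.limit c (mD κ) j)
    rw [zero_pow two_ne_zero, mul_zero, zero_add] at h2
    refine h2.congr' ?_
    filter_upwards [eventually_inProb_of_atTop (P := P) (hpos j)] with q hq
    simp only [Function.comp_apply]
    rw [div_mul_cancel₀ _ (pow_ne_zero 2 hq.ne'), sub_add_cancel]
  exact (key .pos).sub (key .neg)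

/-- The variance asymptotics for `σ = 1` show that `n h` times the sum of squared weights converges
on each side, while `n h → ∞`. -/
theorem IsDesign.tendsto_sum_jumpWeight_sq :
    Tendsto (fun q : ℕ × Ω => ∑ i : Fin q.1,
      jumpWeight K c (H q.1) (fun i : Fin q.1 => X i q.2) i ^ 2) (inProb P) (𝓝 0) := by
  have key : ∀ j, Tendsto (fun q : ℕ × Ω => ∑ i : Fin q.1,
      llrWeight K c (H q.1 j) j (fun i : Fin q.1 => X i q.2) i ^ 2) (inProb P) (𝓝 0) := fun j => by
    have h1 := hD.tendsto_sum_llrWeight_sq (j := j) (h := fun n => H n j) hK (hpos j) (h0 j) hf hΔ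
      (hnh j) (σ := fun _ => 1) tendsto_const_nhds
    have h2 := h1.mul (((hnh j).comp (tendsto_fst_inProb (P := P))).inv_tendsto_atTop)
    rw [mul_zero] at h2
    refine h2.congr' ?_
    filter_upwards [((hnh j).comp (tendsto_fst_inProb (P := P))).eventually_gt_atTop 0] with q hq
    simp only [Function.comp_apply] at hq
    simp only [Function.comp_apply, Pi.inv_apply, mul_one]
    rw [mul_comm, inv_mul_cancel_left₀ hq.ne']
  simpa [jumpWeight_sq, Finset.sum_add_distrib] using (key .pos).add (key .neg)

variable [IsMarkovKernel κ]

include hreg in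
/-- The conditional mean squared error is first-order equivalent to the one of the linearized
estimator. -/
theorem IsDesign.tendsto_condMSE_div
    (hD01 : ∀ᶠ q : ℕ × Ω in inProb P, ∀ i : Fin q.1, ∀ᵐ p ∂κ (X i q.2), p.2 = 0 ∨ p.2 = 1)
    {r : ℝ} (hr : 0 < r) (hrτ : r < |tauD κ c|) {s : ℕ × Ω → ℝ} (hs : ∀ᶠ q in inProb P, 0 < s q)
    {G : ℝ} (hG : Tendsto (fun q : ℕ × Ω =>
      (jumpHat K c (H q.1) (fun i : Fin q.1 => X i q.2) (fun i => mResid κ (tau κ c) (X i q.2)) ^ 2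
        + ∑ i : Fin q.1, jumpWeight K c (H q.1) (fun i : Fin q.1 => X i q.2) i ^ 2
          * varResid κ (tau κ c) (X i q.2)) / s q) (inProb P) (𝓝 G)) :
    Tendsto (fun q : ℕ × Ω => tauD κ c ^ 2 *
      condMSE K κ c r (H q.1) (fun i : Fin q.1 => X i q.2) / s q) (inProb P) (𝓝 G) := by
  have hJ := hD.tendsto_jumpHat_mD hK hf hΔ hreg hpos h0 hnh
  have hW := hD.tendsto_sum_jumpWeight_sq hK hf hΔ hpos h0 hnh
  have hrem : Tendsto (fun q : ℕ × Ω => (jumpHat K c (H q.1) (fun i : Fin q.1 => X i q.2)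
      (fun i => mD κ (X i q.2)) - tauD κ c) ^ 2 + 3 * ∑ i : Fin q.1,
        jumpWeight K c (H q.1) (fun i : Fin q.1 => X i q.2) i ^ 2) (inProb P) (𝓝 0) := by
    simpa using ((hJ.sub_const (tauD κ c)).pow 2).add (hW.const_mul 3)
  set L : ℕ × Ω → ℝ := fun q => (jumpHat K c (H q.1) (fun i : Fin q.1 => X i q.2)
    (fun i => mResid κ (tau κ c) (X i q.2)) ^ 2
      + ∑ i : Fin q.1, jumpWeight K c (H q.1) (fun i : Fin q.1 => X i q.2) i ^ 2
        * varResid κ (tau κ c) (X i q.2)) / s q with hL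
  set M : ℕ × Ω → ℝ := fun q => tauD κ c ^ 2 *
    condMSE K κ c r (H q.1) (fun i : Fin q.1 => X i q.2) / s q with hM
  suffices hdiff : Tendsto (fun q => M q - L q) (inProb P) (𝓝 0) by
    simpa using hdiff.add hG
  rw [Metric.tendsto_nhds]
  intro η hη
  have hG1 : 0 < |G| + 1 := by positivity
  -- The error is at most `L` times a quantity tending to this `ε`; the choice makes `G ε < η`, with
  -- `+ 1` covering `G = 0`.
  obtain ⟨C, hC, hb⟩ := exists_ratio_bound hr hrτ (ε := η / (2 * (|G| + 1))) (by positivity)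
  have hsm : Tendsto (fun q : ℕ × Ω => η / (2 * (|G| + 1)) + 4 * C * ((jumpHat K c (H q.1)
      (fun i : Fin q.1 => X i q.2) (fun i => mD κ (X i q.2)) - tauD κ c) ^ 2 + 3 * ∑ i : Fin q.1,
        jumpWeight K c (H q.1) (fun i : Fin q.1 => X i q.2) i ^ 2)) (inProb P)
      (𝓝 (η / (2 * (|G| + 1)))) := by
    simpa using (hrem.const_mul (4 * C)).const_add (η / (2 * (|G| + 1)))
  have hprod := hG.mul hsm
  have hlt : G * (η / (2 * (|G| + 1))) < η := by
    rw [← mul_div_assoc, div_lt_iff₀ (by positivity)]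
    nlinarith [le_abs_self G, abs_nonneg G]
  filter_upwards [hprod.eventually_lt_const hlt, hs, hD01,
    hD.eventually_integrable hK hreg hpos h0] with q h1 h2 h3 h4
  have hmain := abs_tauD_sq_mul_condMSE_sub_le (K := K) (c := c) (h := H q.1) h4 h3 hr hC hb
  rw [dist_zero_right, Real.norm_eq_abs]
  refine lt_of_le_of_lt ?_ h1
  simp only [hM, hL]
  rw [← sub_div, abs_div, abs_of_pos h2, div_mul_eq_mul_div]
  exact div_le_div_of_nonneg_right hmain h2.le

end Bandwidths

/-! ### Bandwidths that are a fixed pair times a common rate. -/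

section Rates

variable {a : ℕ → ℝ} {t : Side → ℝ} {p : ℕ} {A : ℝ}

/-- Substituting `n = A / a^p` gives `A b^k / a^(p-k)`, which diverges because `k < p`. The cases
needed are `k = 1` and `k = 3`. -/
theorem tendsto_mul_pow_atTop (ha : ∀ᶠ n in atTop, 0 < a n) (ha0 : Tendsto a atTop (𝓝 0))
    (hA : 0 < A) (hap : ∀ᶠ n : ℕ in atTop, a n ^ p = A / n) {k : ℕ} (hk : k < p) {b : ℝ}
    (hb : 0 < b) : Tendsto (fun n : ℕ => (n : ℝ) * (a n * b) ^ k) atTop atTop := by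
  obtain ⟨d, rfl⟩ := Nat.exists_eq_add_of_lt hk
  have h1 : Tendsto (fun n => a n ^ (d + 1)) atTop (𝓝[>] 0) :=
    tendsto_nhdsWithin_iff.2 ⟨by simpa using ha0.pow (d + 1), ha.mono fun n hn => pow_pos hn _⟩
  refine ((tendsto_inv_nhdsGT_zero.comp h1).const_mul_atTop
    (mul_pos hA (pow_pos hb k))).congr' ?_
  filter_upwards [ha, hap, eventually_gt_atTop 0] with n h1 h2 h3
  have hn : (n : ℝ) ≠ 0 := by exact_mod_cast h3.ne'
  have h4 := h1.ne'
  rw [eq_div_iff hn] at h2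
  simp only [Function.comp_apply]
  rw [← h2]
  field_simp
  ring

variable (hD : IsDesign P X f c) (hK : IsSecondOrderKernel K) (hf : 0 < f c)
  (hΔ : mu K 0 * mu K 2 - mu K 1 ^ 2 ≠ 0) (hreg : ∀ j, RegularSide κ c j)
  (ha : ∀ᶠ n in atTop, 0 < a n) (ha0 : Tendsto a atTop (𝓝 0)) (ht : t ∈ bandwidths)
  (hH : ∀ᶠ n in atTop, ∀ j, H n j = a n * t j)

omit [IsProbabilityMeasure P] in
include ha ht hH in
theorem eventually_pos_of_rate (j : Side) : ∀ᶠ n in atTop, 0 < H n j := by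
  filter_upwards [ha, hH] with n h1 h2
  rw [h2]
  exact mul_pos h1 (ht j)

include ha0 hH in
theorem tendsto_zero_of_rate (j : Side) : Tendsto (fun n => H n j) atTop (𝓝 0) := by
  have : Tendsto (fun n => a n * t j) atTop (𝓝 0) := by simpa using ha0.mul_const (t j)
  exact this.congr' (hH.mono fun n h => (h j).symm)

include hD hK hf hΔ hreg ha ha0 ht hH

/-- The conditional variance of the linearized estimator. -/
theorem IsDesign.tendsto_variance (hp : p ≠ 0)
    (hap : ∀ᶠ n : ℕ in atTop, a n ^ (p + 1) = constV K / f c / n) :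
    Tendsto (fun q : ℕ × Ω => (∑ i : Fin q.1,
      jumpWeight K c (H q.1) (fun i : Fin q.1 => X i q.2) i ^ 2
        * varResid κ (tau κ c) (X i q.2)) / a q.1 ^ p) (inProb P) (𝓝 (invTerm (omega κ c) t)) := by
  have hv := div_pos (hK.constV_pos hΔ) hf
  have key : ∀ j, Tendsto (fun q : ℕ × Ω => (∑ i : Fin q.1,
      llrWeight K c (H q.1 j) j (fun i : Fin q.1 => X i q.2) i ^ 2
        * varResid κ (tau κ c) (X i q.2)) / a q.1 ^ p) (inProb P) (𝓝 (omega κ c j / t j)) := fun j => by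
    have hnh : Tendsto (fun n : ℕ => (n : ℝ) * H n j) atTop atTop := by
      refine (tendsto_mul_pow_atTop ha ha0 hv hap (k := 1) (by omega) (ht j)).congr' ?_
      filter_upwards [hH] with n hn
      rw [hn, pow_one]
    have h1 := hD.tendsto_sum_llrWeight_sq (j := j) (h := fun n => H n j) hK
      (eventually_pos_of_rate ha ht hH j) (tendsto_zero_of_rate ha0 hH j) hf hΔ hnh
      (hreg j).tendsto_varResid
    -- Since `n a^(p+1) = v / f(c)`, the factor `n H` equals `(v / f(c)) t_j / a^p`. Dividing by its
    -- constant part turns the scaled variance into variance over `a^p`.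
    have h2 := h1.div_const (constV K / f c * t j)
    rw [mul_div_mul_left _ _ hv.ne'] at h2
    refine h2.congr' ?_
    filter_upwards [eventually_inProb_of_atTop (P := P) ha, eventually_inProb_of_atTop (P := P) hH,
      eventually_inProb_of_atTop (P := P) hap,
      eventually_inProb_of_atTop (P := P) (eventually_gt_atTop 0)] with q h1 h2 h3 h4
    have hn : (q.1 : ℝ) ≠ 0 := by exact_mod_cast h4.ne'
    have ht' := (ht j).ne'
    rw [eq_div_iff hn] at h3
    rw [← h3, h2 j]
    field_simp
    ring
  refine ((key .pos).add (key .neg)).congr fun q => ?_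
  rw [← add_div, ← sum_jumpWeight_sq (H q.1) (fun i : Fin q.1 => X i q.2)]

/-- The conditional bias of the linearized estimator, at second order. -/
theorem IsDesign.tendsto_bias_sq (hτ : tauD κ c ≠ 0)
    (hnh : ∀ j, Tendsto (fun n : ℕ => (n : ℝ) * H n j) atTop atTop) :
    Tendsto (fun q : ℕ × Ω => jumpHat K c (H q.1) (fun i : Fin q.1 => X i q.2)
      (fun i => mResid κ (tau κ c) (X i q.2)) / a q.1 ^ 2) (inProb P)
      (𝓝 (biasTerm (phi K κ c) 2 t)) := by
  have key : ∀ j, Tendsto (fun q : ℕ × Ω =>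
      (((llr K c (H q.1 j) j (fun i : Fin q.1 => X i q.2) (fun i => mY κ (X i q.2))
        - Side.limit c (mY κ) j) / H q.1 j ^ 2
      - tau κ c * ((llr K c (H q.1 j) j (fun i : Fin q.1 => X i q.2) (fun i => mD κ (X i q.2))
        - Side.limit c (mD κ) j) / H q.1 j ^ 2)) * t j ^ 2)) (inProb P)
      (𝓝 (phi K κ c j * t j ^ 2)) := fun j => by
    have hp := eventually_pos_of_rate ha ht hH j
    have h0 := tendsto_zero_of_rate ha0 hH j
    have h1 := hD.tendsto_llr_sub_div_sq (h := fun n => H n j) hK hf hΔ (hreg j).hasSideTaylor_mY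
      hp h0 (hnh j)
    have h2 := hD.tendsto_llr_sub_div_sq (h := fun n => H n j) hK hf hΔ (hreg j).hasSideTaylor_mD
      hp h0 (hnh j)
    have e : phi K κ c j = constC1 K * Side.limit c (iteratedDeriv 2 (mY κ)) j
        - tau κ c * (constC1 K * Side.limit c (iteratedDeriv 2 (mD κ)) j) := by
      rw [phi]; ring
    rw [e]
    exact (h1.sub (h2.const_mul _)).mul_const _
  refine ((key .pos).sub (key .neg)).congr' ?_
  filter_upwards [eventually_inProb_of_atTop (P := P) ha, eventually_inProb_of_atTop (P := P) hH]
    with q h1 h2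
  have hp := (ht .pos).ne'
  have hm := (ht .neg).ne'
  rw [jumpHat_mResid hτ (H q.1) (fun i : Fin q.1 => X i q.2)]
  generalize llr K c (H q.1 .pos) .pos (fun i : Fin q.1 => X i q.2) (fun i => mY κ (X i q.2))
    - Side.limit c (mY κ) .pos = b₁
  generalize llr K c (H q.1 .pos) .pos (fun i : Fin q.1 => X i q.2) (fun i => mD κ (X i q.2))
    - Side.limit c (mD κ) .pos = b₂
  generalize llr K c (H q.1 .neg) .neg (fun i : Fin q.1 => X i q.2) (fun i => mY κ (X i q.2))
    - Side.limit c (mY κ) .neg = b₃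
  generalize llr K c (H q.1 .neg) .neg (fun i : Fin q.1 => X i q.2) (fun i => mD κ (X i q.2))
    - Side.limit c (mD κ) .neg = b₄
  rw [h2, h2]
  field_simp

/-- The conditional bias of the linearized estimator, at third order, when the second order terms
cancel. -/
theorem IsDesign.tendsto_bias_cube (hτ : tauD κ c ≠ 0) (hφt : biasTerm (phi K κ c) 2 t = 0)
    (hnh : ∀ j, Tendsto (fun n : ℕ => (n : ℝ) * H n j ^ 3) atTop atTop) :
    Tendsto (fun q : ℕ × Ω => jumpHat K c (H q.1) (fun i : Fin q.1 => X i q.2)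
      (fun i => mResid κ (tau κ c) (X i q.2)) / a q.1 ^ 3) (inProb P)
      (𝓝 (-biasTerm (psi K f κ c) 3 t)) := by
  have key : ∀ j, Tendsto (fun q : ℕ × Ω =>
      (((llr K c (H q.1 j) j (fun i : Fin q.1 => X i q.2) (fun i => mY κ (X i q.2))
        - Side.limit c (mY κ) j
        - constC1 K * Side.limit c (iteratedDeriv 2 (mY κ)) j * H q.1 j ^ 2) / H q.1 j ^ 3
      - tau κ c * ((llr K c (H q.1 j) j (fun i : Fin q.1 => X i q.2) (fun i => mD κ (X i q.2))
        - Side.limit c (mD κ) j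
        - constC1 K * Side.limit c (iteratedDeriv 2 (mD κ)) j * H q.1 j ^ 2) / H q.1 j ^ 3))
      * t j ^ 3)) (inProb P) (𝓝 (-psi K f κ c j * t j ^ 3)) := fun j => by
    have hp := eventually_pos_of_rate ha ht hH j
    have h0 := tendsto_zero_of_rate ha0 hH j
    have h1 := hD.tendsto_llr_sub_div_cube (h := fun n => H n j) hK hf hΔ (hreg j).hasSideTaylor_mY
      hp h0 (hnh j)
    have h2 := hD.tendsto_llr_sub_div_cube (h := fun n => H n j) hK hf hΔ (hreg j).hasSideTaylor_mD
      hp h0 (hnh j)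
    have e : -psi K f κ c j = -zeta K f (mY κ) c j - tau κ c * -zeta K f (mD κ) c j := by
      rw [psi]; ring
    rw [e]
    exact (h1.sub (h2.const_mul _)).mul_const _
  have e : -biasTerm (psi K f κ c) 3 t =
      -psi K f κ c .pos * t .pos ^ 3 - -psi K f κ c .neg * t .neg ^ 3 := by
    rw [biasTerm]; ring
  rw [e]
  refine ((key .pos).sub (key .neg)).congr' ?_
  filter_upwards [eventually_inProb_of_atTop (P := P) ha, eventually_inProb_of_atTop (P := P) hH]
    with q h1 h2
  have hp := (ht .pos).ne'
  have hm := (ht .neg).ne'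
  rw [jumpHat_mResid hτ (H q.1) (fun i : Fin q.1 => X i q.2)]
  generalize llr K c (H q.1 .pos) .pos (fun i : Fin q.1 => X i q.2) (fun i => mY κ (X i q.2))
    - Side.limit c (mY κ) .pos = b₁
  generalize llr K c (H q.1 .pos) .pos (fun i : Fin q.1 => X i q.2) (fun i => mD κ (X i q.2))
    - Side.limit c (mD κ) .pos = b₂
  generalize llr K c (H q.1 .neg) .neg (fun i : Fin q.1 => X i q.2) (fun i => mY κ (X i q.2))
    - Side.limit c (mY κ) .neg = b₃
  generalize llr K c (H q.1 .neg) .neg (fun i : Fin q.1 => X i q.2) (fun i => mD κ (X i q.2))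
    - Side.limit c (mD κ) .neg = b₄
  -- The second-order biases subtracted in `key` add up across the two sides to a multiple of this
  -- vanishing quantity.
  rw [biasTerm, phi, phi] at hφt
  rw [h2, h2]
  field_simp
  linear_combination (-a q.1 ^ 2) * hφt

end Rates

end MSE

/-! ### The sampling assumptions -/

section Sampling

variable {Ω : Type*} [MeasurableSpace Ω] {P : Measure Ω}
  {Y D X : ℕ → Ω → ℝ} {f K : ℝ → ℝ} {c : ℝ} {κ : Kernel ℝ (ℝ × ℝ)} [IsMarkovKernel κ]

theorem RegularDensity.differentiableAt (hf : RegularDensity f c) : DifferentiableAt ℝ f c := by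
  obtain ⟨U, hU, hc, h, -⟩ := hf.holder
  exact (h.differentiableOn (by norm_num)).differentiableAt (hU.mem_nhds hc)

theorem isDesign_of_law (hY : ∀ i, Measurable (Y i)) (hD : ∀ i, Measurable (D i))
    (hX : ∀ i, Measurable (X i)) (hindep : iIndepFun (fun i ω => (X i ω, Y i ω, D i ω)) P)
    (hlaw : ∀ i, P.map (fun ω => (X i ω, Y i ω, D i ω)) =
      (volume.withDensity fun x => ENNReal.ofReal (f x)) ⊗ₘ κ)
    (hf : RegularDensity f c) : IsDesign P X f c where
  measurable := hX
  indep := hindep.comp (fun _ => Prod.fst) fun _ => measurable_fst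
  density i := by
    have : X i = Prod.fst ∘ fun ω => (X i ω, Y i ω, D i ω) := rfl
    rw [this, ← Measure.map_map measurable_fst ((hX i).prodMk ((hY i).prodMk (hD i))), hlaw i]
    exact Measure.fst_compProd _ _
  density_measurable := hf.measurable
  density_nonneg := hf.nonneg
  density_bounded := hf.bounded
  density_differentiable := hf.differentiableAt

/-- Binary treatment is a statement about the sample; disintegrating the joint law transfers it to
`κ x` for almost every `x` under the law of `X_i`. -/
theorem eventually_binary_of_law (hY : ∀ i, Measurable (Y i)) (hD : ∀ i, Measurable (D i))
    (hX : ∀ i, Measurable (X i)) (hD01 : ∀ i ω, D i ω = 0 ∨ D i ω = 1)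
    (hlaw : ∀ i, P.map (fun ω => (X i ω, Y i ω, D i ω)) =
      (volume.withDensity fun x => ENNReal.ofReal (f x)) ⊗ₘ κ) :
    ∀ᶠ q : ℕ × Ω in inProb P, ∀ i : Fin q.1, ∀ᵐ p ∂κ (X i q.2), p.2 = 0 ∨ p.2 = 1 := by
  refine eventually_inProb_of_ae fun n => (ae_all_iff (ι := Fin n)).2 fun i => ?_
  have hm := (hX i).prodMk ((hY i).prodMk (hD i))
  have hset : MeasurableSet {p : ℝ × ℝ × ℝ | p.2.2 = 0 ∨ p.2.2 = 1} :=
    (measurableSet_eq_fun (by fun_prop) measurable_const).union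
      (measurableSet_eq_fun (by fun_prop) measurable_const)
  have h1 : ∀ᵐ p ∂(P.map fun ω => (X i ω, Y i ω, D i ω)), p.2.2 = 0 ∨ p.2.2 = 1 :=
    (ae_map_iff hm.aemeasurable hset).2 (Eventually.of_forall fun ω => hD01 i ω)
  have hmap : P.map (X i) = volume.withDensity fun x => ENNReal.ofReal (f x) := by
    have : X i = Prod.fst ∘ fun ω => (X i ω, Y i ω, D i ω) := rfl
    rw [this, ← Measure.map_map measurable_fst hm, hlaw i]
    exact Measure.fst_compProd _ _
  rw [hlaw i] at h1
  have h2 := Measure.ae_ae_of_ae_compProd h1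
  rw [← hmap] at h2
  exact ae_of_ae_map (hX i).aemeasurable h2

end Sampling

/-- Division by zero returns zero, so `Δ = 0` would make `C₁` and hence both `φ_j` vanish. This is
how `hphi` yields `Δ ≠ 0`. -/
theorem mu_ne_zero_of_constC1 {K : ℝ → ℝ} (h : constC1 K ≠ 0) :
    mu K 0 * mu K 2 - mu K 1 ^ 2 ≠ 0 := fun h0 => h (by simp [constC1, h0])

end FRD

/-! ### Assembly of the two sign cases. -/

theorem theorem1
    {Ω : Type*} [MeasurableSpace Ω] (P : Measure Ω) [IsProbabilityMeasure P]
    -- the i.i.d. sample `(Y_i, D_i, X_i)`, with binary treatment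
    (Y D X : ℕ → Ω → ℝ)
    (hY : ∀ i, Measurable (Y i)) (hD : ∀ i, Measurable (D i)) (hX : ∀ i, Measurable (X i))
    (hD01 : ∀ i ω, D i ω = 0 ∨ D i ω = 1)
    (hindep : iIndepFun (fun i ω => (X i ω, Y i ω, D i ω)) P)
    -- `X_i` has density `f`, and `κ` is the conditional law of `(Y_i, D_i)` given `X_i`
    (f : ℝ → ℝ) (κ : Kernel ℝ (ℝ × ℝ)) [IsMarkovKernel κ]
    (hlaw : ∀ i, P.map (fun ω => (X i ω, Y i ω, D i ω)) =
      (volume.withDensity fun x => ENNReal.ofReal (f x)) ⊗ₘ κ)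
    -- kernel, density and conditional moments
    (K : ℝ → ℝ) (hK : FRD.IsSecondOrderKernel K)
    (c : ℝ) (hf : FRD.RegularDensity f c) (hreg : ∀ j, FRD.RegularSide κ c j)
    (htauD : FRD.tauD κ c ≠ 0)
    -- the asymptotically first-order optimal bandwidths are defined
    (homega : ∀ j, 0 < FRD.omega κ c j)
    (hphi : FRD.phi K κ c .pos * FRD.phi K κ c .neg ≠ 0)
    (hpsi : 0 < FRD.phi K κ c .pos * FRD.phi K κ c .neg →
      FRD.psi K f κ c .pos
        - (FRD.phi K κ c .pos / FRD.phi K κ c .neg) ^ (3 / 2 : ℝ) * FRD.psi K f κ c .neg ≠ 0)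
    (hAFO : ℕ → FRD.Side → ℝ) (hAFO_def : ∀ n, 0 < n → FRD.IsAFO K f κ c n (hAFO n))
    -- consistent pilot estimators
    (phiHat psiHat omegaHat : ℕ → Ω → FRD.Side → ℝ) (fHat : ℕ → Ω → ℝ)
    (hphiHat : ∀ j, TendstoInMeasure P (fun n ω => phiHat n ω j) atTop fun _ => FRD.phi K κ c j)
    (hpsiHat : ∀ j, TendstoInMeasure P (fun n ω => psiHat n ω j) atTop fun _ => FRD.psi K f κ c j)
    (homegaHat : ∀ j, TendstoInMeasure P (fun n ω => omegaHat n ω j) atTop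
      fun _ => FRD.omega κ c j)
    (hfHat : TendstoInMeasure P fHat atTop fun _ => f c)
    -- bandwidths that minimize the plug-in criterion, whenever it has a minimizer
    (hHat : ℕ → Ω → FRD.Side → ℝ)
    (hHat_def : ∀ n ω,
      (∃ h, FRD.IsMinimizer
        (FRD.MMSE K (phiHat n ω) (psiHat n ω) (fHat n ω) (omegaHat n ω) n) FRD.bandwidths h) →
      FRD.IsMinimizer
        (FRD.MMSE K (phiHat n ω) (psiHat n ω) (fHat n ω) (omegaHat n ω) n) FRD.bandwidths
        (hHat n ω)) :
    (∀ j, TendstoInMeasure P (fun n ω => hHat n ω j / hAFO n j) atTop fun _ => (1 : ℝ)) ∧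
    (∀ r : ℝ, 0 < r → r < |FRD.tauD κ c| →
      TendstoInMeasure P
        (fun n ω =>
          FRD.MMSE K (phiHat n ω) (psiHat n ω) (fHat n ω) (omegaHat n ω) n (hHat n ω) /
            (FRD.tauD κ c ^ 2 *
              FRD.condMSE K κ c r (hAFO n) (fun i : Fin n => X i ω)))
        atTop fun _ => (1 : ℝ)) ∧
    (FRD.phi K κ c .pos * FRD.phi K κ c .neg < 0 →
      ∀ j, (fun n => hAFO n j) =Θ[atTop] fun n : ℕ => (n : ℝ) ^ (-(1 / 5) : ℝ)) ∧
    (0 < FRD.phi K κ c .pos * FRD.phi K κ c .neg →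
      ∀ j, (fun n => hAFO n j) =Θ[atTop] fun n : ℕ => (n : ℝ) ^ (-(1 / 7) : ℝ)) := by

  have hΔ : FRD.mu K 0 * FRD.mu K 2 - FRD.mu K 1 ^ 2 ≠ 0 :=
    FRD.mu_ne_zero_of_constC1 fun h => hphi (by simp [FRD.phi, h])
  have hv := hK.constV_pos hΔ
  have hA := div_pos hv hf.pos
  have hdes := FRD.isDesign_of_law hY hD hX hindep hlaw hf
  have hbin := FRD.eventually_binary_of_law hY hD hX hD01 hlaw
  have hN := FRD.tendsto_fst_inProb (P := P)
  have hφ := fun j => FRD.tendsto_inProb_iff.2 (hphiHat j)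
  have hψ := fun j => FRD.tendsto_inProb_iff.2 (hpsiHat j)
  have hω := fun j => FRD.tendsto_inProb_iff.2 (homegaHat j)
  have hg := FRD.tendsto_inProb_iff.2 hfHat
  have hmul : ∀ {q : ℕ} {t : FRD.Side → ℝ}, (∀ n, 0 < n → ∀ j,
      hAFO n j = FRD.rate q (FRD.constV K / f c) n * t j) →
      ∀ᶠ n in atTop, ∀ j, hAFO n j = FRD.rate q (FRD.constV K / f c) n * t j :=
    fun h => (eventually_gt_atTop 0).mono h
  have hpos : ∀ q : ℕ, ∀ᶠ n in atTop, 0 < FRD.rate q (FRD.constV K / f c) n :=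
    fun q => (eventually_gt_atTop 0).mono fun n hn => FRD.rate_pos hA hn
  -- The common form of both cases: one scale `a`, one limit pair `t`, and one positive limit `G`
  -- for the two criteria divided by `a^p`. Both ratio statements follow by division.
  have main : ∃ (a : ℕ → ℝ) (t : FRD.Side → ℝ) (p : ℕ) (G : ℝ), 0 < G ∧ t ∈ FRD.bandwidths ∧
      (∀ᶠ n in atTop, 0 < a n) ∧ (∀ᶠ n in atTop, ∀ j, hAFO n j = a n * t j) ∧
      (∀ j, Tendsto (fun q : ℕ × Ω => hHat q.1 q.2 j / a q.1) (FRD.inProb P) (𝓝 (t j))) ∧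
      Tendsto (fun q : ℕ × Ω => FRD.MMSE K (phiHat q.1 q.2) (psiHat q.1 q.2) (fHat q.1 q.2)
        (omegaHat q.1 q.2) q.1 (hHat q.1 q.2) / a q.1 ^ p) (FRD.inProb P) (𝓝 G) ∧
      ∀ r : ℝ, 0 < r → r < |FRD.tauD κ c| → Tendsto (fun q : ℕ × Ω => FRD.tauD κ c ^ 2 *
        FRD.condMSE K κ c r (hAFO q.1) (fun i : Fin q.1 => X i q.2) / a q.1 ^ p)
        (FRD.inProb P) (𝓝 G) := by
    rcases hphi.lt_or_gt with hneg | hpos'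
    · obtain ⟨t, ht, hrate⟩ := FRD.exists_eq_rate_mul_of_neg hv hf.pos htauD homega hneg hAFO_def
      obtain ⟨hf1, hf2⟩ := FRD.tendsto_feasible_of_neg (ψ₀ := FRD.psi K f κ c) hv hf.pos homega hneg
        hN hφ hψ hω hg ht fun q => hHat_def q.1 q.2
      have ha0 := FRD.tendsto_rate (A := FRD.constV K / f c) (q := 5) (by norm_num)
      have hap : ∀ᶠ n : ℕ in atTop, FRD.rate 5 (FRD.constV K / f c) n ^ (4 + 1) =
          FRD.constV K / f c / n := Eventually.of_forall fun n => FRD.rate_pow (by norm_num) hA n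
      have hHpos := FRD.eventually_pos_of_rate (hpos 5) ht.1 (hmul hrate)
      have hH0 := FRD.tendsto_zero_of_rate ha0 (hmul hrate)
      have hnh : ∀ j, Tendsto (fun n : ℕ => (n : ℝ) * hAFO n j) atTop atTop := fun j => by
        refine (FRD.tendsto_mul_pow_atTop (hpos 5) ha0 hA hap (k := 1) (by norm_num)
          (ht.1 j)).congr' ?_
        filter_upwards [hmul hrate] with n hn
        rw [hn, pow_one]
      refine ⟨_, t, 4, _, ?_, ht.1, hpos 5, hmul hrate, hf1, hf2, fun r hr hrτ => ?_⟩
      · exact add_pos_of_nonneg_of_pos (sq_nonneg _) (FRD.invTerm_pos homega ht.1)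
      · refine hdes.tendsto_condMSE_div hK hf.pos hΔ hreg hHpos hH0 hnh hbin hr hrτ
          ((FRD.eventually_inProb_of_atTop (hpos 5)).mono fun q h => pow_pos h 4) ?_
        refine (((hdes.tendsto_bias_sq hK hf.pos hΔ hreg (hpos 5) ha0 ht.1 (hmul hrate) htauD
          hnh).pow 2).add (hdes.tendsto_variance hK hf.pos hΔ hreg (hpos 5) ha0 ht.1 (hmul hrate)
            (by norm_num) hap)).congr fun q => ?_
        rw [add_div, div_pow, ← pow_mul]
    · obtain ⟨t, ht, hrate⟩ := FRD.exists_eq_rate_mul_of_pos hv hf.pos htauD homega hpos' hAFO_def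
      obtain ⟨hf1, hf2⟩ := FRD.tendsto_feasible_of_pos hv hf.pos homega hpos' (hpsi hpos')
        hN hφ hψ hω hg ht fun q => hHat_def q.1 q.2
      have ha0 := FRD.tendsto_rate (A := FRD.constV K / f c) (q := 7) (by norm_num)
      have hap : ∀ᶠ n : ℕ in atTop, FRD.rate 7 (FRD.constV K / f c) n ^ (6 + 1) =
          FRD.constV K / f c / n := Eventually.of_forall fun n => FRD.rate_pow (by norm_num) hA n
      have hHpos := FRD.eventually_pos_of_rate (hpos 7) ht.1.1 (hmul hrate)
      have hH0 := FRD.tendsto_zero_of_rate ha0 (hmul hrate)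
      have hnhk : ∀ k < 7, ∀ j, Tendsto (fun n : ℕ => (n : ℝ) * hAFO n j ^ k) atTop atTop :=
        fun k hk j => by
          refine (FRD.tendsto_mul_pow_atTop (hpos 7) ha0 hA hap (k := k) hk (ht.1.1 j)).congr' ?_
          filter_upwards [hmul hrate] with n hn
          rw [hn]
      have hnh : ∀ j, Tendsto (fun n : ℕ => (n : ℝ) * hAFO n j) atTop atTop := fun j => by
        simpa using hnhk 1 (by norm_num) j
      refine ⟨_, t, 6, _, ?_, ht.1.1, hpos 7, hmul hrate, hf1, hf2, fun r hr hrτ => ?_⟩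
      · exact add_pos_of_nonneg_of_pos (sq_nonneg _) (FRD.invTerm_pos homega ht.1.1)
      · refine hdes.tendsto_condMSE_div hK hf.pos hΔ hreg hHpos hH0 hnh hbin hr hrτ
          ((FRD.eventually_inProb_of_atTop (hpos 7)).mono fun q h => pow_pos h 6) ?_
        -- The third-order bias converges to minus the cubic bias term; only its square matters.
        rw [← neg_sq]
        refine (((hdes.tendsto_bias_cube hK hf.pos hΔ hreg (hpos 7) ha0 ht.1.1 (hmul hrate) htauD
          ht.1.2 (hnhk 3 (by norm_num))).pow 2).add (hdes.tendsto_variance hK hf.pos hΔ hreg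
            (hpos 7) ha0 ht.1.1 (hmul hrate) (by norm_num) hap)).congr fun q => ?_
        rw [add_div, div_pow, ← pow_mul]
  obtain ⟨a, t, p, G, hG, ht, ha, hH, h1, h2, h3⟩ := main
  refine ⟨fun j => ?_, fun r hr hrτ => ?_, fun hneg j => ?_, fun hpos' j => ?_⟩
  · rw [← FRD.tendsto_inProb_iff]
    have := (h1 j).div_const (t j)
    rw [div_self (ht j).ne'] at this
    refine this.congr' ?_
    filter_upwards [FRD.eventually_inProb_of_atTop (P := P) hH] with q hq
    rw [hq, div_div]
  · rw [← FRD.tendsto_inProb_iff]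
    have := h2.div (h3 r hr hrτ) hG.ne'
    rw [div_self hG.ne'] at this
    refine this.congr' ?_
    filter_upwards [FRD.eventually_inProb_of_atTop (P := P) ha] with q hq
    exact div_div_div_cancel_right₀ (pow_ne_zero _ hq.ne') _ _
  · obtain ⟨t, ht, hrate⟩ := FRD.exists_eq_rate_mul_of_neg hv hf.pos htauD homega hneg hAFO_def
    simpa using FRD.isTheta_rate hA (ht.1 j).ne' fun n hn => hrate n hn j
  · obtain ⟨t, ht, hrate⟩ := FRD.exists_eq_rate_mul_of_pos hv hf.pos htauD homega hpos' hAFO_def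
    simpa using FRD.isTheta_rate hA (ht.1.1 j).ne' fun n hn => hrate n hn j
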